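/- Let $k$ be a field, $Q$ a finite quiver, and $\Lambda=kQ/\mathcal J$ a gentle algebra: $\mathcal J$ is an admissible ideal generated by paths of length $2$; at most two arrows start, and at most two arrows end, at any vertex; and for each arrow $y$ there is at most one arrow $x$ with $t(x)=h(y)$ and $xy\in\mathcal J$, at most one such $x$ with $xy\notin\mathcal J$, at most one arrow $z$ with $h(z)=t(y)$ and $yz\in\mathcal J$, and at most one such $z$ with $yz\notin\mathcal J$. (Here $t$ and $h$ denote tail and head, and $ba$ is the path $a$ followed by $b$.) Let $\mathbf P$ be the set of non-trivial paths not in $\mathcal J$; for $\gamma\in\mathbf P$ let $\mathrm f(\gamma)$ and $\mathrm l(\gamma)$ be its first and last arrow. A generalised $I$-word $[C]$, for $I=\{0,\dots,m\}$, $\mathbb N$, $-\mathbb N$ or $\mathbb Z$, is a sequence of letters $[C_i]$ (one for each $i\in I$ with $i-1\in I$), each of the form $[\gamma]$ or $[\gamma^{-1}]$ with $\gamma\in\mathbf P$, in which any two consecutive letters are of the form $[\gamma][\lambda^{-1}]$ with $h(\gamma)=h(\lambda)$, $\mathrm l(\gamma)\ne \mathrm l(\lambda)$; $[\gamma^{-1}][\lambda^{-1}]$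 with $t(\gamma)=h(\lambda)$, $\mathrm f(\gamma)\mathrm l(\lambda)\in\mathcal J$; $[\gamma^{-1}][\lambda]$ with $t(\gamma)=t(\lambda)$, $\mathrm f(\gamma)\neq \mathrm f(\lambda)$; or $[\gamma][\lambda]$ with $h(\gamma)=t(\lambda)$, $\mathrm f(\lambda)\mathrm l(\gamma)\in\mathcal J$. For $I=\{0\}$ there are instead the trivial words $[1_{v,\pm1}]$, one pair for each vertex $v$. A word is finite if $I$ is finite. Let $v_C(i)$ be the vertex between $[C_i]$ and $[C_{i+1}]$, where $[\gamma]$ leads from $t(\gamma)$ on its left to $h(\gamma)$ on its right and $[\gamma^{-1}]$ from $h(\gamma)$ to $t(\gamma)$; for a trivial word $v_C(0)=v$. Let $\mu_C:I\to\mathbb Z$ be given by $\mu_C(0)=0$ and $\mu_C(i)-\mu_C(i-1)=-1$ if $[C_i]=[\gamma]$, $=1$ if $[C_i]=[\gamma^{-1}]$. The complex $P(C)$ of projective left $\Lambda$-modules has $P^n(C)=\bigoplus_{\mu_C(i)=n}\Lambda e_{v_C(i)}$, with generator $b_i$ of the $i$-th summand, and $d(b_i)=b_i^-+b_i^+$,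 where $b_i^+=\gamma b_{i+1}$ if $[C_{i+1}]=[\gamma^{-1}]$, $b_i^-=\gamma b_{i-1}$ if $[C_i]=[\gamma]$, and $b_i^\pm=0$ otherwise. For a $\mathbb Z$-word, $[C[t]]$ is the $\mathbb Z$-word whose $i$-th letter is $[C_{i+t}]$; for other words $[C[t]]=[C]$. A $\mathbb Z$-word is periodic if $[C]=[C[p]]$ and $\mu_C(p)=0$ for some $p>0$, the least such $p$ being its period; words that are not periodic are aperiodic. A string complex is a complex $P(A)$ with $[A]$ aperiodic. If $[D]$ is periodic of period $p$, then $T$ acts on $P(D)$ by $b_i\mapsto b_{i-p}$, and for an indecomposable $k[T,T^{-1}]$-module $V$ the band complex is $P(D,V)=P(D)\otimes_{k[T,T^{-1}]}V$. Choose signs $s(a),s(a^{-1})\in\{\pm1\}$ for all arrows $a$ such that, with $h(a^{-1})=t(a)$, two distinct symbols with the same head have the same sign if and only if they are of the form $\alpha^{-1},\beta$ with $\alpha\beta\in\mathcal J$. For a finite word $[C]$ let $[C(\swarrow)]=[B][C]$ where $[B]=\dots[\alpha_2][\alpha_1]$ is the longest non-empty (finite or infinite) sequence of arrows for which $[B][C]$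 is a generalised word, and $[C(\swarrow)]=[C]$ if there is no such sequence. Similarly let $[C(\searrow)]=[C][E]$ where $[E]=[\gamma_1^{-1}][\gamma_2^{-1}]\dots$ is the longest non-empty sequence of inverses of arrows for which $[C][E]$ is a generalised word, and $[C(\searrow)]=[C]$ if there is none. Here, for trivial $[C]=[1_{v,\delta}]$, $[B][C]=[B]$ is admitted only if $h(\alpha_1)=v$ and $s(\alpha_1)=\delta$, and $[C][E]=[E]$ only if $h(\gamma_1)=v$ and $s(\gamma_1)=-\delta$. Let $[C(\swarrow\searrow)]=[B][C(\searrow)]$ if $[B]$ exists, and $[C(\searrow)]$ otherwise (if both ends are infinite, the letter of index $1$ is the first one after $[B]$). Let $\mathcal K^{+,b}(\Lambda\text{-}\mathbf{proj})$ be the full subcategory of the homotopy category of complexes of projective $\Lambda$-modules consisting of the objects isomorphic to a left-bounded complex of finitely generated projective $\Lambda$-modules with bounded cohomology. Then: (i) For a generalised word $[A]$, $P(A)$ is a string complex lying in $\mathcal K^{+,b}(\Lambda\text{-}\mathbf{proj})$ if and only if there are a finite generalised word $[C]$ and an integer $t$ such that $[A]=[C'[t]]$ where $[C']$ is one of $[C]$,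 $[C(\swarrow)]$, $[C(\searrow)]$, $[C(\swarrow\searrow)]$. In other words, up to shift, the string complexes in $\mathcal K^{+,b}(\Lambda\text{-}\mathbf{proj})$ are precisely the complexes $P(C)$, $P(C(\swarrow))$, $P(C(\searrow))$ and $P(C(\swarrow\searrow))$ with $[C]$ a finite generalised word. (ii) For a periodic word $[D]$ and an indecomposable $k[T,T^{-1}]$-module $V$, a shift of the band complex $P(D,V)$ lies in $\mathcal K^{+,b}(\Lambda\text{-}\mathbf{proj})$ if and only if $V$ is finite-dimensional over $k$. -/

import Mathlib

universe u

open CategoryTheory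
open scoped LaurentPolynomial TensorProduct

noncomputable section

namespace GentleAlgebra

/-! ### Quivers, paths and the path algebra -/

section PathAlgebra

variable (k : Type u) [Field k] (Q : Type u) [Quiver.{u} Q]

/-- The arrows of the quiver `Q`. -/
abbrev Arrow : Type u := Quiver.Total Q

variable {Q}

/-- The tail `t(a)` of an arrow. -/
abbrev Arrow.tail (a : Arrow Q) : Q := a.left

/-- The head `h(a)` of an arrow. -/
abbrev Arrow.head (a : Arrow Q) : Q := a.right

variable (Q)

/-- A path of `Q` (possibly trivial), with its tail and its head. -/
structure QPath : Type u where
  /-- the vertex where the path starts -/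
  tail : Q
  /-- the vertex where the path ends -/
  head : Q
  /-- the path itself -/
  path : Quiver.Path tail head

variable {Q}

namespace QPath

/-- The number of arrows in a path. -/
def length (p : QPath Q) : ℕ := p.path.length

/-- The trivial path at a vertex. -/
def triv (v : Q) : QPath Q := ⟨v, v, .nil⟩

/-- An arrow as a path of length one. -/
def ofArrow (a : Arrow Q) : QPath Q := ⟨a.tail, a.head, a.hom.toPath⟩

end QPath

/-- The first arrow of the path which traverses `p` and then the arrow `a`. -/
def firstArrowAux {v w : Q} (p : Quiver.Path v w) (a : Arrow Q) : Arrow Q :=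
  match p with
  | .nil => a
  | .cons q e => firstArrowAux q ⟨_, _, e⟩

variable (Q)

/-- A non-trivial path, presented as its last arrow preceded by a (possibly trivial) path. -/
structure NPath : Type u where
  /-- the tail of the path -/
  tail : Q
  /-- the last arrow of the path -/
  last : Arrow Q
  /-- the part of the path before its last arrow -/
  front : Quiver.Path tail last.tail

variable {Q}

namespace NPath

/-- The head of a non-trivial path. -/
def head (γ : NPath Q) : Q := γ.last.head

/-- The first arrow of a non-trivial path. -/
def first (γ : NPath Q) : Arrow Q := firstArrowAux γ.front γ.last

/-- A non-trivial path is a path. -/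
def toQPath (γ : NPath Q) : QPath Q := ⟨γ.tail, γ.head, γ.front.cons γ.last.hom⟩

/-- The length of a non-trivial path. -/
def length (γ : NPath Q) : ℕ := γ.toQPath.length

end NPath

variable (Q)

/-- The path algebra `kQ`: the vector space with basis the paths of `Q`. -/
def PathAlgebra : Type u := QPath Q →₀ k

namespace PathAlgebra

instance : AddCommGroup (PathAlgebra k Q) := inferInstanceAs (AddCommGroup (QPath Q →₀ k))
instance : Module k (PathAlgebra k Q) := inferInstanceAs (Module k (QPath Q →₀ k))

variable {Q}

/-- A path as an element of the path algebra. -/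
def of (p : QPath Q) : PathAlgebra k Q := Finsupp.single p 1

/-- The paths form a basis of the path algebra. -/
def basis : Module.Basis (QPath Q) k (PathAlgebra k Q) :=
  ⟨LinearEquiv.refl k (QPath Q →₀ k)⟩

theorem basis_apply (p : QPath Q) : basis k p = of k p := rfl

open Classical in
/-- The product `p q` of two paths: first `q`, then `p`, if the head of `q` is the tail of `p`, and
zero otherwise. -/
def mulPath (p q : QPath Q) : PathAlgebra k Q :=
  if h : q.head = p.tail then of k ⟨q.tail, p.head, q.path.comp (h ▸ p.path)⟩ else 0

/-- The multiplication of the path algebra: the bilinear extension of the product of paths. -/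
def mulHom : PathAlgebra k Q →ₗ[k] PathAlgebra k Q →ₗ[k] PathAlgebra k Q :=
  (basis k).constr k fun p => (basis k).constr k fun q => mulPath k p q

instance : Mul (PathAlgebra k Q) := ⟨fun x y => mulHom k x y⟩

theorem mul_def (x y : PathAlgebra k Q) : x * y = mulHom k x y := rfl

theorem of_mul_of (p q : QPath Q) : of k p * of k q = mulPath k p q := by
  rw [mul_def, mulHom, ← basis_apply, ← basis_apply, Module.Basis.constr_basis,
    Module.Basis.constr_basis]

@[elab_as_elim]
theorem induction {P : PathAlgebra k Q → Prop} (x : PathAlgebra k Q) (h0 : P 0)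
    (hadd : ∀ x y, P x → P y → P (x + y)) (hof : ∀ (c : k) p, P (c • of k p)) : P x := by
  refine Finsupp.induction_linear x h0 (fun f g hf hg => hadd f g hf hg) fun p c => ?_
  have h : (Finsupp.single p c : QPath Q →₀ k) = c • Finsupp.single p 1 := by simp
  rw [h]
  exact hof c p

theorem of_mul_of_comp {a b c : Q} (p : Quiver.Path b c) (q : Quiver.Path a b) :
    of k ⟨b, c, p⟩ * of k ⟨a, b, q⟩ = of k (⟨a, c, q.comp p⟩ : QPath Q) := by
  rw [of_mul_of]; simp [mulPath]

theorem of_cons {a b c : Q} (p : Quiver.Path a b) (e : b ⟶ c) :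
    of k (⟨a, c, p.cons e⟩ : QPath Q) = of k (QPath.ofArrow ⟨b, c, e⟩) * of k ⟨a, b, p⟩ :=
  (of_mul_of_comp k e.toPath p).symm

theorem of_mul_of_ne {p q : QPath Q} (h : q.head ≠ p.tail) : of k p * of k q = 0 := by
  rw [of_mul_of]; simp [mulPath, h]

protected theorem add_mul (x y z : PathAlgebra k Q) : (x + y) * z = x * z + y * z := by
  simp [mul_def]

protected theorem mul_add (x y z : PathAlgebra k Q) : x * (y + z) = x * y + x * z := by
  simp [mul_def]

protected theorem smul_mul (c : k) (x y : PathAlgebra k Q) : (c • x) * y = c • (x * y) := by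
  simp [mul_def]

protected theorem mul_smul (c : k) (x y : PathAlgebra k Q) : x * (c • y) = c • (x * y) := by
  simp [mul_def]

protected theorem zero_mul (x : PathAlgebra k Q) : 0 * x = 0 := by simp [mul_def]

protected theorem mul_zero (x : PathAlgebra k Q) : x * 0 = 0 := by simp [mul_def]

theorem of_mul_assoc (p q r : QPath Q) :
    of k p * of k q * of k r = of k p * (of k q * of k r) := by
  obtain ⟨a, b, p⟩ := p
  obtain ⟨c, d, q⟩ := q
  obtain ⟨e, f, r⟩ := r
  by_cases h1 : d = a
  · subst h1
    by_cases h2 : f = c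
    · subst h2
      simp only [of_mul_of_comp, Quiver.Path.comp_assoc]
    · rw [of_mul_of_comp, of_mul_of_ne k (p := ⟨c, _, _⟩) h2, of_mul_of_ne k (p := ⟨c, _, _⟩) h2,
        PathAlgebra.mul_zero]
  · rw [of_mul_of_ne k (p := ⟨a, _, _⟩) h1, PathAlgebra.zero_mul]
    by_cases h2 : f = c
    · subst h2
      rw [of_mul_of_comp, of_mul_of_ne k (p := ⟨a, _, _⟩) h1]
    · rw [of_mul_of_ne k (p := ⟨c, _, _⟩) h2, PathAlgebra.mul_zero]

protected theorem mul_assoc (x y z : PathAlgebra k Q) : x * y * z = x * (y * z) := by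
  induction x using induction with
  | h0 => simp [PathAlgebra.zero_mul]
  | hadd x x' hx hx' => simp only [PathAlgebra.add_mul, hx, hx']
  | hof c p =>
    induction y using induction with
    | h0 => simp [PathAlgebra.zero_mul, PathAlgebra.mul_zero]
    | hadd y y' hy hy' => simp only [PathAlgebra.add_mul, PathAlgebra.mul_add, hy, hy']
    | hof d q =>
      induction z using induction with
      | h0 => simp [PathAlgebra.mul_zero]
      | hadd z z' hz hz' => simp only [PathAlgebra.mul_add, hz, hz']
      | hof e r =>
        simp only [PathAlgebra.smul_mul, PathAlgebra.mul_smul, of_mul_assoc]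

variable [Fintype Q]

/-- The unit of the path algebra is the sum of the trivial paths. -/
instance : One (PathAlgebra k Q) := ⟨∑ v : Q, of k (QPath.triv v)⟩

theorem one_def : (1 : PathAlgebra k Q) = ∑ v : Q, of k (QPath.triv v) := rfl

protected theorem one_mul (x : PathAlgebra k Q) : 1 * x = x := by
  induction x using induction with
  | h0 => simp [PathAlgebra.mul_zero]
  | hadd x y hx hy => simp only [PathAlgebra.mul_add, hx, hy]
  | hof c p =>
    rw [PathAlgebra.mul_smul, one_def, mul_def, map_sum, LinearMap.sum_apply]
    congr 1
    obtain ⟨a, b, p⟩ := p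
    rw [Finset.sum_eq_single b]
    · exact (of_mul_of_comp k .nil p).trans (by simp)
    · intro v _ hv
      exact of_mul_of_ne k (Ne.symm hv)
    · simp

protected theorem mul_one (x : PathAlgebra k Q) : x * 1 = x := by
  induction x using induction with
  | h0 => simp [PathAlgebra.zero_mul]
  | hadd x y hx hy => simp only [PathAlgebra.add_mul, hx, hy]
  | hof c p =>
    rw [PathAlgebra.smul_mul, one_def, mul_def, map_sum]
    congr 1
    obtain ⟨a, b, p⟩ := p
    rw [Finset.sum_eq_single a]
    · exact (of_mul_of_comp k p .nil).trans (by simp)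
    · intro v _ hv
      exact of_mul_of_ne k hv
    · simp

instance : Ring (PathAlgebra k Q) :=
  { (inferInstance : AddCommGroup (PathAlgebra k Q)) with
    mul := (· * ·)
    one := 1
    left_distrib := PathAlgebra.mul_add k
    right_distrib := PathAlgebra.add_mul k
    zero_mul := PathAlgebra.zero_mul k
    mul_zero := PathAlgebra.mul_zero k
    mul_assoc := PathAlgebra.mul_assoc k
    one_mul := PathAlgebra.one_mul k
    mul_one := PathAlgebra.mul_one k }

instance : Algebra k (PathAlgebra k Q) :=
  Algebra.ofModule (PathAlgebra.smul_mul k) (PathAlgebra.mul_smul k)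

end PathAlgebra

end PathAlgebra

section Gentle

variable {k : Type u} [Field k] {Q : Type u} [Quiver.{u} Q] [Fintype Q]

variable (k) in
/-- An arrow as an element of the path algebra. -/
def arrow (a : Arrow Q) : PathAlgebra k Q := PathAlgebra.of k (QPath.ofArrow a)

variable (k Q) in
/-- The `m`-th power of the ideal generated by the arrows, that is, the ideal of `kQ` generated by
the paths of length `m`. -/
def arrowIdealPow (m : ℕ) : TwoSidedIdeal (PathAlgebra k Q) :=
  TwoSidedIdeal.span {x | ∃ p : QPath Q, p.length = m ∧ x = PathAlgebra.of k p}

/-- Admissible ideals of a path algebra. -/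
def IsAdmissible (J : TwoSidedIdeal (PathAlgebra k Q)) : Prop :=
  ∃ m : ℕ, 2 ≤ m ∧ arrowIdealPow k Q m ≤ J ∧ J ≤ arrowIdealPow k Q 2

/-- The conditions on the ideal `J` which say that `kQ / J` is a gentle algebra. -/
structure IsGentle (J : TwoSidedIdeal (PathAlgebra k Q)) : Prop where
  admissible : IsAdmissible J
  generated : ∃ S : Set (QPath Q), (∀ p ∈ S, p.length = 2) ∧
    J = TwoSidedIdeal.span (PathAlgebra.of k '' S)
  card_out_le (v : Q) : {a : Arrow Q | a.tail = v}.encard ≤ 2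
  card_in_le (v : Q) : {a : Arrow Q | a.head = v}.encard ≤ 2
  card_left_mem_le (y : Arrow Q) :
    {x : Arrow Q | x.tail = y.head ∧ arrow k x * arrow k y ∈ J}.encard ≤ 1
  card_right_mem_le (y : Arrow Q) :
    {z : Arrow Q | z.head = y.tail ∧ arrow k y * arrow k z ∈ J}.encard ≤ 1
  card_left_notMem_le (y : Arrow Q) :
    {x : Arrow Q | x.tail = y.head ∧ arrow k x * arrow k y ∉ J}.encard ≤ 1
  card_right_notMem_le (y : Arrow Q) :
    {z : Arrow Q | z.head = y.tail ∧ arrow k y * arrow k z ∉ J}.encard ≤ 1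

/-- The quotient algebra `Λ = kQ / J`. -/
abbrev Lam (J : TwoSidedIdeal (PathAlgebra k Q)) : Type u := J.ringCon.Quotient

/-- The coset in `Λ` of a path. -/
def pathClass (J : TwoSidedIdeal (PathAlgebra k Q)) (p : QPath Q) : Lam J :=
  J.ringCon.mk' (PathAlgebra.of k p)

/-- The idempotent `e_v` of `Λ`. -/
def idem (J : TwoSidedIdeal (PathAlgebra k Q)) (v : Q) : Lam J := pathClass J (QPath.triv v)

variable (J : TwoSidedIdeal (PathAlgebra k Q))

theorem mk_eq_zero_iff (x : PathAlgebra k Q) : J.ringCon.mk' x = 0 ↔ x ∈ J := by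
  rw [TwoSidedIdeal.mem_iff, ← map_zero J.ringCon.mk']
  exact RingCon.eq _

theorem pathClass_comp {a b c : Q} (p : Quiver.Path b c) (q : Quiver.Path a b) :
    pathClass J ⟨b, c, p⟩ * pathClass J ⟨a, b, q⟩ = pathClass J ⟨a, c, q.comp p⟩ := by
  rw [pathClass, pathClass, ← map_mul, PathAlgebra.of_mul_of_comp]; rfl

theorem pathClass_mul_idem (p : QPath Q) : pathClass J p * idem J p.tail = pathClass J p :=
  (pathClass_comp J p.path .nil).trans (by rw [Quiver.Path.nil_comp])

/-! ### Generalised letters and generalised words -/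

/-- The generalised letters `[γ]` and `[γ⁻¹]`, where `γ` is a non-trivial path not in `J`. -/
structure Letter : Type u where
  /-- the path `γ` -/
  path : NPath Q
  notMem : PathAlgebra.of k path.toQPath ∉ J
  /-- whether the letter is `[γ⁻¹]` rather than `[γ]` -/
  isInv : Bool

variable {J}

namespace Letter

/-- The head of a generalised letter: `h([γ]) = t(γ)` and `h([γ⁻¹]) = h(γ)`. -/
def head (l : Letter J) : Q := if l.isInv then l.path.head else l.path.tail

/-- The tail of a generalised letter: `t([γ]) = h(γ)` and `t([γ⁻¹]) = t(γ)`. -/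
def tail (l : Letter J) : Q := if l.isInv then l.path.tail else l.path.head

/-- The inverse of a generalised letter. -/
def inv (l : Letter J) : Letter J := { l with isInv := !l.isInv }

/-- The coset in `Λ` of the path of a generalised letter. -/
def cls (l : Letter J) : Lam J := pathClass J l.path.toQPath

/-- The degree `H[γ] = -1`, `H[γ⁻¹] = 1`. -/
def deg (l : Letter J) : ℤ := if l.isInv then 1 else -1

/-- The generalised letters `[a]` and `[b]` may be consecutive in a generalised word. -/
def Adj (a b : Letter J) : Prop :=
  match a.isInv, b.isInv with
  | false, true => a.path.head = b.path.head ∧ a.path.last ≠ b.path.last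
  | true, true => a.path.tail = b.path.head ∧ arrow k a.path.first * arrow k b.path.last ∈ J
  | true, false => a.path.tail = b.path.tail ∧ a.path.first ≠ b.path.first
  | false, false => a.path.head = b.path.tail ∧ arrow k b.path.first * arrow k a.path.last ∈ J

theorem Adj.tail_eq {a b : Letter J} (h : a.Adj b) : a.tail = b.head := by
  unfold Adj at h
  cases ha : a.isInv <;> cases hb : b.isInv <;> simp_all [tail, head]

end Letter

variable (J)

/-- Sequences of generalised letters, indexed by `{0}` (trivial), by `{0, …, m}`, by `ℕ`, by `-ℕ`
or by `ℤ`. -/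
inductive PreWord : Type u
  /-- the trivial sequence `1_{v,δ}` -/
  | triv (v : Q) (δ : ℤˣ) : PreWord
  /-- the sequence `[L₁]⋯[L_m]` -/
  | fin (L : List (Letter J)) : PreWord
  /-- the sequence `[C₁][C₂]⋯` with `C_{j+1} = f j` -/
  | nat (f : ℕ → Letter J) : PreWord
  /-- the sequence `⋯[C₋₁][C₀]` with `C_{-j} = f j` -/
  | neg (f : ℕ → Letter J) : PreWord
  /-- the sequence `⋯[C₀]:[C₁]⋯` with `C_j = f j` -/
  | int (f : ℤ → Letter J) : PreWord

variable {J}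

namespace PreWord

/-- The letter `C_i`, if there is one. -/
def letterAt : PreWord J → ℤ → Option (Letter J)
  | triv _ _, _ => none
  | fin L, i => if 1 ≤ i then L[(i - 1).toNat]? else none
  | nat f, i => if 1 ≤ i then some (f (i - 1).toNat) else none
  | neg f, i => if i ≤ 0 then some (f (-i).toNat) else none
  | int f, i => some (f i)

/-- A generalised word: trivial, or a non-empty sequence of generalised letters any two consecutive
ones of which satisfy the adjacency condition. -/
def IsWord : PreWord J → Prop
  | triv _ _ => True
  | fin L => L ≠ [] ∧ L.IsChain Letter.Adj
  | nat f => ∀ j, (f j).Adj (f (j + 1))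
  | neg f => ∀ j, (f (j + 1)).Adj (f j)
  | int f => ∀ j, (f j).Adj (f (j + 1))

theorem IsWord.adj {C : PreWord J} (hC : C.IsWord) {i : ℤ} {a b : Letter J}
    (ha : C.letterAt i = some a) (hb : C.letterAt (i + 1) = some b) : a.Adj b := by
  cases C with
  | triv v δ => simp [letterAt] at ha
  | fin L =>
    simp only [letterAt] at ha hb
    split_ifs at ha hb with h1 h2
    obtain ⟨n, hn⟩ : ∃ n : ℕ, i = n + 1 := ⟨(i - 1).toNat, by omega⟩
    subst hn
    have e1 : ((n : ℤ) + 1 - 1).toNat = n := by omega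
    have e2 : ((n : ℤ) + 1 + 1 - 1).toNat = n + 1 := by omega
    rw [e1] at ha
    rw [e2] at hb
    obtain ⟨hn1, rfl⟩ := List.getElem?_eq_some_iff.1 ha
    obtain ⟨hn2, rfl⟩ := List.getElem?_eq_some_iff.1 hb
    exact List.isChain_iff_getElem.1 hC.2 n hn2
  | nat f =>
    simp only [letterAt] at ha hb
    split_ifs at ha hb with h1 h2
    obtain ⟨n, hn⟩ : ∃ n : ℕ, i = n + 1 := ⟨(i - 1).toNat, by omega⟩
    subst hn
    have e1 : ((n : ℤ) + 1 - 1).toNat = n := by omega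
    have e2 : ((n : ℤ) + 1 + 1 - 1).toNat = n + 1 := by omega
    rw [e1, Option.some_inj] at ha
    rw [e2, Option.some_inj] at hb
    subst ha hb
    exact hC n
  | neg f =>
    simp only [letterAt] at ha hb
    split_ifs at ha hb with h1 h2
    obtain ⟨n, hn⟩ : ∃ n : ℕ, i = -((n : ℤ) + 1) := ⟨(-i - 1).toNat, by omega⟩
    subst hn
    have e1 : (- -((n : ℤ) + 1)).toNat = n + 1 := by omega
    have e2 : (-(-((n : ℤ) + 1) + 1)).toNat = n := by omega
    rw [e1, Option.some_inj] at ha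
    rw [e2, Option.some_inj] at hb
    subst ha hb
    exact hC n
  | int f =>
    simp only [letterAt, Option.some_inj] at ha hb
    subst ha hb
    exact hC i

/-- The vertex `v_C(i)` for `i` in the index set of `C`, and `none` outside the index set: it is
the tail of `C_i` and the head of `C_{i+1}`. -/
def vertexAt (C : PreWord J) (i : ℤ) : Option Q :=
  match C, C.letterAt i, C.letterAt (i + 1) with
  | triv v _, _, _ => if i = 0 then some v else none
  | _, some l, _ => some l.tail
  | _, none, some l => some l.head
  | _, none, none => none

/-- The degree of the letter `C_i`, and zero if there is no such letter. -/
def degAt (C : PreWord J) (i : ℤ) : ℤ := ((C.letterAt i).map Letter.deg).getD 0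

/-- The function `μ_C`: it is `H[C₁] + ⋯ + H[C_i]` for `i ≥ 0` and `-(H[C₀] + ⋯ + H[C_{i+1}])` for
`i ≤ 0`. -/
def mu (C : PreWord J) (i : ℤ) : ℤ :=
  ∑ j ∈ Finset.Ioc 0 i, C.degAt j - ∑ j ∈ Finset.Ioc i 0, C.degAt j

/-- The shift `C[t]` of a sequence of generalised letters. -/
def shift (t : ℤ) : PreWord J → PreWord J
  | int f => int fun i => f (i + t)
  | C => C

/-- The number of letters of a sequence of generalised letters. -/
def length : PreWord J → ℕ∞
  | triv _ _ => 0
  | fin L => L.length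
  | nat _ => ⊤
  | neg _ => ⊤
  | int _ => ⊤

/-- The concatenation `B C`. It is meaningful if `B` has a right end and `C` has a left end; the
value is `B` in the other cases. -/
def concat : PreWord J → PreWord J → PreWord J
  | triv _ _, C => C
  | B, triv _ _ => B
  | fin L, fin M => fin (L ++ M)
  | fin L, nat f => nat fun j => if h : j < L.length then L[j] else f (j - L.length)
  | neg f, fin L => neg fun j =>
      if h : j < L.length then L[L.length - 1 - j] else f (j - L.length)
  | neg f, nat g => int fun i => if i ≤ 0 then f (-i).toNat else g (i - 1).toNat
  | B, _ => B

end PreWord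

variable (J)

/-- Generalised words. -/
structure Word : Type u where
  /-- the underlying sequence of generalised letters -/
  pre : PreWord J
  isWord : pre.IsWord

/-- A choice of a sign for each of the symbols `a = (a, false)` and `a⁻¹ = (a, true)`, for `a` an
arrow. Here `h(a⁻¹) = t(a)`. -/
structure SignChoice where
  /-- the sign of a symbol -/
  sign : Arrow Q × Bool → ℤˣ
  sign_eq_iff (l l' : Arrow Q × Bool) (hne : l ≠ l')
    (hhead : (if l.2 then l.1.tail else l.1.head) = if l'.2 then l'.1.tail else l'.1.head) :
    sign l = sign l' ↔ ∃ a b : Arrow Q, arrow k a * arrow k b ∈ J ∧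
      ((l = (a, true) ∧ l' = (b, false)) ∨ (l = (b, false) ∧ l' = (a, true)))

variable {J}

/-- The sign of a generalised letter: `s([γ]) = s(f(γ)⁻¹)` and `s([γ⁻¹]) = -s(l(γ))`. -/
def SignChoice.letterSign (s : SignChoice J) (l : Letter J) : ℤˣ :=
  if l.isInv then -s.sign (l.path.last, false) else s.sign (l.path.first, true)

namespace PreWord

/-- The head and the sign of `C`, if `C` has a left end. -/
def headSign (s : SignChoice J) : PreWord J → Option (Q × ℤˣ)
  | triv v δ => some (v, δ)
  | fin L => L.head?.map fun l => (l.head, s.letterSign l)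
  | nat f => some ((f 0).head, s.letterSign (f 0))
  | _ => none

/-- The head and the sign of `C⁻¹`, if `C` has a right end. -/
def invHeadSign (s : SignChoice J) : PreWord J → Option (Q × ℤˣ)
  | triv v δ => some (v, -δ)
  | fin L => L.getLast?.map fun l => (l.inv.head, s.letterSign l.inv)
  | neg f => some ((f 0).inv.head, s.letterSign (f 0).inv)
  | _ => none

/-- The composition `B C` is defined and is again a generalised word. -/
structure Composable (s : SignChoice J) (B C : PreWord J) : Prop where
  isWord : (B.concat C).IsWord
  right_triv (v : Q) (δ : ℤˣ) (h : C = triv v δ) : B.invHeadSign s = some (v, -δ)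
  left_triv (v : Q) (δ : ℤˣ) (h : B = triv v δ) : C.headSign s = some (v, δ)

end PreWord

namespace Word

/-- A finite generalised word. -/
def IsFinite (C : Word J) : Prop :=
  (∃ v δ, C.pre = .triv v δ) ∨ ∃ L, C.pre = .fin L

/-- The shift `C[t]`. -/
def shift (t : ℤ) (C : Word J) : Word J :=
  ⟨C.pre.shift t, by
    obtain ⟨C, hC⟩ := C
    cases C with
    | int f => intro j; simpa [add_right_comm] using hC (j + t)
    | _ => exact hC⟩

/-- `C` is a `ℤ`-word with `C = C[p]` and `μ_C(p) = 0`. -/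
def HasPeriod (C : Word J) (p : ℕ) : Prop :=
  (∃ f, C.pre = .int f) ∧ C = C.shift p ∧ C.pre.mu p = 0

/-- Periodic generalised words. -/
def IsPeriodic (C : Word J) : Prop := ∃ p : ℕ, 0 < p ∧ C.HasPeriod p

/-- Aperiodic generalised words. -/
def IsAperiodic (C : Word J) : Prop := ¬ C.IsPeriodic

/-- The period of a periodic generalised word. -/
def period (C : Word J) : ℕ := sInf {p : ℕ | 0 < p ∧ C.HasPeriod p}

/-- The set of the non-trivial sequences `⋯[α₂][α₁]` of arrows, finite or indexed by `-ℕ`, whose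
concatenation with `C` on the right is a generalised word. -/
def swSet (s : SignChoice J) (C : Word J) : Set (PreWord J) :=
  {B | ((∃ L, L ≠ [] ∧ B = .fin L) ∨ ∃ f, B = .neg f) ∧
    (∀ i l, B.letterAt i = some l → l.isInv = false ∧ l.path.length = 1) ∧
    B.Composable s C.pre}

/-- The set of the non-trivial sequences `[γ₁⁻¹][γ₂⁻¹]⋯` of inverses of arrows, finite or indexed
by `ℕ`, whose concatenation with `C` on the left is a generalised word. -/
def seSet (s : SignChoice J) (C : Word J) : Set (PreWord J) :=
  {D | ((∃ L, L ≠ [] ∧ D = .fin L) ∨ ∃ f, D = .nat f) ∧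
    (∀ i l, D.letterAt i = some l → l.isInv = true ∧ l.path.length = 1) ∧
    C.pre.Composable s D}

/-- `B` is the longest element of a set of sequences. -/
def IsLongest (W : Set (PreWord J)) (B : PreWord J) : Prop :=
  B ∈ W ∧ ∀ B' ∈ W, B'.length ≤ B.length

open Classical in
/-- The generalised word `C(↙)`, for a finite generalised word `C`. -/
def sw (s : SignChoice J) (C : Word J) : Word J :=
  if h : ∃ B, IsLongest (C.swSet s) B then ⟨h.choose.concat C.pre, h.choose_spec.1.2.2.isWord⟩ else C

open Classical in
/-- The generalised word `C(↘)`, for a finite generalised word `C`. -/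
def se (s : SignChoice J) (C : Word J) : Word J :=
  if h : ∃ D, IsLongest (C.seSet s) D then ⟨C.pre.concat h.choose, h.choose_spec.1.2.2.isWord⟩ else C

end Word

namespace PreWord

/-- The first letter of a sequence of generalised letters with a left end. -/
def firstLetter : PreWord J → Option (Letter J)
  | fin L => L.head?
  | nat f => some (f 0)
  | _ => none

/-- The last letter of a sequence of generalised letters with a right end. -/
def lastLetter : PreWord J → Option (Letter J)
  | fin L => L.getLast?
  | neg f => some (f 0)
  | _ => none

theorem isWord_concat {B E : PreWord J} (hB : B.IsWord) (hE : E.IsWord)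
    (h : ∀ a ∈ B.lastLetter, ∀ b ∈ E.firstLetter, a.Adj b) : (B.concat E).IsWord := by
  cases B with
  | triv v δ => exact hE
  | nat f => cases E <;> exact hB
  | int f => cases E <;> exact hB
  | fin L =>
    cases E with
    | triv v δ => exact hB
    | neg f => exact hB
    | int f => exact hB
    | fin M =>
      exact ⟨by simp [hB.1], List.isChain_append.2 ⟨hB.2, hE.2, h⟩⟩
    | nat f =>
      intro j
      have hlast : ∀ hj : j < L.length, j + 1 = L.length → L[j] ∈ L.getLast? := by
        intro hj hj'
        rw [Option.mem_def, List.getLast?_eq_getElem?]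
        have : L.length - 1 = j := by omega
        rw [this, List.getElem?_eq_getElem hj]
      rcases lt_trichotomy (j + 1) L.length with h1 | h1 | h1
      · have h2 : j < L.length := by omega
        simp only [h1, h2, dite_true]
        exact List.isChain_iff_getElem.1 hB.2 j h1
      · have h2 : j < L.length := by omega
        have h3 : ¬ j + 1 < L.length := by omega
        simp only [h2, h3, dite_true, dite_false]
        have h4 : j + 1 - L.length = 0 := by omega
        rw [h4]
        exact h _ (hlast h2 h1) _ rfl
      · have h2 : ¬ j < L.length := by omega
        have h3 : ¬ j + 1 < L.length := by omega
        simp only [h2, h3, dite_false]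
        have h4 : j + 1 - L.length = (j - L.length) + 1 := by omega
        rw [h4]
        exact hE _
  | neg f =>
    cases E with
    | triv v δ => exact hB
    | neg f => exact hB
    | int f => exact hB
    | fin L =>
      intro j
      rcases lt_trichotomy (j + 1) L.length with h1 | h1 | h1
      · have h2 : j < L.length := by omega
        simp only [h1, h2, dite_true]
        have h4 := List.isChain_iff_getElem.1 hE.2 (L.length - 1 - (j + 1)) (by omega)
        have h5 : L.length - 1 - (j + 1) + 1 = L.length - 1 - j := by omega
        simpa only [h5] using h4
      · have h2 : j < L.length := by omega
        have h3 : ¬ j + 1 < L.length := by omega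
        simp only [h2, h3, dite_true, dite_false]
        have h4 : j + 1 - L.length = 0 := by omega
        have h5 : L.length - 1 - j = 0 := by omega
        simp only [h4, h5]
        refine h _ rfl _ ?_
        rw [firstLetter, Option.mem_def, List.head?_eq_getElem?, List.getElem?_eq_getElem]
      · have h2 : ¬ j < L.length := by omega
        have h3 : ¬ j + 1 < L.length := by omega
        simp only [h2, h3, dite_false]
        have h4 : j + 1 - L.length = (j - L.length) + 1 := by omega
        rw [h4]
        exact hB _
    | nat g =>
      intro j
      rcases lt_trichotomy j 0 with h1 | h1 | h1
      · have h2 : j ≤ 0 := by omega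
        have h3 : j + 1 ≤ 0 := by omega
        simp only [h2, h3, if_true]
        have h4 : (-j).toNat = (-(j + 1)).toNat + 1 := by omega
        rw [h4]
        exact hB _
      · subst h1
        simpa using h _ rfl _ rfl
      · have h2 : ¬ j ≤ 0 := by omega
        have h3 : ¬ j + 1 ≤ 0 := by omega
        simp only [h2, h3, if_false]
        have h4 : (j + 1 - 1).toNat = (j - 1).toNat + 1 := by omega
        rw [h4]
        exact hE _

theorem isWord_of_concat_fin {B : PreWord J} {M : List (Letter J)} (hM : M ≠ [])
    (hBs : (∃ L, L ≠ [] ∧ B = .fin L) ∨ ∃ f, B = .neg f) (h : (B.concat (.fin M)).IsWord) :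
    B.IsWord ∧ ∀ a ∈ B.lastLetter, ∀ b ∈ M.head?, a.Adj b := by
  rcases hBs with ⟨L, hL, rfl⟩ | ⟨f, rfl⟩
  · obtain ⟨h1, h2, h3⟩ := List.isChain_append.1 h.2
    exact ⟨⟨hL, h1⟩, h3⟩
  · have hM' : 0 < M.length := List.length_pos_iff.2 hM
    refine ⟨fun j => ?_, ?_⟩
    · have h1 := h (j + M.length)
      have h2 : ¬ j + M.length < M.length := by omega
      have h3 : ¬ j + M.length + 1 < M.length := by omega
      simp only [h2, h3, dite_false] at h1
      have h4 : j + M.length + 1 - M.length = j + 1 := by omega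
      rw [h4, Nat.add_sub_cancel] at h1
      exact h1
    · intro a ha b hb
      have h1 := h (M.length - 1)
      have h2 : M.length - 1 < M.length := by omega
      have h3 : ¬ M.length - 1 + 1 < M.length := by omega
      simp only [h2, h3, dite_true, dite_false] at h1
      have h4 : M.length - 1 + 1 - M.length = 0 := by omega
      simp only [h4, Nat.sub_self] at h1
      rw [List.head?_eq_getElem?, List.getElem?_eq_getElem hM', Option.mem_def,
        Option.some_inj] at hb
      obtain rfl : f 0 = a := by simpa [lastLetter] using ha
      subst hb
      exact h1

end PreWord

namespace Word

theorem isWord_concat_concat {s : SignChoice J} {C : Word J} {B D : PreWord J}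
    (hB : B ∈ C.swSet s) (hD : D ∈ C.seSet s) : (B.concat (C.pre.concat D)).IsWord := by
  obtain ⟨hB1, hB2, hB3⟩ := hB
  obtain ⟨hD1, hD2, hD3⟩ := hD
  obtain ⟨C, hC⟩ := C
  cases C with
  | triv v δ =>
    have hBw : B.IsWord := by
      rcases hB1 with ⟨L, hL, rfl⟩ | ⟨f, rfl⟩ <;> exact hB3.isWord
    refine PreWord.isWord_concat hBw hD3.isWord fun a ha b hb => ?_
    have hb' : b ∈ D.firstLetter := hb
    have ha1 : a.isInv = false ∧ a.head = a.path.tail ∧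
        (a.inv.head, s.letterSign a.inv) = (v, -δ) := by
      have h3 := hB3.right_triv v δ rfl
      rcases hB1 with ⟨L, hL, rfl⟩ | ⟨f, rfl⟩
      · have ha2 : L.getLast? = some a := ha
        have h4 : a.isInv = false := by
          refine (hB2 L.length a ?_).1
          rw [List.getLast?_eq_getElem?] at ha2
          have := List.length_pos_iff.2 hL
          have h6 : (1 : ℤ) ≤ L.length := by omega
          have h7 : ((L.length : ℤ) - 1).toNat = L.length - 1 := by omega
          simp only [PreWord.letterAt, h6, if_true, h7, ha2]
        refine ⟨h4, by simp [Letter.head, h4], ?_⟩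
        simpa [PreWord.invHeadSign, ha2] using h3
      · obtain rfl : f 0 = a := by simpa [PreWord.lastLetter] using ha
        have h4 : (f 0).isInv = false := (hB2 0 (f 0) (by simp [PreWord.letterAt])).1
        refine ⟨h4, by simp [Letter.head, h4], ?_⟩
        simpa [PreWord.invHeadSign] using h3
    have hb1 : b.isInv = true ∧ (b.head, s.letterSign b) = (v, δ) := by
      have h3 := hD3.left_triv v δ rfl
      rcases hD1 with ⟨L, hL, rfl⟩ | ⟨f, rfl⟩
      · have hb2 : L.head? = some b := hb
        have h4 : b.isInv = true := by
          refine (hD2 1 b ?_).1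
          rw [List.head?_eq_getElem?] at hb2
          simp [PreWord.letterAt, hb2]
        refine ⟨h4, ?_⟩
        simpa [PreWord.headSign, hb2] using h3
      · obtain rfl : f 0 = b := by simpa [PreWord.firstLetter] using hb'
        have h4 : (f 0).isInv = true := (hD2 1 (f 0) (by simp [PreWord.letterAt])).1
        refine ⟨h4, ?_⟩
        simpa [PreWord.headSign] using h3
    obtain ⟨ha1, -, ha3⟩ := ha1
    obtain ⟨hb1, hb3⟩ := hb1
    simp only [Prod.mk.injEq, Letter.inv, Letter.head, ha1, SignChoice.letterSign] at ha3
    simp only [Prod.mk.injEq, Letter.head, hb1, SignChoice.letterSign] at hb3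
    simp only [Letter.Adj, ha1, hb1]
    refine ⟨by simpa using ha3.1.trans hb3.1.symm, fun he => ?_⟩
    have h1 := ha3.2
    have h2 := hb3.2
    simp only [Bool.not_false, if_true, he] at h1 h2
    rw [h2] at h1
    rcases Int.units_eq_one_or δ with rfl | rfl <;> simp at h1
  | fin M =>
    obtain ⟨h1, h2⟩ := PreWord.isWord_of_concat_fin hC.1 hB1 hB3.isWord
    refine PreWord.isWord_concat h1 hD3.isWord fun a ha b hb => h2 a ha b ?_
    have hM : 0 < M.length := List.length_pos_iff.2 hC.1
    rcases hD1 with ⟨L, hL, rfl⟩ | ⟨f, rfl⟩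
    · have hb' : b ∈ (M ++ L).head? := hb
      rw [List.head?_append_of_ne_nil _ hC.1] at hb'
      exact hb'
    · have hb' : (if h : 0 < M.length then M[0] else f (0 - M.length)) = b := by
        simpa [PreWord.concat, PreWord.firstLetter] using hb
      simp only [hM, dite_true] at hb'
      rw [List.head?_eq_getElem?, List.getElem?_eq_getElem hM, hb']; rfl
  | nat f => exact (by rcases hD1 with ⟨L, hL, rfl⟩ | ⟨g, rfl⟩ <;> exact hB3.isWord)
  | int f => exact (by rcases hD1 with ⟨L, hL, rfl⟩ | ⟨g, rfl⟩ <;> exact hB3.isWord)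
  | neg f =>
    rcases hB1 with ⟨L, hL, rfl⟩ | ⟨g, rfl⟩ <;> rcases hD1 with ⟨L, hL, rfl⟩ | ⟨g, rfl⟩ <;>
      exact hB3.isWord

theorem isWord_concat_se {s : SignChoice J} {C : Word J} {B : PreWord J}
    (hB : B ∈ C.swSet s) : (B.concat (C.se s).pre).IsWord := by
  unfold se
  by_cases h : ∃ D, IsLongest (C.seSet s) D
  · rw [dif_pos h]
    exact isWord_concat_concat hB h.choose_spec.1
  · rw [dif_neg h]
    exact hB.2.2.isWord

open Classical in
/-- The generalised word `C(↙↘)`, for a finite generalised word `C`. -/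
def swse (s : SignChoice J) (C : Word J) : Word J :=
  if h : ∃ B, IsLongest (C.swSet s) B then
    ⟨h.choose.concat (C.se s).pre, isWord_concat_se h.choose_spec.1⟩
  else C.se s

end Word

/-! ### String complexes -/

namespace PreWord

theorem mu_succ (C : PreWord J) (i : ℤ) : C.mu (i + 1) = C.mu i + C.degAt (i + 1) := by
  unfold mu
  rcases lt_or_ge i 0 with h | h
  · have h1 : Finset.Ioc 0 (i + 1) = ∅ := Finset.Ioc_eq_empty (by omega)
    have h2 : Finset.Ioc 0 i = ∅ := Finset.Ioc_eq_empty (by omega)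
    have h3 : Finset.Ioc i 0 = insert (i + 1) (Finset.Ioc (i + 1) 0) := by
      ext j; simp only [Finset.mem_Ioc, Finset.mem_insert]; omega
    rw [h1, h2, h3, Finset.sum_insert (by simp)]
    simp
  · have h1 : Finset.Ioc (i + 1) 0 = ∅ := Finset.Ioc_eq_empty (by omega)
    have h2 : Finset.Ioc i 0 = ∅ := Finset.Ioc_eq_empty (by omega)
    have h3 : Finset.Ioc 0 (i + 1) = insert (i + 1) (Finset.Ioc 0 i) := by
      ext j; simp only [Finset.mem_Ioc, Finset.mem_insert]; omega
    rw [h1, h2, h3, Finset.sum_insert (by simp)]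
    simp [add_comm]

/-- The left ideal `Λ e_{v_C(i)}` if `i` lies in the index set and `μ_C(i) = n`, and zero
otherwise. -/
def stalk (C : PreWord J) (n i : ℤ) : Submodule (Lam J) (Lam J) :=
  if C.mu i = n then
    match C.vertexAt i with
    | some v => Ideal.span {idem J v}
    | none => ⊥
  else ⊥

/-- The homogeneous component `Pⁿ(C)`, the direct sum of the left ideals `Λ e_{v_C(i)}` with `i` in
the index set and `μ_C(i) = n`. It is realised inside the free module with basis `(b_i)_{i ∈ ℤ}`. -/
def comp (C : PreWord J) (n : ℤ) : Submodule (Lam J) (ℤ →₀ Lam J) where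
  carrier := {f | ∀ i, f i ∈ C.stalk n i}
  add_mem' hf hg i := (C.stalk n i).add_mem (hf i) (hg i)
  zero_mem' i := (C.stalk n i).zero_mem
  smul_mem' c _ hf i := (C.stalk n i).smul_mem c (hf i)

/-- `b_i⁺`, which is `γ b_{i+1}` if `C_{i+1} = [γ⁻¹]`, and zero otherwise. -/
def bPlus (C : PreWord J) (i : ℤ) : ℤ →₀ Lam J :=
  match C.letterAt (i + 1) with
  | some l => if l.isInv then Finsupp.single (i + 1) l.cls else 0
  | none => 0

/-- `b_i⁻`, which is `γ b_{i-1}` if `C_i = [γ]`, and zero otherwise. -/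
def bMinus (C : PreWord J) (i : ℤ) : ℤ →₀ Lam J :=
  match C.letterAt i with
  | some l => if l.isInv then 0 else Finsupp.single (i - 1) l.cls
  | none => 0

/-- The `Λ`-linear map with `b_i ↦ b_i⁻ + b_i⁺`. -/
def diff (C : PreWord J) : (ℤ →₀ Lam J) →ₗ[Lam J] (ℤ →₀ Lam J) :=
  Finsupp.linearCombination (Lam J) fun i => C.bMinus i + C.bPlus i

end PreWord

theorem Letter.cls_mul_idem (l : Letter J) : l.cls * idem J l.path.tail = l.cls :=
  pathClass_mul_idem J l.path.toQPath

theorem exists_of_eq_mul_first (γ : NPath Q) :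
    ∃ x, PathAlgebra.of k γ.toQPath = x * arrow k γ.first := by
  suffices h : ∀ {a b : Q} (p : Quiver.Path a b) (c : Q) (e : b ⟶ c),
      ∃ x, PathAlgebra.of k (⟨a, c, p.cons e⟩ : QPath Q) =
        x * arrow k (firstArrowAux p ⟨b, c, e⟩) from h γ.front _ γ.last.hom
  intro a b p
  induction p with
  | nil => exact fun c e => ⟨1, by rw [one_mul]; rfl⟩
  | @cons b' b p e' ih =>
    intro c e
    obtain ⟨x, hx⟩ := ih b e'
    refine ⟨arrow k ⟨b, c, e⟩ * x, ?_⟩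
    rw [PathAlgebra.of_cons, hx, mul_assoc]
    rfl

/-- If the product of the first arrow of `γ` and the last arrow of `δ` lies in `J` then so does the
product of `γ` and `δ`. -/
theorem pathClass_mul_eq_zero {γ δ : NPath Q} (h : arrow k γ.first * arrow k δ.last ∈ J) :
    pathClass J γ.toQPath * pathClass J δ.toQPath = 0 := by
  obtain ⟨x, hx⟩ := exists_of_eq_mul_first (k := k) γ
  have hδ : PathAlgebra.of k δ.toQPath =
      arrow k δ.last * PathAlgebra.of k ⟨δ.tail, δ.last.tail, δ.front⟩ := PathAlgebra.of_cons k δ.front δ.last.hom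
  rw [pathClass, pathClass, ← map_mul, mk_eq_zero_iff, hx, hδ]
  have h1 := J.mul_mem_right _ (PathAlgebra.of k ⟨δ.tail, δ.last.tail, δ.front⟩)
    (J.mul_mem_left x _ h)
  simpa only [mul_assoc] using h1

namespace PreWord

theorem vertexAt_of_letterAt {C : PreWord J} {i : ℤ} {l : Letter J} (h : C.letterAt i = some l) :
    C.vertexAt i = some l.tail := by
  unfold vertexAt
  cases C with
  | triv v δ => simp [letterAt] at h
  | _ => simp only [h]

theorem vertexAt_of_letterAt_succ {C : PreWord J} (hC : C.IsWord) {i : ℤ} {l : Letter J}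
    (h : C.letterAt (i + 1) = some l) : C.vertexAt i = some l.head := by
  rcases h' : C.letterAt i with _ | l'
  · unfold vertexAt
    cases C with
    | triv v δ => simp [letterAt] at h
    | _ => simp only [h, h']
  · rw [vertexAt_of_letterAt h', (hC.adj h' h).tail_eq]

theorem single_mem_comp {C : PreWord J} {n i : ℤ} {x : Lam J} (h : x ∈ C.stalk n i) :
    Finsupp.single i x ∈ C.comp n := by
  intro j
  rw [Finsupp.single_apply]
  split_ifs with hij
  · exact hij ▸ h
  · exact Submodule.zero_mem _

theorem smul_single_mem_comp {C : PreWord J} {n i : ℤ} {v : Q} {y : Lam J} (x : Lam J)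
    (hn : C.mu i = n) (hv : C.vertexAt i = some v) (hy : y * idem J v = y) :
    x • Finsupp.single i y ∈ C.comp n := by
  refine Submodule.smul_mem _ x (single_mem_comp ?_)
  rw [stalk, if_pos hn, hv]
  exact Ideal.mem_span_singleton'.2 ⟨y, hy⟩

theorem diff_mem {C : PreWord J} (hC : C.IsWord) {n m : ℤ} (hm : n + 1 = m) {f : ℤ →₀ Lam J}
    (hf : f ∈ C.comp n) : C.diff f ∈ C.comp m := by
  rw [diff, Finsupp.linearCombination_apply]
  refine Submodule.sum_mem _ fun i _ => ?_
  change f i • (C.bMinus i + C.bPlus i) ∈ C.comp m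
  by_cases hi : C.mu i = n
  · rw [smul_add]
    refine Submodule.add_mem _ ?_ ?_
    · unfold bMinus
      rcases h : C.letterAt i with _ | l
      · simp
      · by_cases hl : l.isInv
        · simp [hl]
        · have hs : C.letterAt (i - 1 + 1) = some l := by rw [sub_add_cancel, h]
          have h1 := C.mu_succ (i - 1)
          have h2 : C.degAt (i - 1 + 1) = -1 := by simp [degAt, h, Letter.deg, hl]
          rw [h2, sub_add_cancel] at h1
          simp only [hl]
          refine smul_single_mem_comp (v := l.head) _ (by omega)
            (vertexAt_of_letterAt_succ hC hs) ?_
          simpa [Letter.head, hl] using l.cls_mul_idem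
    · unfold bPlus
      rcases h : C.letterAt (i + 1) with _ | l
      · simp
      · by_cases hl : l.isInv
        · have h1 := C.mu_succ i
          have h2 : C.degAt (i + 1) = 1 := by simp [degAt, h, Letter.deg, hl]
          rw [h2] at h1
          simp only [hl]
          refine smul_single_mem_comp (v := l.tail) _ (by omega) (vertexAt_of_letterAt h) ?_
          simpa [Letter.tail, hl] using l.cls_mul_idem
        · simp [hl]
  · have h0 := hf i
    rw [stalk, if_neg hi, Submodule.mem_bot] at h0
    simp [h0]

theorem diff_single (C : PreWord J) (i : ℤ) (x : Lam J) :
    C.diff (Finsupp.single i x) = x • (C.bMinus i + C.bPlus i) := by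
  rw [diff, Finsupp.linearCombination_single]

theorem diff_bPlus {C : PreWord J} (hC : C.IsWord) (i : ℤ) : C.diff (C.bPlus i) = 0 := by
  rw [bPlus]
  rcases h : C.letterAt (i + 1) with _ | l
  · simp
  · by_cases hl : l.isInv
    · simp only [hl, if_true, diff_single, bMinus, bPlus, h]
      rcases h' : C.letterAt (i + 1 + 1) with _ | l'
      · simp
      · by_cases hl' : l'.isInv
        · have h1 := hC.adj h h'
          simp only [Letter.Adj, hl, hl'] at h1
          have h2 : l.cls * l'.cls = 0 := pathClass_mul_eq_zero h1.2
          simp [hl', h2]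
        · simp [hl']
    · simp [hl]

theorem diff_bMinus {C : PreWord J} (hC : C.IsWord) (i : ℤ) : C.diff (C.bMinus i) = 0 := by
  rw [bMinus]
  rcases h : C.letterAt i with _ | l
  · simp
  · by_cases hl : l.isInv
    · simp [hl]
    · have h0 : C.letterAt (i - 1 + 1) = some l := by rw [sub_add_cancel, h]
      simp only [hl, if_false, Bool.false_eq_true, diff_single, bMinus, bPlus, h0]
      rcases h' : C.letterAt (i - 1) with _ | l'
      · simp
      · by_cases hl' : l'.isInv
        · simp [hl']
        · have h1 := hC.adj h' h0
          simp only [Letter.Adj, hl, hl'] at h1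
          have h2 : l.cls * l'.cls = 0 := pathClass_mul_eq_zero h1.2
          simp [hl', h2]

theorem diff_diff {C : PreWord J} (hC : C.IsWord) (f : ℤ →₀ Lam J) : C.diff (C.diff f) = 0 := by
  induction f using Finsupp.induction_linear with
  | zero => simp
  | add f g hf hg => simp [hf, hg]
  | single i x => simp [diff_single, diff_bPlus hC, diff_bMinus hC]

end PreWord

namespace Word

/-- The differential `Pⁿ(C) → Pᵐ(C)`, for `m = n + 1`. -/
def dHom (C : Word J) {n m : ℤ} (h : n + 1 = m) : C.pre.comp n →ₗ[Lam J] C.pre.comp m :=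
  C.pre.diff.restrict fun _ hf => PreWord.diff_mem C.isWord h hf

theorem dHom_dHom (C : Word J) {n m l : ℤ} (h : n + 1 = m) (h' : m + 1 = l) :
    C.dHom h' ∘ₗ C.dHom h = 0 := by
  ext1 f
  exact Subtype.ext (PreWord.diff_diff C.isWord f.1)

/-- The complex `P(C)`. -/
def stringComplex (C : Word J) : CochainComplex (ModuleCat.{u} (Lam J)) ℤ where
  X n := ModuleCat.of (Lam J) (C.pre.comp n)
  d n m := if h : n + 1 = m then ModuleCat.ofHom (C.dHom h) else 0
  shape n m h := dif_neg h
  d_comp_d' n m l h h' := by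
    have h1 : n + 1 = m := h
    have h2 : m + 1 = l := h'
    simp only [h1, h2, dite_true]
    rw [← ModuleCat.ofHom_comp, dHom_dHom]
    rfl

end Word

/-! ### Band complexes -/

namespace PreWord

/-- The `Λ`-linear map with `b_i ↦ b_{i-t}`. -/
def translate (t : ℤ) : (ℤ →₀ Lam J) →ₗ[Lam J] (ℤ →₀ Lam J) :=
  Finsupp.lmapDomain (Lam J) (Lam J) fun i => i - t

theorem translate_single (t i : ℤ) (x : Lam J) :
    translate t (Finsupp.single i x) = Finsupp.single (i - t) x := by
  simp [translate, Finsupp.lmapDomain_apply]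

theorem translate_apply (t : ℤ) (f : ℤ →₀ Lam J) (i : ℤ) : translate t f i = f (i + t) := by
  induction f using Finsupp.induction_linear with
  | zero => simp
  | add f g hf hg => simp [hf, hg]
  | single j x =>
    rw [translate_single, Finsupp.single_apply, Finsupp.single_apply]
    congr 1
    exact propext ⟨fun h => by omega, fun h => by omega⟩

theorem translate_translate (s t : ℤ) (f : ℤ →₀ Lam J) :
    translate s (translate t f) = translate (s + t) f := by
  ext i; simp [translate_apply, add_assoc]

theorem translate_zero (f : ℤ →₀ Lam J) : translate 0 f = f := by
  ext i; simp [translate_apply]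

/-- `t` is a translational symmetry of a sequence of letters which preserves the degrees. -/
structure IsSymm (C : PreWord J) (t : ℤ) : Prop where
  letterAt (i : ℤ) : C.letterAt (i + t) = C.letterAt i
  vertexAt (i : ℤ) : C.vertexAt (i + t) = C.vertexAt i
  mu (i : ℤ) : C.mu (i + t) = C.mu i

theorem IsSymm.translate_mem {C : PreWord J} {t : ℤ} (h : C.IsSymm t) {n : ℤ} {f : ℤ →₀ Lam J}
    (hf : f ∈ C.comp n) : translate t f ∈ C.comp n := by
  intro i
  rw [translate_apply]
  have h1 := hf (i + t)
  rw [stalk, h.mu, h.vertexAt] at h1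
  exact h1

theorem IsSymm.diff_translate {C : PreWord J} {t : ℤ} (h : C.IsSymm t) (f : ℤ →₀ Lam J) :
    C.diff (translate t f) = translate t (C.diff f) := by
  induction f using Finsupp.induction_linear with
  | zero => simp
  | add f g hf hg => simp [hf, hg]
  | single i x =>
    have h1 : C.letterAt (i - t) = C.letterAt i := by
      rw [← h.letterAt (i - t), sub_add_cancel]
    have h2 : C.letterAt (i - t + 1) = C.letterAt (i + 1) := by
      rw [← h.letterAt (i - t + 1)]; congr 1; ring
    rw [translate_single, diff_single, diff_single, map_smul, map_add]
    congr 2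
    · rw [bMinus, bMinus, h1]
      rcases C.letterAt i with _ | l
      · simp
      · by_cases hl : l.isInv
        · simp [hl]
        · have h3 : i - t - 1 = i - 1 - t := by ring
          simp [hl, translate_single, h3]
    · rw [bPlus, bPlus, h2]
      rcases C.letterAt (i + 1) with _ | l
      · simp
      · by_cases hl : l.isInv
        · have h3 : i - t + 1 = i + 1 - t := by ring
          simp [hl, translate_single, h3]
        · simp [hl]

end PreWord

namespace Word

theorem HasPeriod.isSymm {C : Word J} {p : ℕ} (h : C.HasPeriod p) (n : ℤ) :
    C.pre.IsSymm (n * p) := by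
  obtain ⟨⟨f, hf⟩, h2, h3⟩ := h
  have hper : Function.Periodic f (p : ℤ) := by
    intro i
    have h4 := congrArg Word.pre h2
    change C.pre = C.pre.shift p at h4
    rw [hf] at h4
    injection h4 with h5
    exact (congrFun h5 i).symm
  have hpern : Function.Periodic f (n * p) := hper.int_mul n
  have hl : ∀ i, C.pre.letterAt i = some (f i) := fun i => by rw [hf]; rfl
  have hdeg : ∀ (m : ℤ) i, C.pre.degAt (i + m * p) = C.pre.degAt i := fun m i => by
    
    have h5 : f (i + m * p) = f i := hper.int_mul m i
    rw [PreWord.degAt, PreWord.degAt, hl, hl, h5]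
  have hmu : ∀ (m i : ℤ), C.pre.mu (i + m * p) = C.pre.mu i + C.pre.mu (m * p) := by
    intro m i
    have h0 : C.pre.mu 0 = 0 := by simp [PreWord.mu]
    induction i using Int.induction_on with
    | zero => simp [h0]
    | succ i ih =>
      have e1 := C.pre.mu_succ (i + m * p)
      have e2 := C.pre.mu_succ i
      have e3 : (i : ℤ) + m * p + 1 = i + 1 + m * p := by ring
      rw [e3, hdeg] at e1
      omega
    | pred i ih =>
      have e1 := C.pre.mu_succ (-i - 1 + m * p)
      have e2 := C.pre.mu_succ (-i - 1)
      have e3 : -(i : ℤ) - 1 + m * p + 1 = -i - 1 + 1 + m * p := by ring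
      rw [e3, hdeg] at e1
      rw [sub_add_cancel] at e1 e2
      omega
  have hmun : ∀ m : ℤ, C.pre.mu (m * p) = 0 := by
    intro m
    induction m using Int.induction_on with
    | zero => simp [PreWord.mu]
    | succ i ih =>
      have e1 := hmu 1 (i * p)
      rw [one_mul, h3, ih] at e1
      rw [add_mul, one_mul]
      omega
    | pred i ih =>
      have e1 := hmu 1 ((-i - 1) * p)
      rw [one_mul, h3] at e1
      have e2 : (-(i : ℤ) - 1) * p + p = -i * p := by ring
      rw [e2, ih] at e1
      omega
  have hl' : ∀ i, C.pre.letterAt (i + n * p) = C.pre.letterAt i := fun i => by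
    rw [hl, hl, hpern i]
  refine ⟨hl', fun i => ?_, fun i => by rw [hmu, hmun, add_zero]⟩
  rw [PreWord.vertexAt_of_letterAt (hl _), PreWord.vertexAt_of_letterAt (hl i), hpern i]

theorem IsPeriodic.hasPeriod {C : Word J} (hC : C.IsPeriodic) : C.HasPeriod C.period :=
  (Nat.sInf_mem (s := {p : ℕ | 0 < p ∧ C.HasPeriod p}) hC).2

/-- The homogeneous component `Pⁿ(C)` for a periodic word `C`, to be regarded as a module over
`Λ` and over `k[T;T⁻¹]`. -/
def BandComp {C : Word J} (_ : C.IsPeriodic) (n : ℤ) : Type u := C.pre.comp n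

section BandComp

variable {C : Word J} (hC : C.IsPeriodic) (n : ℤ)

instance : AddCommGroup (BandComp hC n) := inferInstanceAs (AddCommGroup (C.pre.comp n))
instance : Module (Lam J) (BandComp hC n) := inferInstanceAs (Module (Lam J) (C.pre.comp n))
instance : Module k (C.pre.comp n) := Submodule.module' _
instance : SMulCommClass (Lam J) k (C.pre.comp n) := inferInstance
instance : IsScalarTower k (Lam J) (C.pre.comp n) := inferInstance

/-- The action of `T ^ t` on `Pⁿ(C)`, given by `b_i ↦ b_{i - tp}` where `p` is the period of `C`. -/
def translateHom : Multiplicative ℤ →* Module.End (Lam J) (C.pre.comp n) where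
  toFun t := (PreWord.translate (t.toAdd * C.period)).restrict fun _ hf =>
    (hC.hasPeriod.isSymm t.toAdd).translate_mem hf
  map_one' := by
    ext1 f
    refine Subtype.ext ?_
    simpa using PreWord.translate_zero f.1
  map_mul' s t := by
    ext1 f
    refine Subtype.ext ?_
    simpa [add_mul] using (PreWord.translate_translate (s.toAdd * C.period)
      (t.toAdd * C.period) f.1).symm

/-- The ring homomorphism which gives the action of `k[T;T⁻¹]` on `Pⁿ(C)`. -/
def laurentHom : k[T;T⁻¹] →ₐ[k] Module.End (Lam J) (C.pre.comp n) :=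
  AddMonoidAlgebra.lift k (Module.End (Lam J) (C.pre.comp n)) ℤ (translateHom hC n)

end BandComp
end Word

namespace Word

section BandComp

variable {C : Word J} (hC : C.IsPeriodic) (n : ℤ)

instance : Module k[T;T⁻¹] (BandComp hC n) :=
  letI : Module (Module.End (Lam J) (C.pre.comp n)) (BandComp hC n) :=
    inferInstanceAs (Module (Module.End (Lam J) (C.pre.comp n)) (C.pre.comp n))
  Module.compHom (BandComp hC n) (laurentHom hC n).toRingHom

theorem laurent_smul_def (r : k[T;T⁻¹]) (x : BandComp hC n) :
    r • x = (laurentHom hC n r : C.pre.comp n →ₗ[Lam J] C.pre.comp n) x := rfl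

instance : SMulCommClass k[T;T⁻¹] (Lam J) (BandComp hC n) :=
  ⟨fun r a x => (laurentHom hC n r).map_smul a x⟩

variable {n} {m : ℤ}

theorem dHom_laurentHom (h : n + 1 = m) (r : k[T;T⁻¹]) (x : C.pre.comp n) :
    C.dHom h (laurentHom hC n r x) = laurentHom hC m r (C.dHom h x) := by
  induction r using LaurentPolynomial.induction_on' with
  | add p q hp hq => simp [hp, hq]
  | C_mul_T t a =>
    have h1 : ∀ l, laurentHom hC l (LaurentPolynomial.C a * LaurentPolynomial.T t) =
        a • translateHom hC l (Multiplicative.ofAdd t) := by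
      intro l
      rw [← LaurentPolynomial.single_eq_C_mul_T, laurentHom, AddMonoidAlgebra.lift_single]
    rw [h1, h1, LinearMap.smul_apply, LinearMap.smul_apply]
    have h2 : C.dHom h (translateHom hC n (Multiplicative.ofAdd t) x) =
        translateHom hC m (Multiplicative.ofAdd t) (C.dHom h x) :=
      Subtype.ext ((hC.hasPeriod.isSymm t).diff_translate x.1)
    rw [← h2]
    have h3 : ∀ (l : ℤ) (y : C.pre.comp l), a • y = (algebraMap k (Lam J) a) • y := fun l y =>
      (algebraMap_smul (Lam J) a y).symm
    rw [h3, h3, map_smul]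

/-- The differential `Pⁿ(C) → Pᵐ(C)` for `m = n + 1` as a map of modules over `k[T;T⁻¹]`. -/
def bandHom (h : n + 1 = m) : BandComp hC n →ₗ[k[T;T⁻¹]] BandComp hC m where
  toFun := C.dHom h
  map_add' := (C.dHom h).map_add
  map_smul' r x := dHom_laurentHom hC h r x

theorem bandHom_smul (h : n + 1 = m) (a : Lam J) (x : BandComp hC n) :
    bandHom hC h (a • x) = a • bandHom hC h x := (C.dHom h).map_smul a x

variable (V : Type u) [AddCommGroup V] [Module k[T;T⁻¹] V]

/-- The differential `d ⊗ id_V` of the complex `P(C,V)`. -/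
def bandDiff (h : n + 1 = m) :
    BandComp hC n ⊗[k[T;T⁻¹]] V →ₗ[Lam J] BandComp hC m ⊗[k[T;T⁻¹]] V where
  toFun := (bandHom hC h).rTensor V
  map_add' := map_add _
  map_smul' a x := by
    induction x using TensorProduct.induction_on with
    | zero => simp
    | tmul x v =>
      rw [TensorProduct.smul_tmul', LinearMap.rTensor_tmul, bandHom_smul, RingHom.id_apply,
        LinearMap.rTensor_tmul, TensorProduct.smul_tmul']
    | add x y hx hy => rw [smul_add, map_add, map_add, smul_add, hx, hy]

theorem bandDiff_bandDiff {l : ℤ} (h : n + 1 = m) (h' : m + 1 = l) :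
    bandDiff hC V h' ∘ₗ bandDiff hC V h = 0 := by
  ext x
  induction x using TensorProduct.induction_on with
  | zero => simp
  | tmul x v =>
    have h1 : bandHom hC h' (bandHom hC h x) = 0 := LinearMap.congr_fun (C.dHom_dHom h h') x
    change bandHom hC h' (bandHom hC h x) ⊗ₜ[k[T;T⁻¹]] v = 0
    rw [h1, TensorProduct.zero_tmul]
  | add x y hx hy => rw [map_add, hx, hy, map_add]

/-- The complex `P(C,V)` for a periodic generalised word `C` and a `k[T;T⁻¹]`-module `V`: its
homogeneous components are `Pⁿ(C) ⊗ V`, and its differential is `d ⊗ id_V`. -/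
def bandComplex : CochainComplex (ModuleCat.{u} (Lam J)) ℤ where
  X n := ModuleCat.of (Lam J) (BandComp hC n ⊗[k[T;T⁻¹]] V)
  d n m := if h : n + 1 = m then ModuleCat.ofHom (bandDiff hC V h) else 0
  shape n m h := dif_neg h
  d_comp_d' n m l h h' := by
    have h1 : n + 1 = m := h
    have h2 : m + 1 = l := h'
    simp only [h1, h2, dite_true]
    rw [← ModuleCat.ofHom_comp, bandDiff_bandDiff]
    rfl

end BandComp

end Word

end Gentle

/-! ### The homotopy category -/

section Homotopy

variable {Λ : Type u} [Ring Λ]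

/-- The complex `X` lies in `C^{+,b}(Λ-proj)`: it consists of finitely generated projective modules,
it is left-bounded, and its cohomology is bounded. -/
structure IsPlusB (X : CochainComplex (ModuleCat.{u} Λ) ℤ) : Prop where
  projective (i : ℤ) : Module.Projective Λ (X.X i)
  finite (i : ℤ) : Module.Finite Λ (X.X i)
  leftBounded : ∃ n : ℤ, ∀ i < n, Subsingleton (X.X i)
  boundedCohomology : ∃ h : ℤ, ∀ i ∉ Set.Icc (-h) h,
    LinearMap.range (X.d i (i + 1)).hom = LinearMap.ker (X.d (i + 1) (i + 1 + 1)).hom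

/-- An object of the homotopy category of complexes of `Λ`-modules lies in `K^{+,b}(Λ-proj)`: it
is isomorphic in the homotopy category to a complex in `C^{+,b}(Λ-proj)`. -/
def InKPlusB (X : HomotopyCategory (ModuleCat.{u} Λ) (ComplexShape.up ℤ)) : Prop :=
  ∃ Y : CochainComplex (ModuleCat.{u} Λ) ℤ, IsPlusB Y ∧
    Nonempty (X ≅ (HomotopyCategory.quotient _ _).obj Y)

end Homotopy

end GentleAlgebra

end

open GentleAlgebra

/-! Everything in (i) turns on one combinatorial condition, `PreWord.HasResolvingEnds`: each
infinite end of the word eventually consists of single arrows along which the degree rises towards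
the outside. A word satisfies it if and only if its string complex lies in `K^{+,b}`, and if and
only if it is one of the words listed in (i).

Sufficiency. Far out on such an end the degree grows by one with each letter, so every degree
contains finitely many generators and the degrees are bounded below. In high degrees only generators
deep inside these rays occur. There the differential is right multiplication by an arrow `y`, and
gentleness makes the kernel of that map on `Λ e_{h(y)}` the left ideal of the unique arrow `a` with
`ay ∈ J` (`IsGentle.exists_eq_mul_of_mul_eq_zero`), so the complex is exact. Hence `P(C)` itself is
a complex of the required kind (`IsGentle.isPlusB_stringComplex`).

Necessity. The differential of `P(C)` has coefficients in non-trivial paths, so every homomorphism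
to a module killed by these paths vanishes on boundaries. The two homotopy terms of a homotopy
equivalence with `Y` are therefore invisible to such homomorphisms (`map_inv_hom_apply`), and each
generator of `P(C)` in degree `n` must be detected by generators of `Yⁿ`. So only finitely many
generators lie below any given degree, and the degree tends to infinity along an infinite end.
Exactness in high degrees passes from `Y` to `P(C)`. It forbids two differentials meeting at one
generator (`IsGentle.not_step_step`) and forces the letters to be single arrows
(`IsGentle.length_eq_one_of_exactIn`).

Combinatorics. In a gentle algebra an arrow ray is determined letter by letter by what it is
attached to, so an infinite ray is the unique longest extension of the finite part
(`Word.exists_eq_of_hasResolvingEnds`). A periodic word never has resolving ends, since it takes the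
same degree infinitely often.

Bands. The degrees of a periodic word are bounded, so only finite generation is at stake. If `V` is
finite-dimensional, each component of `P(D,V)` is a summand of a free module of finite rank.
Conversely, `b₀ ⊗ v ↦ v` maps degree zero onto `V`, regarded as a sum of copies of a simple module;
by the same invisibility of homotopies `V` is a quotient of `Y⁰`, hence finite-dimensional. -/

noncomputable section

namespace GentleAlgebra

/-! ### Ideals of the path algebra spanned by paths -/

section MonomialIdeals

variable {k : Type u} [Field k] {Q : Type u} [Quiver.{u} Q]

namespace PathAlgebra

/-- The coefficient of a path in an element of the path algebra. -/
def coeff (p : QPath Q) : PathAlgebra k Q →ₗ[k] k := Finsupp.lapply p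

open Classical in
theorem coeff_of (p q : QPath Q) : coeff p (of k q) = if q = p then 1 else 0 :=
  Finsupp.single_apply

theorem coeff_eq_zero_of_mem_span {Pr : QPath Q → Prop} {x : PathAlgebra k Q}
    (hx : x ∈ Submodule.span k (of k '' {p | Pr p})) {p : QPath Q} (hp : ¬ Pr p) :
    coeff p x = 0 := by
  classical
  induction hx using Submodule.span_induction with
  | mem x hx =>
    obtain ⟨q, hq, rfl⟩ := hx
    rw [coeff_of, if_neg]
    rintro rfl
    exact hp hq
  | zero => exact map_zero _
  | add x y _ _ hx hy => rw [map_add, hx, hy, add_zero]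
  | smul c x _ hx => rw [map_smul, hx, smul_zero]

end PathAlgebra

/-- A property of paths which is inherited by every path that contains one with the property. -/
structure Absorbing (Pr : QPath Q → Prop) : Prop where
  comp_right {a b c : Q} (p : Quiver.Path a b) (q : Quiver.Path b c) :
    Pr ⟨a, b, p⟩ → Pr ⟨a, c, p.comp q⟩
  comp_left {a b c : Q} (p : Quiver.Path a b) (q : Quiver.Path b c) :
    Pr ⟨b, c, q⟩ → Pr ⟨a, c, p.comp q⟩

theorem absorbing_le_length (m : ℕ) : Absorbing fun p : QPath Q => m ≤ p.length where
  comp_right p q h := by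
    change m ≤ (p.comp q).length
    rw [Quiver.Path.length_comp]
    exact le_add_right h
  comp_left p q h := by
    change m ≤ (p.comp q).length
    rw [Quiver.Path.length_comp]
    exact le_add_left h

variable [Fintype Q]

/-- The product of two paths is a path containing both of them or zero, so the span of an absorbing
family of paths is stable under multiplication on either side. -/
theorem Absorbing.mul_mem {Pr : QPath Q → Prop} (h : Absorbing Pr) (x : PathAlgebra k Q)
    {y : PathAlgebra k Q} (hy : y ∈ Submodule.span k (PathAlgebra.of k '' {p | Pr p})) :
    x * y ∈ Submodule.span k (PathAlgebra.of k '' {p | Pr p}) ∧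
      y * x ∈ Submodule.span k (PathAlgebra.of k '' {p | Pr p}) := by
  induction hy using Submodule.span_induction with
  | zero => simp
  | add y z _ _ hy hz =>
    rw [mul_add, add_mul]
    exact ⟨add_mem hy.1 hz.1, add_mem hy.2 hz.2⟩
  | smul c y _ hy =>
    rw [mul_smul_comm, smul_mul_assoc]
    exact ⟨Submodule.smul_mem _ c hy.1, Submodule.smul_mem _ c hy.2⟩
  | mem y hy =>
    obtain ⟨⟨a, b, p⟩, hp, rfl⟩ := hy
    induction x using PathAlgebra.induction with
    | h0 => simp
    | hadd x z hx hz =>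
      rw [mul_add, add_mul]
      exact ⟨add_mem hx.1 hz.1, add_mem hx.2 hz.2⟩
    | hof c q =>
      rw [mul_smul_comm, smul_mul_assoc]
      obtain ⟨a', b', q⟩ := q
      refine ⟨Submodule.smul_mem _ c ?_, Submodule.smul_mem _ c ?_⟩
      · by_cases hb : b = a'
        · subst hb
          rw [PathAlgebra.of_mul_of_comp]
          exact Submodule.subset_span ⟨_, h.comp_right p q hp, rfl⟩
        · rw [PathAlgebra.of_mul_of_ne k hb]
          exact zero_mem _
      · by_cases hb : b' = a
        · subst hb
          rw [PathAlgebra.of_mul_of_comp]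
          exact Submodule.subset_span ⟨_, h.comp_left q p hp, rfl⟩
        · rw [PathAlgebra.of_mul_of_ne k hb]
          exact zero_mem _

variable (k) in
/-- The two-sided ideal of the path algebra spanned by the paths with an absorbing property. -/
def Absorbing.ideal {Pr : QPath Q → Prop} (h : Absorbing Pr) : TwoSidedIdeal (PathAlgebra k Q) :=
  .mk' (Submodule.span k (PathAlgebra.of k '' {p | Pr p})) (zero_mem _) add_mem neg_mem
    (fun {x _} hy => (h.mul_mem x hy).1) (fun {_ y} hx => (h.mul_mem y hx).2)

theorem Absorbing.coeff_eq_zero {Pr : QPath Q → Prop} (h : Absorbing Pr) {x : PathAlgebra k Q}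
    (hx : x ∈ h.ideal k) {p : QPath Q} (hp : ¬ Pr p) : PathAlgebra.coeff p x = 0 := by
  rw [Absorbing.ideal, TwoSidedIdeal.mem_mk'] at hx
  exact PathAlgebra.coeff_eq_zero_of_mem_span hx hp

/-- Bounds an ideal given by generators by a linear span of paths, in which membership can be tested
on coefficients. It is applied to path length and to the presence of a relation. -/
theorem Absorbing.span_le {Pr : QPath Q → Prop} (h : Absorbing Pr) {S : Set (QPath Q)}
    (hS : ∀ p ∈ S, Pr p) : TwoSidedIdeal.span (PathAlgebra.of k '' S) ≤ h.ideal k := by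
  rw [TwoSidedIdeal.span_le]
  rintro _ ⟨p, hp, rfl⟩
  rw [SetLike.mem_coe, Absorbing.ideal, TwoSidedIdeal.mem_mk']
  exact Submodule.subset_span ⟨p, hS p hp, rfl⟩

theorem coeff_eq_zero_of_mem_arrowIdealPow {m : ℕ} {x : PathAlgebra k Q}
    (hx : x ∈ arrowIdealPow k Q m) {p : QPath Q} (hp : p.length < m) :
    PathAlgebra.coeff p x = 0 := by
  refine (absorbing_le_length m).coeff_eq_zero (k := k) ?_ (not_le.2 hp)
  have h := (absorbing_le_length (Q := Q) m).span_le (k := k) (S := {p | p.length = m})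
    fun p hp => hp.ge
  refine h ?_
  have h1 : PathAlgebra.of k '' {p : QPath Q | p.length = m} =
      {x | ∃ p : QPath Q, p.length = m ∧ x = PathAlgebra.of k p} := by
    ext x
    simp [eq_comm]
  rwa [h1]

theorem of_mem_arrowIdealPow (p : QPath Q) : PathAlgebra.of k p ∈ arrowIdealPow k Q p.length :=
  TwoSidedIdeal.subset_span ⟨p, rfl, rfl⟩

end MonomialIdeals

/-! ### Elements of a gentle ideal and the kernel of multiplication by an arrow -/

section Gentle

variable {k : Type u} [Field k] {Q : Type u} [Quiver.{u} Q] [Fintype Q]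
  {J : TwoSidedIdeal (PathAlgebra k Q)}

theorem IsGentle.coeff_eq_zero (hJ : IsGentle J) {x : PathAlgebra k Q} (hx : x ∈ J)
    {p : QPath Q} (hp : p.length < 2) : PathAlgebra.coeff p x = 0 := by
  obtain ⟨m, -, -, h⟩ := hJ.admissible
  exact coeff_eq_zero_of_mem_arrowIdealPow (h hx) hp

/-! ### The simple modules -/

/-- The ring homomorphism `kQ → k` onto the simple module at the vertex `v`. -/
def PathAlgebra.vertexHom (v : Q) : PathAlgebra k Q →+* k where
  toFun := coeff (QPath.triv v)
  map_zero' := map_zero _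
  map_add' := map_add _
  map_one' := by
    classical
    rw [one_def, map_sum, Finset.sum_eq_single v]
    · simp [coeff_of]
    · intro w _ hw
      rw [coeff_of, if_neg]
      intro h
      exact hw (congrArg QPath.tail h)
    · simp
  map_mul' x y := by
    classical
    induction x using PathAlgebra.induction with
    | h0 => simp
    | hadd x z hx hz => rw [add_mul, map_add, hx, hz, map_add, add_mul]
    | hof c p =>
      induction y using PathAlgebra.induction with
      | h0 => simp
      | hadd x z hx hz => rw [mul_add, map_add, hx, hz, map_add, mul_add]
      | hof d q =>
        rw [smul_mul_smul_comm, map_smul, map_smul, map_smul, smul_mul_smul_comm]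
        congr 1
        obtain ⟨a, b, p⟩ := p
        obtain ⟨a', b', q⟩ := q
        by_cases h : b' = a
        · subst h
          rw [of_mul_of_comp, coeff_of, coeff_of, coeff_of]
          -- If `p` is non-trivial then neither `p` nor the product is a trivial path, and both
          -- sides vanish. Otherwise the product is `q`.
          cases p with
          | cons p e =>
            rw [if_neg, if_neg (c := _ = _), zero_mul]
            · intro h
              simpa [QPath.length, QPath.triv] using congrArg QPath.length h
            · intro h
              simpa [QPath.length, QPath.triv] using congrArg QPath.length h
          | nil =>
            rw [Quiver.Path.comp_nil]
            by_cases h : (⟨a', b, q⟩ : QPath Q) = QPath.triv v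
            · have h1 : b = v := congrArg QPath.head h
              subst h1
              rw [h, if_pos rfl]
              simp [QPath.triv]
            · simp [h]
        · rw [of_mul_of_ne k h, map_zero, coeff_of, coeff_of]
          by_cases h1 : (⟨a, b, p⟩ : QPath Q) = QPath.triv v
          · rw [if_neg (c := (⟨a', b', q⟩ : QPath Q) = _), mul_zero]
            intro h2
            exact h ((congrArg QPath.head h2).trans (congrArg QPath.tail h1).symm)
          · rw [if_neg h1, zero_mul]

/-- The ring homomorphism `Λ → k` onto the simple module at the vertex `v`. -/
def IsGentle.vertexHom (hJ : IsGentle J) (v : Q) : Lam J →+* k :=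
  J.ringCon.lift (PathAlgebra.vertexHom v) fun x y h => by
    rw [RingCon.ker_apply]
    have h1 : x - y ∈ J := (TwoSidedIdeal.rel_iff J x y).1 h
    have h2 : PathAlgebra.vertexHom v (x - y) = 0 := hJ.coeff_eq_zero h1 two_pos
    rwa [map_sub, sub_eq_zero] at h2

theorem IsGentle.vertexHom_mk (hJ : IsGentle J) (v : Q) (x : PathAlgebra k Q) :
    hJ.vertexHom v (J.ringCon.mk' x) = PathAlgebra.coeff (QPath.triv v) x := rfl

theorem IsGentle.vertexHom_idem (hJ : IsGentle J) (v : Q) : hJ.vertexHom v (idem J v) = 1 := by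
  classical
  rw [idem, pathClass, vertexHom_mk, PathAlgebra.coeff_of, if_pos rfl]

/-- Non-trivial paths act as zero on simple modules. Applied to the paths of letters, this says that
the differentials of string and band complexes are radical. -/
theorem IsGentle.vertexHom_pathClass (hJ : IsGentle J) (v : Q) (γ : NPath Q) :
    hJ.vertexHom v (pathClass J γ.toQPath) = 0 := by
  classical
  rw [pathClass, vertexHom_mk, PathAlgebra.coeff_of, if_neg]
  intro h
  exact Nat.succ_ne_zero _ (congrArg QPath.length h)

theorem IsGentle.vertexHom_algebraMap (hJ : IsGentle J) (v : Q) (c : k) :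
    hJ.vertexHom v (algebraMap k (Lam J) c) = c := by
  have h : algebraMap k (Lam J) c = J.ringCon.mk' (algebraMap k (PathAlgebra k Q) c) := rfl
  rw [h, vertexHom_mk, Algebra.algebraMap_eq_smul_one, map_smul]
  have : PathAlgebra.coeff (QPath.triv v) (1 : PathAlgebra k Q) = 1 :=
    map_one (PathAlgebra.vertexHom v)
  rw [this, smul_eq_mul, mul_one]

/-- The class of an arrow is not a multiple of a path of length at least two. -/
theorem IsGentle.length_le_one_of_mul_eq (hJ : IsGentle J) {a : Arrow Q} {p : QPath Q} {z : Lam J}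
    (h : z * pathClass J p = pathClass J (QPath.ofArrow a)) : p.length ≤ 1 := by
  classical
  by_contra! hp
  obtain ⟨z, rfl⟩ := J.ringCon.mk'_surjective z
  rw [pathClass, pathClass, ← map_mul] at h
  have h1 : z * PathAlgebra.of k p - PathAlgebra.of k (QPath.ofArrow a) ∈ J := by
    rw [← mk_eq_zero_iff, map_sub, h, sub_self]
  have h2 := hJ.coeff_eq_zero h1 (p := QPath.ofArrow a) one_lt_two
  -- If `p` had length at least two, neither `J` nor `z p` would contribute to the coefficient of
  -- the arrow `a`, although their difference is `a` itself.
  have h3 : z * PathAlgebra.of k p ∈ arrowIdealPow k Q p.length :=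
    TwoSidedIdeal.mul_mem_left _ _ _ (of_mem_arrowIdealPow p)
  have h4 := coeff_eq_zero_of_mem_arrowIdealPow h3 (p := QPath.ofArrow a) hp
  rw [map_sub, h4, PathAlgebra.coeff_of, if_pos rfl] at h2
  simp at h2

/-! ### Paths which contain a relation -/

variable (J) in
/-- The path contains two consecutive arrows whose product lies in `J`. -/
def HasRelation {a : Q} : {b : Q} → Quiver.Path a b → Prop
  | _, .nil => False
  | _, .cons .nil _ => False
  | _, .cons (.cons q f) e =>
    HasRelation (q.cons f) ∨ arrow k ⟨_, _, e⟩ * arrow k ⟨_, _, f⟩ ∈ J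

theorem HasRelation.cons {a b c : Q} {p : Quiver.Path a b} (h : HasRelation J p) (e : b ⟶ c) :
    HasRelation J (p.cons e) := by
  cases p with
  | nil => exact h.elim
  | cons q f => exact Or.inl h

theorem HasRelation.comp_right {a b c : Q} {p : Quiver.Path a b} (h : HasRelation J p)
    (q : Quiver.Path b c) : HasRelation J (p.comp q) := by
  induction q with
  | nil => exact h
  | cons q e ih => exact ih.cons e

theorem HasRelation.comp_left {a b : Q} (p : Quiver.Path a b) :
    ∀ {c : Q} {q : Quiver.Path b c}, HasRelation J q → HasRelation J (p.comp q)
  | _, .nil, h => h.elim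
  | _, .cons .nil _, h => h.elim
  | _, .cons (.cons _ _) _, h => h.elim (fun h => Or.inl (HasRelation.comp_left p h)) Or.inr

theorem HasRelation.of_mem {a : Q} : ∀ {b : Q} {p : Quiver.Path a b}, HasRelation J p →
    PathAlgebra.of k ⟨a, b, p⟩ ∈ J
  | _, .nil, h => h.elim
  | _, .cons .nil _, h => h.elim
  | _, .cons (.cons q f) e, h => by
    rw [PathAlgebra.of_cons]
    rcases h with h | h
    · exact J.mul_mem_left _ _ h.of_mem
    · rw [PathAlgebra.of_cons, ← mul_assoc]
      exact J.mul_mem_right _ _ h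

/-- The only consecutive pair of arrows in `y` followed by `p` that does not lie within `p` consists
of `y` and the first arrow `x` of `p`. In that case `p` is a left multiple of `x`. -/
theorem HasRelation.of_toPath_comp (y : Arrow Q) : ∀ {c : Q} {p : Quiver.Path y.head c},
    HasRelation J (y.hom.toPath.comp p) → HasRelation J p ∨
      ∃ x : Arrow Q, x.tail = y.head ∧ arrow k x * arrow k y ∈ J ∧
        ∃ z, PathAlgebra.of k ⟨y.head, c, p⟩ = z * arrow k x
  | _, .nil, h => h.elim
  | _, .cons .nil e, h => by
    rcases h with h | h
    · exact h.elim
    · exact Or.inr ⟨⟨_, _, e⟩, rfl, h, 1, by rw [one_mul]; rfl⟩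
  | _, .cons (.cons q f) e, h => by
    rcases h with h | h
    · rcases HasRelation.of_toPath_comp y (p := q.cons f) h with h1 | ⟨x, h1, h2, z, hz⟩
      · exact Or.inl (Or.inl h1)
      · refine Or.inr ⟨x, h1, h2, arrow k ⟨_, _, e⟩ * z, ?_⟩
        rw [PathAlgebra.of_cons, hz, mul_assoc]
        rfl
    · exact Or.inl (Or.inr h)

theorem absorbing_hasRelation : Absorbing fun p : QPath Q => HasRelation J p.path where
  comp_right _ q h := h.comp_right q
  comp_left p _ h := h.comp_left p

/-- The generators of `J` are paths of length two, each of them a relation, so `J` is contained in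
the span of the paths that contain a relation. Together with `HasRelation.of_mem` this makes `J` a
monomial ideal. -/
theorem IsGentle.hasRelation_of_coeff_ne_zero (hJ : IsGentle J) {x : PathAlgebra k Q} (hx : x ∈ J)
    {p : QPath Q} (hp : PathAlgebra.coeff p x ≠ 0) : HasRelation J p.path := by
  by_contra h
  refine hp ((absorbing_hasRelation (J := J)).coeff_eq_zero (k := k) ?_ h)
  obtain ⟨S, hS, hJS⟩ := hJ.generated
  have h1 : ∀ p ∈ S, HasRelation J p.path := by
    rintro ⟨a, b, p⟩ hp
    have h2 : PathAlgebra.of k ⟨a, b, p⟩ ∈ J := by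
      rw [hJS]
      exact TwoSidedIdeal.subset_span ⟨_, hp, rfl⟩
    have h3 : p.length = 2 := hS _ hp
    cases p with
    | nil => simp at h3
    | cons p e =>
      cases p with
      | nil => simp at h3
      | cons p f =>
        cases p with
        | cons p g => simp at h3
        | nil =>
          refine Or.inr ?_
          rw [PathAlgebra.of_cons] at h2
          exact h2
  have h4 := (absorbing_hasRelation (J := J)).span_le (k := k) h1
  rw [← hJS] at h4
  exact h4 hx

/-- If `a y = 0` in `Λ`, for arrows `a` and `y`, then the kernel of right multiplication by `y` on
`Λ e_{h(y)}` is generated by `a`. -/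
theorem IsGentle.exists_eq_mul_of_mul_eq_zero (hJ : IsGentle J) {a y : Arrow Q}
    (hay : a.tail = y.head) (hJay : arrow k a * arrow k y ∈ J) {x : Lam J}
    (hx : x * idem J y.head = x) (hxy : x * pathClass J (QPath.ofArrow y) = 0) :
    ∃ z, x = z * pathClass J (QPath.ofArrow a) := by
  classical
  obtain ⟨x, rfl⟩ := J.ringCon.mk'_surjective x
  have hxy' : x * arrow k y ∈ J := by rwa [← mk_eq_zero_iff, map_mul]
  -- As `J` is monomial, the claim can be checked separately on each path in the support of `x`.
  have key : ∀ p : QPath Q, PathAlgebra.coeff p x ≠ 0 → ∃ z,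
      J.ringCon.mk' (PathAlgebra.of k p * PathAlgebra.of k (QPath.triv y.head)) =
        z * pathClass J (QPath.ofArrow a) := by
    rintro ⟨b, c, p⟩ hp
    by_cases hb : y.head = b
    · subst hb
      -- Prefixing `y` is injective on the paths that start at `h(y)`, so no terms cancel in `x y`
      -- and its coefficients are those of `x`.
      have h0 : ∀ x : PathAlgebra k Q,
          PathAlgebra.coeff (⟨y.tail, c, y.hom.toPath.comp p⟩ : QPath Q) (x * arrow k y) =
          PathAlgebra.coeff ⟨y.head, c, p⟩ x := by
        intro x
        induction x using PathAlgebra.induction with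
        | h0 => simp
        | hadd x z hx hz => rw [add_mul, map_add, hx, hz, map_add]
        | hof r q =>
          rw [smul_mul_assoc, map_smul, map_smul]
          congr 1
          obtain ⟨b', c', q⟩ := q
          by_cases hb : y.head = b'
          · subst hb
            rw [arrow, QPath.ofArrow, PathAlgebra.of_mul_of_comp, PathAlgebra.coeff_of,
              PathAlgebra.coeff_of]
            congr 1
            by_cases hc : c' = c
            · subst hc
              simp [Quiver.Path.comp_inj_right]
            · have : ∀ {a : Q} (u : Quiver.Path a c') (v : Quiver.Path a c),
                  (⟨a, c', u⟩ : QPath Q) ≠ ⟨a, c, v⟩ :=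
                fun u v h => hc (congrArg QPath.head h)
              simp [hc]
          · rw [arrow, PathAlgebra.of_mul_of_ne k hb, map_zero, PathAlgebra.coeff_of, if_neg]
            intro h
            exact hb (congrArg QPath.tail h).symm
      rw [← h0] at hp
      have h1 := hJ.hasRelation_of_coeff_ne_zero hxy' hp
      have h2 : PathAlgebra.of k ⟨y.head, c, p⟩ * PathAlgebra.of k (QPath.triv y.head) =
          PathAlgebra.of k ⟨y.head, c, p⟩ :=
        (PathAlgebra.of_mul_of_comp k p .nil).trans (by rw [Quiver.Path.nil_comp])
      rw [h2]
      rcases HasRelation.of_toPath_comp y h1 with h3 | ⟨x', h3, h4, z, hz⟩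
      · exact ⟨0, by rw [zero_mul, mk_eq_zero_iff]; exact h3.of_mem⟩
      -- Gentleness: at most one arrow composes with `y` to an element of `J`.
      · have h5 : x' = a := Set.encard_le_one_iff.1 (hJ.card_left_mem_le y) _ _ ⟨h3, h4⟩
          ⟨hay, hJay⟩
        subst h5
        exact ⟨J.ringCon.mk' z, by rw [hz, map_mul]; rfl⟩
    · refine ⟨0, ?_⟩
      rw [PathAlgebra.of_mul_of_ne k hb, zero_mul, map_zero]
  have hsum : x = Finsupp.sum (show QPath Q →₀ k from x) fun p c => c • PathAlgebra.of k p := by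
    conv_lhs => rw [← Finsupp.sum_single (show QPath Q →₀ k from x)]
    refine Finsupp.sum_congr fun p _ => ?_
    exact (Finsupp.smul_single_one p _).symm
  choose! z hz using key
  refine ⟨∑ p ∈ (show QPath Q →₀ k from x).support,
    algebraMap k (Lam J) (PathAlgebra.coeff p x) * z p, ?_⟩
  rw [← hx, idem, pathClass, ← map_mul]
  conv_lhs => rw [hsum]
  rw [Finsupp.sum, Finset.sum_mul, map_sum, Finset.sum_mul]
  refine Finset.sum_congr rfl fun p hp => ?_
  rw [mul_assoc, ← hz p (Finsupp.mem_support_iff.1 hp), smul_mul_assoc,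
    Algebra.smul_def, map_mul]
  rfl

end Gentle

/-! ### The differential of `P(C)` as a graph of steps between generators -/

section Steps

variable {k : Type u} [Field k] {Q : Type u} [Quiver.{u} Q] [Fintype Q]
  {J : TwoSidedIdeal (PathAlgebra k Q)}

theorem idem_mul_pathClass (p : QPath Q) : idem J p.head * pathClass J p = pathClass J p :=
  (pathClass_comp J .nil p.path).trans (by rw [Quiver.Path.comp_nil])

theorem idem_mul_idem (v : Q) : idem J v * idem J v = idem J v :=
  pathClass_mul_idem J (QPath.triv v)

namespace PreWord

/-- The differential of `b_i` has the component `γ b_j`, where `γ` is the path of the letter `l`. -/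
def Step (C : PreWord J) (i j : ℤ) (l : Letter J) : Prop :=
  (j = i + 1 ∧ C.letterAt j = some l ∧ l.isInv = true) ∨
    (j = i - 1 ∧ C.letterAt i = some l ∧ l.isInv = false)

variable {C : PreWord J} {i j m n : ℤ} {l l' : Letter J}

theorem Step.letter_unique (h : C.Step i j l) (h' : C.Step i j l') : l = l' := by
  rcases h with ⟨h1, h2, h3⟩ | ⟨h1, h2, h3⟩ <;> rcases h' with ⟨h4, h5, h6⟩ | ⟨h4, h5, h6⟩
  · exact Option.some_injective _ (h2.symm.trans h5)
  · omega
  · omega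
  · exact Option.some_injective _ (h2.symm.trans h5)

theorem Step.vertexAt_left (hC : C.IsWord) (h : C.Step i j l) :
    C.vertexAt i = some l.path.head := by
  rcases h with ⟨rfl, h2, h3⟩ | ⟨h1, h2, h3⟩
  · rw [vertexAt_of_letterAt_succ hC h2, Letter.head, if_pos h3]
  · rw [vertexAt_of_letterAt h2, Letter.tail, h3]
    rfl

theorem Step.vertexAt_right (hC : C.IsWord) (h : C.Step i j l) :
    C.vertexAt j = some l.path.tail := by
  rcases h with ⟨rfl, h2, h3⟩ | ⟨rfl, h2, h3⟩
  · rw [vertexAt_of_letterAt h2, Letter.tail, if_pos h3]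
  · rw [vertexAt_of_letterAt_succ hC (l := l) (by rwa [sub_add_cancel]), Letter.head, h3]
    rfl

theorem Step.mu_eq (h : C.Step i j l) : C.mu j = C.mu i + 1 := by
  rcases h with ⟨rfl, h2, h3⟩ | ⟨rfl, h2, h3⟩
  · rw [mu_succ, degAt, h2]
    simp [Letter.deg, h3]
  · have h := C.mu_succ (i - 1)
    rw [sub_add_cancel, degAt, h2] at h
    simp [Letter.deg, h3] at h
    omega

/-- Two successive steps run in the same direction along the word, since turning back would read one
letter both as direct and as inverse. The adjacency condition between two letters of the same
orientation is the relation claimed. -/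
theorem Step.mul_mem (hC : C.IsWord) (h : C.Step i j l) (h' : C.Step j m l') :
    l.path.tail = l'.path.head ∧ arrow k l.path.first * arrow k l'.path.last ∈ J := by
  rcases h with ⟨rfl, h2, h3⟩ | ⟨rfl, h2, h3⟩ <;> rcases h' with ⟨rfl, h5, h6⟩ | ⟨rfl, h5, h6⟩
  · have h := hC.adj h2 h5
    rw [Letter.Adj, h3, h6] at h
    exact h
  · rw [h2] at h5
    simp_all
  · rw [sub_add_cancel, h2] at h5
    simp_all
  · have h := hC.adj h5 (b := l) (by rwa [sub_add_cancel])
    rw [Letter.Adj, h3, h6] at h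
    exact ⟨h.1.symm, h.2⟩

theorem Step.eq_or (h : C.Step i j l) : j = i + 1 ∨ j = i - 1 :=
  h.imp And.left And.left

/-- An index has only two neighbours. The degrees show that `h` and `j` are distinct, hence are
these neighbours, and that no step leads from `j` back to `i`. -/
theorem Step.unique_in {h i' : ℤ} (h1 : C.Step h i l) (h2 : C.Step i j l') {l'' : Letter J}
    (h3 : C.Step i' i l'') : i' = h := by
  have e1 := h1.eq_or
  have e2 := h2.eq_or
  have e3 := h3.eq_or
  have e4 := h1.mu_eq
  have e5 := h2.mu_eq
  have e6 := h3.mu_eq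
  have e7 : h ≠ j := by rintro rfl; omega
  have e8 : i' = h ∨ i' = j := by omega
  rcases e8 with rfl | rfl <;> omega

theorem Step.unique_out {h j' : ℤ} (h1 : C.Step h i l) (h2 : C.Step i j l') {l'' : Letter J}
    (h3 : C.Step i j' l'') : j' = j := by
  have e1 := h1.eq_or
  have e2 := h2.eq_or
  have e3 := h3.eq_or
  have e4 := h1.mu_eq
  have e5 := h2.mu_eq
  have e6 := h3.mu_eq
  have e7 : h ≠ j := by rintro rfl; omega
  have e8 : j' = h ∨ j' = j := by omega
  rcases e8 with rfl | rfl <;> omega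

theorem step_or_step (h : C.letterAt (i + 1) = some l) :
    C.Step i (i + 1) l ∨ C.Step (i + 1) i l := by
  rcases hl : l.isInv
  · exact Or.inr (Or.inr ⟨by omega, h, hl⟩)
  · exact Or.inl (Or.inl ⟨rfl, h, hl⟩)

theorem bPlus_cases (C : PreWord J) (i : ℤ) : (C.bPlus i = 0 ∧ ∀ l, ¬ C.Step i (i + 1) l) ∨
    ∃ l, C.Step i (i + 1) l ∧ C.bPlus i = Finsupp.single (i + 1) l.cls := by
  unfold bPlus Step
  rcases h : C.letterAt (i + 1) with _ | l
  · refine Or.inl ⟨rfl, ?_⟩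
    rintro l (⟨-, h1, -⟩ | ⟨h1, -⟩)
    · simp at h1
    · omega
  · rcases hl : l.isInv
    · refine Or.inl ⟨by simp [hl], ?_⟩
      rintro l' (⟨-, h1, h2⟩ | ⟨h1, -⟩)
      · simp only [Option.some_inj] at h1
        simp_all
      · omega
    · exact Or.inr ⟨l, Or.inl ⟨rfl, rfl, hl⟩, by simp [hl]⟩

theorem bMinus_cases (C : PreWord J) (i : ℤ) : (C.bMinus i = 0 ∧ ∀ l, ¬ C.Step i (i - 1) l) ∨
    ∃ l, C.Step i (i - 1) l ∧ C.bMinus i = Finsupp.single (i - 1) l.cls := by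
  unfold bMinus Step
  rcases h : C.letterAt i with _ | l
  · refine Or.inl ⟨rfl, ?_⟩
    rintro l (⟨h1, -⟩ | ⟨-, h1, -⟩)
    · omega
    · simp at h1
  · rcases hl : l.isInv
    · exact Or.inr ⟨l, Or.inr ⟨rfl, rfl, hl⟩, by simp [hl]⟩
    · refine Or.inl ⟨by simp [hl], ?_⟩
      rintro l' (⟨h1, -⟩ | ⟨-, h1, h2⟩)
      · omega
      · simp only [Option.some_inj] at h1
        simp_all

theorem Step.diff_single_apply (h : C.Step i j l) (x : Lam J) :
    C.diff (Finsupp.single i x) j = x * l.cls := by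
  rw [diff_single, Finsupp.smul_apply, Finsupp.add_apply, smul_eq_mul]
  congr 1
  rcases h.eq_or with rfl | rfl
  · rcases C.bPlus_cases i with ⟨-, h2⟩ | ⟨l', h1, h2⟩
    · exact (h2 l h).elim
    · have h3 : C.bMinus i (i + 1) = 0 := by
        rcases C.bMinus_cases i with ⟨h, -⟩ | ⟨l, -, h⟩
        · simp [h]
        · rw [h, Finsupp.single_apply, if_neg (by omega)]
      rw [h3, h2, Finsupp.single_eq_same, zero_add, h.letter_unique h1]
  · rcases C.bMinus_cases i with ⟨-, h2⟩ | ⟨l', h1, h2⟩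
    · exact (h2 l h).elim
    · have h3 : C.bPlus i (i - 1) = 0 := by
        rcases C.bPlus_cases i with ⟨h, -⟩ | ⟨l, -, h⟩
        · simp [h]
        · rw [h, Finsupp.single_apply, if_neg (by omega)]
      rw [h3, h2, Finsupp.single_eq_same, add_zero, h.letter_unique h1]

theorem diff_single_apply_eq_zero (h : ∀ l, ¬ C.Step i j l) (x : Lam J) :
    C.diff (Finsupp.single i x) j = 0 := by
  rw [diff_single, Finsupp.smul_apply, Finsupp.add_apply]
  have h1 : C.bPlus i j = 0 := by
    rcases C.bPlus_cases i with ⟨h1, -⟩ | ⟨l, hl, h1⟩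
    · simp [h1]
    · rw [h1, Finsupp.single_apply, if_neg]
      rintro rfl
      exact h l hl
  have h2 : C.bMinus i j = 0 := by
    rcases C.bMinus_cases i with ⟨h2, -⟩ | ⟨l, hl, h2⟩
    · simp [h2]
    · rw [h2, Finsupp.single_apply, if_neg]
      rintro rfl
      exact h l hl
  rw [h1, h2, add_zero, smul_zero]

theorem diff_single_eq_zero (h : ∀ j l, ¬ C.Step i j l) (x : Lam J) :
    C.diff (Finsupp.single i x) = 0 := by
  ext j
  exact diff_single_apply_eq_zero (h j) x

theorem Step.diff_single (h : C.Step i j l) (hu : ∀ j' l', C.Step i j' l' → j' = j) (x : Lam J) :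
    C.diff (Finsupp.single i x) = Finsupp.single j (x * l.cls) := by
  ext j'
  by_cases hj : j = j'
  · subst hj
    rw [h.diff_single_apply, Finsupp.single_eq_same]
  · rw [Finsupp.single_apply, if_neg hj, diff_single_apply_eq_zero]
    intro l' h'
    exact hj (hu _ _ h').symm

/-- When `j` receives a single step, no sum of two contributions arises there, and vanishing of the
differential can be tested on one coefficient. -/
theorem Step.diff_apply (h : C.Step i j l) (hu : ∀ i' l', C.Step i' j l' → i' = i)
    (f : ℤ →₀ Lam J) : C.diff f j = f i * l.cls := by
  induction f using Finsupp.induction_linear with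
  | zero => simp
  | add f g hf hg => rw [map_add, Finsupp.add_apply, hf, hg, Finsupp.add_apply, add_mul]
  | single i' x =>
    by_cases hi : i' = i
    · subst hi
      rw [h.diff_single_apply, Finsupp.single_eq_same]
    · rw [diff_single_apply_eq_zero, Finsupp.single_apply, if_neg hi, zero_mul]
      intro l' h'
      exact hi (hu _ _ h')

theorem single_idem_mem_comp {v : Q} (hv : C.vertexAt i = some v) (hn : C.mu i = n) :
    Finsupp.single i (idem J v) ∈ C.comp n := by
  refine single_mem_comp ?_
  rw [stalk, if_pos hn, hv]
  exact Ideal.subset_span rfl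

theorem eq_zero_or_of_mem_stalk {x : Lam J} (hx : x ∈ C.stalk n i) :
    x = 0 ∨ C.mu i = n ∧ ∃ v, C.vertexAt i = some v ∧ x * idem J v = x := by
  unfold stalk at hx
  split_ifs at hx with h
  · rcases hv : C.vertexAt i with _ | v
    · rw [hv] at hx
      exact Or.inl hx
    · rw [hv] at hx
      obtain ⟨y, rfl⟩ := Ideal.mem_span_singleton'.1 hx
      exact Or.inr ⟨h, v, rfl, by rw [mul_assoc, idem_mul_idem]⟩
  · exact Or.inl hx

theorem mem_stalk {x : Lam J} {v : Q} (hn : C.mu i = n) (hv : C.vertexAt i = some v)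
    (hx : x * idem J v = x) : x ∈ C.stalk n i := by
  rw [stalk, if_pos hn, hv]
  exact Ideal.mem_span_singleton'.2 ⟨x, hx⟩

/-- The `i`-th component of an element of `Pⁿ(C)`, as an element of `Pⁿ(C)`. -/
def component (f : C.comp n) (i : ℤ) : C.comp n :=
  ⟨Finsupp.single i (f.1 i), single_mem_comp (f.2 i)⟩

theorem sum_component (f : C.comp n) : ∑ i ∈ f.1.support, component f i = f := by
  refine Subtype.ext ?_
  rw [AddSubmonoidClass.coe_finsetSum]
  exact Finsupp.sum_single f.1

end PreWord

variable {M : Type*} [AddCommGroup M] [Module (Lam J) M]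

/-- A homomorphism to a semisimple module vanishes on the image of the differential of `P(C)`. -/
theorem Word.map_dHom_eq_zero (C : Word J) (hM : ∀ (l : Letter J) (y : M), l.cls • y = 0) {n m : ℤ}
    (h : n + 1 = m) (φ : C.pre.comp m →ₗ[Lam J] M) (x : C.pre.comp n) : φ (C.dHom h x) = 0 := by
  rw [← PreWord.sum_component x, map_sum, map_sum]
  refine Finset.sum_eq_zero fun i hi => ?_
  rcases PreWord.eq_zero_or_of_mem_stalk (x.2 i) with h0 | ⟨hn, -⟩
  · exact (Finsupp.mem_support_iff.1 hi h0).elim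
  -- The term `γ b_j` is `γ` times an element of the module, so by linearity `φ` sends it to a
  -- multiple of `γ` in `M`, which is zero.
  have key : ∀ {j l}, C.pre.Step i j l → ∃ h' : Finsupp.single j l.cls ∈ C.pre.comp m,
      φ ⟨Finsupp.single j l.cls, h'⟩ = 0 := by
    intro j l hl
    have h1 := PreWord.single_idem_mem_comp (n := m) (hl.vertexAt_right C.isWord)
      (by rw [hl.mu_eq]; omega)
    have h2 : l.cls • Finsupp.single j (idem J l.path.tail) = Finsupp.single j l.cls := by
      rw [Finsupp.smul_single, smul_eq_mul, l.cls_mul_idem]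
    refine ⟨h2 ▸ Submodule.smul_mem _ _ h1, ?_⟩
    have h3 : φ (l.cls • ⟨_, h1⟩) = 0 := by rw [map_smul, hM]
    convert h3 using 2
    exact Subtype.ext h2.symm
  have hp : ∃ h' : C.pre.bPlus i ∈ C.pre.comp m, φ ⟨_, h'⟩ = 0 := by
    rcases C.pre.bPlus_cases i with ⟨h1, -⟩ | ⟨l, h1, h2⟩
    · rw [h1]
      exact ⟨zero_mem _, map_zero φ⟩
    · rw [h2]
      exact key h1
  have hm : ∃ h' : C.pre.bMinus i ∈ C.pre.comp m, φ ⟨_, h'⟩ = 0 := by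
    rcases C.pre.bMinus_cases i with ⟨h1, -⟩ | ⟨l, h1, h2⟩
    · rw [h1]
      exact ⟨zero_mem _, map_zero φ⟩
    · rw [h2]
      exact key h1
  obtain ⟨hp, hp'⟩ := hp
  obtain ⟨hm, hm'⟩ := hm
  have h1 : C.dHom h (PreWord.component x i) = x.1 i • (⟨_, hm⟩ + ⟨_, hp⟩) :=
    Subtype.ext (C.pre.diff_single i _)
  rw [h1, map_smul, map_add, hp', hm', add_zero, smul_zero]

end Steps

/-! ### What a homotopy equivalence preserves -/

section Homotopy

variable {Λ : Type u} [Ring Λ] {X Y : CochainComplex (ModuleCat.{u} Λ) ℤ}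

theorem exists_homotopy_apply (e : HomotopyEquiv X Y) {l n m : ℤ} (hl : l + 1 = n)
    (hm : n + 1 = m) : ∃ (h : X.X m →ₗ[Λ] X.X n) (h' : X.X n →ₗ[Λ] X.X l), ∀ x : X.X n,
      e.inv.f n (e.hom.f n x) = h (X.d n m x) + X.d l n (h' x) + x := by
  refine ⟨(e.homotopyHomInvId.hom m n).hom, (e.homotopyHomInvId.hom n l).hom, fun x => ?_⟩
  have h1 := e.homotopyHomInvId.comm n
  rw [dNext_eq _ (show (ComplexShape.up ℤ).Rel n m from hm),
    prevD_eq _ (show (ComplexShape.up ℤ).Rel l n from hl)] at h1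
  exact congrArg (fun f : X.X n ⟶ X.X n => f x) h1

/-- Both homotopy terms vanish under `φ`: one is a boundary, and the other is `φ ∘ h` evaluated at a
boundary, where `φ ∘ h` is again a homomorphism to `M`. -/
theorem map_inv_hom_apply {M : Type*} [AddCommGroup M] [Module Λ M]
    (hM : ∀ (n m : ℤ) (φ : X.X m →ₗ[Λ] M) (x : X.X n), n + 1 = m → φ (X.d n m x) = 0)
    (e : HomotopyEquiv X Y) {n : ℤ} (φ : X.X n →ₗ[Λ] M) (x : X.X n) :
    φ (e.inv.f n (e.hom.f n x)) = φ x := by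
  obtain ⟨h, h', H⟩ := exists_homotopy_apply e (sub_add_cancel n 1) rfl
  have h1 := hM n (n + 1) (φ ∘ₗ h) x rfl
  rw [LinearMap.comp_apply] at h1
  rw [H, map_add, map_add, h1, hM _ _ _ _ (sub_add_cancel n 1), zero_add, zero_add]

theorem exists_d_eq_of_homotopyEquiv (e : HomotopyEquiv X Y) {l n m : ℤ} (hl : l + 1 = n)
    (hm : n + 1 = m)
    (hY : LinearMap.range (Y.d l n).hom = LinearMap.ker (Y.d n m).hom) {x : X.X n}
    (hx : X.d n m x = 0) : ∃ z, X.d l n z = x := by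
  obtain ⟨h, h', H⟩ := exists_homotopy_apply e hl hm
  have comm : ∀ {A B : CochainComplex (ModuleCat.{u} Λ) ℤ} (f : A ⟶ B) (i j : ℤ) (a : A.X i),
      B.d i j (f.f i a) = f.f j (A.d i j a) := fun f i j a =>
    congrArg (fun g => g a) (f.comm i j)
  have h1 : e.hom.f n x ∈ LinearMap.ker (Y.d n m).hom := by
    rw [LinearMap.mem_ker]
    exact (comm e.hom n m x).trans (by rw [hx, map_zero])
  rw [← hY] at h1
  obtain ⟨y, hy⟩ := h1
  -- The image of the cycle `x` in `Y` bounds `y`. Pulling `y` back gives a primitive of `x` up to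
  -- the homotopy term `d (h' x)`, which is subtracted.
  refine ⟨e.inv.f l y - h' x, ?_⟩
  have h2 := H x
  have h3 : X.d l n (e.inv.f l y) = e.inv.f n (e.hom.f n x) := by
    rw [comm]
    exact congrArg (e.inv.f n) hy
  rw [map_sub, h3, h2, hx, map_zero, zero_add, add_sub_cancel_left]

end Homotopy

/-! ### First arrows and paths of length one -/

section Paths

variable {Q : Type u} [Quiver.{u} Q]

/-- The definition of `firstArrowAux` does not force `a` to start where `p` ends. The hypothesis
supplies this, and it matters when `p` is trivial. -/
theorem NPath.tail_firstArrowAux : ∀ {v w : Q} (p : Quiver.Path v w) (a : Arrow Q) (_ : a.tail = w),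
    (firstArrowAux p a).tail = v
  | _, _, .nil, _, h => h
  | _, _, .cons q _, _, _ => NPath.tail_firstArrowAux q _ rfl

theorem NPath.tail_first (γ : NPath Q) : γ.first.tail = γ.tail :=
  NPath.tail_firstArrowAux γ.front γ.last rfl

/-- An arrow as a non-trivial path. -/
def NPath.ofArrow (a : Arrow Q) : NPath Q := ⟨a.tail, a, .nil⟩

theorem NPath.ext_of_length {γ δ : NPath Q} (hγ : γ.length = 1) (hδ : δ.length = 1)
    (h : γ.last = δ.last) : γ = δ := by
  have key : ∀ γ : NPath Q, γ.length = 1 → γ = NPath.ofArrow γ.last := by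
    rintro ⟨t, a, p⟩ h
    have h1 : p.length = 0 := Nat.succ_injective h
    cases p with
    | nil => rfl
    | cons p e => simp at h1
  rw [key γ hγ, key δ hδ, h]

theorem NPath.eq_ofArrow {γ : NPath Q} (hγ : γ.length = 1) : γ = NPath.ofArrow γ.last :=
  ext_of_length hγ rfl rfl

theorem NPath.first_eq_last {γ : NPath Q} (hγ : γ.length = 1) : γ.first = γ.last := by
  rw [eq_ofArrow hγ]
  rfl

end Paths

/-! ### Generators, projectivity and finiteness of the components -/

section Generators

variable {k : Type u} [Field k] {Q : Type u} [Quiver.{u} Q] [Fintype Q]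
  {J : TwoSidedIdeal (PathAlgebra k Q)}

namespace PreWord

variable {C : PreWord J} {i n : ℤ}

open Classical in
/-- The generator `b_i` as an element of `Pⁿ(C)`, and zero if `b_i` is not of degree `n`. -/
def gen (C : PreWord J) (n i : ℤ) : C.comp n :=
  if h : C.mu i = n ∧ ∃ v, C.vertexAt i = some v then
    ⟨Finsupp.single i (idem J h.2.choose), single_idem_mem_comp h.2.choose_spec h.1⟩
  else 0

theorem gen_eq {v : Q} (hn : C.mu i = n) (hv : C.vertexAt i = some v) :
    C.gen n i = ⟨Finsupp.single i (idem J v), single_idem_mem_comp hv hn⟩ := by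
  have h : C.mu i = n ∧ ∃ v, C.vertexAt i = some v := ⟨hn, v, hv⟩
  have h1 : h.2.choose = v := Option.some_injective _ (h.2.choose_spec.symm.trans hv)
  rw [gen, dif_pos h]
  exact Subtype.ext (congrArg (fun w => Finsupp.single i (idem J w)) h1)

theorem gen_eq_zero (h : ¬ (C.mu i = n ∧ ∃ v, C.vertexAt i = some v)) : C.gen n i = 0 :=
  dif_neg h

theorem component_eq_smul_gen (f : C.comp n) (i : ℤ) : component f i = f.1 i • C.gen n i := by
  rcases eq_zero_or_of_mem_stalk (f.2 i) with h | ⟨h1, v, h2, h3⟩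
  · rw [h, zero_smul]
    refine Subtype.ext ?_
    change Finsupp.single i (f.1 i) = 0
    rw [h, Finsupp.single_zero]
  · rw [gen_eq h1 h2]
    refine Subtype.ext ?_
    change Finsupp.single i (f.1 i) = f.1 i • Finsupp.single i (idem J v)
    rw [Finsupp.smul_single, smul_eq_mul, h3]

theorem sum_smul_gen (f : C.comp n) : ∑ i ∈ f.1.support, f.1 i • C.gen n i = f := by
  simp_rw [← component_eq_smul_gen]
  exact sum_component f

/-- The inclusion into the free module on `ℤ` is split by the map which sends the basis element at
`i` to `gen`, since every element is the combination of the generators with its own coefficients. -/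
instance (C : PreWord J) (n : ℤ) : Module.Projective (Lam J) (C.comp n) := by
  refine .of_split (C.comp n).subtype (Finsupp.linearCombination (Lam J) (C.gen n)) ?_
  ext1 f
  exact sum_smul_gen f

theorem finite_comp (h : {i : ℤ | C.mu i = n ∧ ∃ v, C.vertexAt i = some v}.Finite) :
    Module.Finite (Lam J) (C.comp n) := by
  refine ⟨Submodule.fg_def.2 ⟨C.gen n '' _, h.image _, ?_⟩⟩
  rw [eq_top_iff]
  rintro f -
  rw [← sum_smul_gen f]
  refine Submodule.sum_mem _ fun i _ => Submodule.smul_mem _ _ ?_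
  by_cases hi : C.mu i = n ∧ ∃ v, C.vertexAt i = some v
  · exact Submodule.subset_span ⟨i, hi, rfl⟩
  · rw [gen_eq_zero hi]
    exact zero_mem _

theorem subsingleton_comp (h : ∀ i v, C.vertexAt i = some v → C.mu i ≠ n) :
    Subsingleton (C.comp n) := by
  refine subsingleton_of_forall_eq 0 fun f => ?_
  rw [← sum_smul_gen f]
  refine Finset.sum_eq_zero fun i _ => ?_
  rw [gen_eq_zero, smul_zero]
  rintro ⟨h1, v, h2⟩
  exact h i v h2 h1

end PreWord

end Generators

/-! ### Necessary conditions for a string complex to lie in `K^{+,b}` -/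

section StringComplexes

variable {k : Type u} [Field k] {Q : Type u} [Quiver.{u} Q] [Fintype Q]
  {J : TwoSidedIdeal (PathAlgebra k Q)}

theorem Word.stringComplex_d_apply (C : Word J) {n m : ℤ} (h : n + 1 = m) (x : C.pre.comp n) :
    C.stringComplex.d n m x = C.dHom h x := by
  have h1 : C.stringComplex.d n m = ModuleCat.ofHom (C.dHom h) := dif_pos h
  rw [h1]
  rfl

namespace IsGentle

variable (hJ : IsGentle J) {C : Word J} {Y : CochainComplex (ModuleCat.{u} (Lam J)) ℤ}
include hJ

/-- Reading the `i`-th coefficient in the simple module at `v` gives `1` on `b_i`, and by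
`map_inv_hom_apply` this value survives the passage through `Yⁿ`. The functional therefore cannot
vanish on the images of all the generators of `Yⁿ`. -/
theorem exists_vertexHom_apply_ne_zero (e : HomotopyEquiv C.stringComplex Y) {n i : ℤ} {v : Q}
    (hn : C.pre.mu i = n) (hv : C.pre.vertexAt i = some v) (S : Set (Y.X n))
    (hS : Submodule.span (Lam J) S = ⊤) : ∃ y ∈ S, (e.inv.f n y : C.pre.comp n).1 i ≠ 0 := by
  let _ : Module (Lam J) k := Module.compHom k (hJ.vertexHom v)
  have hk : ∀ (a : Lam J) (c : k), a • c = hJ.vertexHom v a * c := fun a c => rfl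
  let φ : C.pre.comp n →ₗ[Lam J] k :=
    { toFun f := hJ.vertexHom v (f.1 i)
      map_add' f g := map_add (hJ.vertexHom v) (f.1 i) (g.1 i)
      map_smul' a f := map_mul (hJ.vertexHom v) a (f.1 i) }
  by_contra! H
  have h1 : φ ∘ₗ (e.inv.f n).hom = 0 := by
    refine LinearMap.ext_on hS fun y hy => ?_
    change hJ.vertexHom v ((e.inv.f n y : C.pre.comp n).1 i) = 0
    rw [H y hy, map_zero]
  have h2 := map_inv_hom_apply (X := C.stringComplex) (M := k) (fun n m φ x h => by
    exact (congrArg φ (C.stringComplex_d_apply h x)).trans (C.map_dHom_eq_zero (fun l y => by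
      rw [hk, Letter.cls, hJ.vertexHom_pathClass, zero_mul]) h φ x)) e φ (C.pre.gen n i)
  have h3 : φ (C.pre.gen n i) = 1 := by
    rw [PreWord.gen_eq hn hv]
    change hJ.vertexHom v (Finsupp.single i (idem J v) i) = 1
    rw [Finsupp.single_eq_same, hJ.vertexHom_idem]
  have h4 := LinearMap.congr_fun h1 (e.hom.f n (C.pre.gen n i))
  exact zero_ne_one (h4.symm.trans (h2.trans h3))

/-- The indices all lie in the union of the supports of finitely many elements, the images of a
finite generating set of `Yⁿ`. -/
theorem finite_setOf_mu_eq (e : HomotopyEquiv C.stringComplex Y) (hY : IsPlusB Y) (n : ℤ) :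
    {i : ℤ | C.pre.mu i = n ∧ ∃ v, C.pre.vertexAt i = some v}.Finite := by
  obtain ⟨S, hS, hS'⟩ := Submodule.fg_def.1 (hY.finite n).fg_top
  refine (hS.biUnion fun y _ => (e.inv.f n y : C.pre.comp n).1.hasFiniteSupport).subset ?_
  rintro i ⟨hn, v, hv⟩
  obtain ⟨y, hy, h⟩ := hJ.exists_vertexHom_apply_ne_zero e hn hv S hS'
  exact Set.mem_biUnion hy h

theorem exists_forall_le_mu (e : HomotopyEquiv C.stringComplex Y) (hY : IsPlusB Y) :
    ∃ n, ∀ i v, C.pre.vertexAt i = some v → n ≤ C.pre.mu i := by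
  obtain ⟨n, hn⟩ := hY.leftBounded
  refine ⟨n, fun i v hv => ?_⟩
  by_contra! h
  have := hn _ h
  -- A zero module is generated by the empty set, which leaves no generator to detect `b_i`.
  obtain ⟨y, hy, -⟩ := hJ.exists_vertexHom_apply_ne_zero e rfl hv ∅
    (Subsingleton.elim (h := Submodule.subsingleton_iff _ |>.2 this) _ _)
  exact hy

theorem finite_setOf_mu_le (e : HomotopyEquiv C.stringComplex Y) (hY : IsPlusB Y) (m : ℤ) :
    {i : ℤ | C.pre.mu i ≤ m ∧ ∃ v, C.pre.vertexAt i = some v}.Finite := by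
  obtain ⟨n, hn⟩ := hJ.exists_forall_le_mu e hY
  refine ((Set.finite_Icc n m).biUnion fun l _ => hJ.finite_setOf_mu_eq e hY l).subset ?_
  rintro i ⟨h, v, hv⟩
  exact Set.mem_biUnion ⟨hn i v hv, h⟩ ⟨rfl, v, hv⟩

end IsGentle

/-- The complex `P(C)` is exact in the degree `n`. -/
def Word.ExactIn (C : Word J) (n : ℤ) : Prop :=
  ∀ f ∈ C.pre.comp n, C.pre.diff f = 0 → ∃ g ∈ C.pre.comp (n - 1), C.pre.diff g = f

theorem exists_forall_exactIn {C : Word J} {Y : CochainComplex (ModuleCat.{u} (Lam J)) ℤ}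
    (e : HomotopyEquiv C.stringComplex Y) (hY : IsPlusB Y) : ∃ h, ∀ n, h < n → C.ExactIn n := by
  obtain ⟨h, H⟩ := hY.boundedCohomology
  -- The bound on cohomology is indexed by the source of the incoming differential, so exactness in
  -- degree `n` is its instance at `n - 1`.
  refine ⟨h + 1, fun n hn f hf hdf => ?_⟩
  have H1 := H (n - 1) (by rw [Set.mem_Icc]; omega)
  have hn1 : n - 1 + 1 = n := sub_add_cancel n 1
  rw [hn1] at H1
  obtain ⟨g, hg⟩ := exists_d_eq_of_homotopyEquiv e hn1 rfl H1 (x := (⟨f, hf⟩ : C.pre.comp n))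
    ((C.stringComplex_d_apply rfl _).trans (Subtype.ext hdf))
  refine ⟨(g : C.pre.comp (n - 1)).1, (g : C.pre.comp (n - 1)).2, ?_⟩
  exact congrArg Subtype.val ((C.stringComplex_d_apply hn1 g).symm.trans hg)

namespace IsGentle

variable (hJ : IsGentle J) {C : Word J} {h i j m n : ℤ} {l l' : Letter J}
include hJ

/-- Two incoming steps use up both neighbours of `i`, so `b_i` is a cycle. It is not a boundary,
because the `i`-th coefficient of a boundary is a sum of multiples of non-trivial paths and vanishes
in the simple module, where that of `b_i` is `1`. -/
theorem not_step_step (hC : C.ExactIn (C.pre.mu i)) (h1 : C.pre.Step h i l)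
    (h2 : C.pre.Step j i l') (hne : h ≠ j) : False := by
  have hv := h1.vertexAt_right C.isWord
  obtain ⟨g, -, hg⟩ := hC _ (PreWord.single_idem_mem_comp hv rfl)
    (PreWord.diff_single_eq_zero (fun m l'' hm => by
      have e1 := h1.eq_or
      have e2 := h2.eq_or
      have e3 := hm.eq_or
      have e4 := h1.mu_eq
      have e5 := h2.mu_eq
      have e6 := hm.mu_eq
      have e7 : m = h ∨ m = j := by omega
      rcases e7 with rfl | rfl <;> omega) _)
  have h3 := congrArg (fun f => hJ.vertexHom l.path.tail (f i)) hg
  simp only [Finsupp.single_eq_same, hJ.vertexHom_idem] at h3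
  refine zero_ne_one (h3.symm.trans ?_).symm
  clear hg h3
  induction g using Finsupp.induction_linear with
  | zero => simp
  | add f g hf hg => rw [map_add, Finsupp.add_apply, map_add, hf, hg, add_zero]
  | single m x =>
    by_cases hm : ∃ l'', C.pre.Step m i l''
    · obtain ⟨l'', hm⟩ := hm
      rw [hm.diff_single_apply, map_mul, Letter.cls, hJ.vertexHom_pathClass, mul_zero]
    · push Not at hm
      rw [PreWord.diff_single_apply_eq_zero hm, map_zero]

/-- Let `γ` be the path of the step into `i` and `a` its first arrow. The relation between the two
steps already kills `a b_i`, so exactness makes `a` a left multiple of `γ`. By length this forces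
`γ` to be a single arrow. -/
theorem length_eq_one_of_exactIn (hC : C.ExactIn (C.pre.mu i)) (h1 : C.pre.Step h i l)
    (h2 : C.pre.Step i j l') : l.path.length = 1 := by
  have hv := h1.vertexAt_right C.isWord
  have hx : pathClass J (QPath.ofArrow l.path.first) * idem J l.path.tail =
      pathClass J (QPath.ofArrow l.path.first) := by
    rw [← l.path.tail_first]
    exact pathClass_mul_idem J (QPath.ofArrow l.path.first)
  obtain ⟨g, -, hg⟩ := hC _ (PreWord.single_mem_comp (PreWord.mem_stalk rfl hv hx)) (by
    rw [h2.diff_single fun _ _ => h1.unique_out h2]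
    have h3 := pathClass_mul_eq_zero (γ := NPath.ofArrow l.path.first)
      (h1.mul_mem C.isWord h2).2
    change pathClass J (QPath.ofArrow l.path.first) * l'.cls = 0 at h3
    rw [h3, Finsupp.single_zero])
  have h3 := congrArg (fun f => f i) hg
  simp only [Finsupp.single_eq_same] at h3
  rw [h1.diff_apply fun _ _ => h1.unique_in h2] at h3
  exact le_antisymm (hJ.length_le_one_of_mul_eq h3) (Nat.succ_pos _)

/-- If `P(C)` is exact in high degrees, then an infinite end of `C` along which the degrees tend to
infinity eventually consists of arrows which raise the degree. -/
theorem exists_forall_step (hfin : ∀ m, {i : ℤ | C.pre.mu i ≤ m ∧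
      ∃ v, C.pre.vertexAt i = some v}.Finite)
    (hex : ∃ h, ∀ n, h < n → C.ExactIn n) (g : ℕ → ℤ) (hg : g.Injective)
    (hstep : ∀ t, ∃ l, C.pre.Step (g t) (g (t + 1)) l ∨ C.pre.Step (g (t + 1)) (g t) l) :
    ∃ N, ∀ t ≥ N, ∃ l, C.pre.Step (g t) (g (t + 1)) l ∧ l.path.length = 1 := by
  obtain ⟨h, hex⟩ := hex
  -- Only finitely many indices have degree at most `h`, and `g` is injective, so it eventually
  -- avoids them.
  have h1 : ∃ N, ∀ t ≥ N, h < C.pre.mu (g t) := by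
    obtain ⟨N, hN⟩ := ((hfin h).preimage hg.injOn).bddAbove
    refine ⟨N + 1, fun t ht => ?_⟩
    by_contra! H
    have hv : ∃ v, C.pre.vertexAt (g t) = some v := by
      obtain ⟨l, hl | hl⟩ := hstep t
      · exact ⟨_, hl.vertexAt_left C.isWord⟩
      · exact ⟨_, hl.vertexAt_right C.isWord⟩
    have := hN (show t ∈ g ⁻¹' _ from ⟨H, hv⟩)
    omega
  obtain ⟨N, hN⟩ := h1
  -- If every later step pointed backwards, the degree would fall by one each time and reach `h`
  -- after `μ(g N) - h` letters.
  have h2 : ∃ t ≥ N, ∃ l, C.pre.Step (g t) (g (t + 1)) l := by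
    by_contra! H
    have h3 : ∀ s : ℕ, C.pre.mu (g (N + s)) = C.pre.mu (g N) - s := by
      intro s
      induction s with
      | zero => simp
      | succ s ih =>
        obtain ⟨l, hl | hl⟩ := hstep (N + s)
        · exact (H _ (by omega) l hl).elim
        · have h4 := hl.mu_eq
          rw [ih] at h4
          rw [← add_assoc]
          push_cast
          omega
    have h4 := h3 (C.pre.mu (g N) - h).toNat
    have h5 := hN N le_rfl
    have h6 := hN (N + (C.pre.mu (g N) - h).toNat) (by omega)
    omega
  obtain ⟨t₀, ht₀, h2⟩ := h2
  have h3 : ∀ t ≥ t₀, ∃ l, C.pre.Step (g t) (g (t + 1)) l := by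
    intro t ht
    induction t, ht using Nat.le_induction with
    | base => exact h2
    | succ t ht ih =>
      obtain ⟨l, hl⟩ := ih
      obtain ⟨l', hl' | hl'⟩ := hstep (t + 1)
      · exact ⟨l', hl'⟩
      -- A backward step right after a forward one would give two steps into `g (t + 1)`. So once
      -- the degree rises, it rises for ever.
      · exact (hJ.not_step_step (hex _ (hN _ (by omega))) hl hl'
          (fun h => by have := hg h; omega)).elim
  refine ⟨t₀, fun t ht => ?_⟩
  obtain ⟨l, hl⟩ := h3 t ht
  obtain ⟨l', hl'⟩ := h3 (t + 1) (by omega)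
  exact ⟨l, hl, hJ.length_eq_one_of_exactIn (hex _ (hN _ (by omega))) hl hl'⟩

end IsGentle

end StringComplexes

/-! ### Words with resolving ends and exactness of their complexes -/

section Ends

variable {k : Type u} [Field k] {Q : Type u} [Quiver.{u} Q] [Fintype Q]
  {J : TwoSidedIdeal (PathAlgebra k Q)}

namespace PreWord

/-- The sequence `C` stops along `g`, or it eventually consists of arrows which raise the
degree. -/
def EventuallyUp (C : PreWord J) (g : ℕ → ℤ) : Prop :=
  ∃ N, (∀ t ≥ N, C.vertexAt (g t) = none) ∨
    ∀ t ≥ N, ∃ l, C.Step (g t) (g (t + 1)) l ∧ l.path.length = 1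

/-- Each of the ends of `C` stops or eventually consists of arrows which raise the degree. -/
structure HasResolvingEnds (C : PreWord J) : Prop where
  right : C.EventuallyUp fun t => t
  left : C.EventuallyUp fun t => -t

variable {C : PreWord J} {g : ℕ → ℤ}

theorem EventuallyUp.exists_mu_eq (h : C.EventuallyUp g) : ∃ (N : ℕ) (b : ℤ), ∀ t ≥ N,
    ∀ v, C.vertexAt (g t) = some v → C.mu (g t) = b + t := by
  obtain ⟨N, h | h⟩ := h
  · exact ⟨N, 0, fun t ht v hv => by simp [h t ht] at hv⟩
  · refine ⟨N, C.mu (g N) - N, fun t ht v hv => ?_⟩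
    clear hv
    induction t, ht using Nat.le_induction with
    | base => omega
    | succ t ht ih =>
      obtain ⟨l, hl, -⟩ := h t ht
      have := hl.mu_eq
      push_cast
      omega

theorem EventuallyUp.finite_setOf (h : C.EventuallyUp g) (n : ℤ) :
    {t : ℕ | C.mu (g t) = n ∧ ∃ v, C.vertexAt (g t) = some v}.Finite := by
  obtain ⟨N, b, h⟩ := h.exists_mu_eq
  refine (Set.finite_Iic (N + (n - b).toNat)).subset ?_
  rintro t ⟨h1, v, hv⟩
  rw [Set.mem_Iic]
  by_contra! H
  have := h t (by omega) v hv
  omega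

theorem EventuallyUp.exists_le_mu (h : C.EventuallyUp g) :
    ∃ b, ∀ t v, C.vertexAt (g t) = some v → b ≤ C.mu (g t) := by
  obtain ⟨N, b, h⟩ := h.exists_mu_eq
  obtain ⟨b', hb'⟩ := ((Set.finite_Iio N).image fun t => C.mu (g t)).bddBelow
  refine ⟨min b b', fun t v hv => ?_⟩
  rcases lt_or_ge t N with ht | ht
  · exact (min_le_right _ _).trans (hb' ⟨t, ht, rfl⟩)
  · rw [h t ht v hv]
    exact (min_le_left _ _).trans (by omega)

/-- Choosing `b` above the degrees of the first `N + 2` positions forces `t` to be at least `N + 2`.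
The two steps before `t`, and those after it, are the room that `IsGentle.exists_diff_eq_single`
needs. -/
theorem EventuallyUp.exists_steps (h : C.EventuallyUp g) : ∃ b, ∀ t v,
    C.vertexAt (g t) = some v → b < C.mu (g t) → ∃ s, t = s + 2 ∧
      ∀ r ≥ s, ∃ l, C.Step (g r) (g (r + 1)) l ∧ l.path.length = 1 := by
  obtain ⟨N, h⟩ := h
  obtain ⟨b, hb⟩ := ((Set.finite_Iio (N + 2)).image fun t => C.mu (g t)).bddAbove
  refine ⟨b, fun t v hv ht => ?_⟩
  rcases lt_or_ge t (N + 2) with htN | htN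
  · exact (not_le.2 ht (hb ⟨t, htN, rfl⟩)).elim
  · rcases h with h | h
    · simp [h t (by omega)] at hv
    · exact ⟨t - 2, by omega, fun r hr => h r (by omega)⟩

theorem eventuallyUp_of_letterAt_eq_none (hC : ∀ v δ, C ≠ triv v δ) {N : ℕ}
    (h : ∀ t ≥ N, C.letterAt (g t) = none ∧ C.letterAt (g t + 1) = none) : C.EventuallyUp g := by
  refine ⟨N, Or.inl fun t ht => ?_⟩
  obtain ⟨h1, h2⟩ := h t ht
  cases C with
  | triv v δ => exact (hC v δ rfl).elim
  | _ => simp only [vertexAt, h1, h2]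

theorem hasResolvingEnds_triv (v : Q) (δ : ℤˣ) : (triv v δ : PreWord J).HasResolvingEnds :=
  ⟨⟨1, Or.inl fun t (ht : 1 ≤ t) => if_neg (by simp; omega)⟩,
    ⟨1, Or.inl fun t (ht : 1 ≤ t) => if_neg (by simp; omega)⟩⟩

theorem hasResolvingEnds_fin (L : List (Letter J)) : (fin L).HasResolvingEnds := by
  constructor
  · refine eventuallyUp_of_letterAt_eq_none nofun (N := L.length + 1) fun t ht => ?_
    have h1 : L[((t : ℤ) - 1).toNat]? = none := List.getElem?_eq_none (by omega)
    have h2 : L[((t : ℤ) + 1 - 1).toNat]? = none := List.getElem?_eq_none (by omega)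
    simp only [letterAt, h1, h2, ite_self, and_self]
  · refine eventuallyUp_of_letterAt_eq_none nofun (N := 1) fun t ht => ?_
    exact ⟨if_neg (by omega), if_neg (by omega)⟩

theorem eventuallyUp_nat_left (f : ℕ → Letter J) : (nat f).EventuallyUp fun t => -t :=
  eventuallyUp_of_letterAt_eq_none nofun (N := 1) fun t ht =>
    ⟨if_neg (by omega), if_neg (by omega)⟩

theorem eventuallyUp_neg_right (f : ℕ → Letter J) : (neg f).EventuallyUp fun t => t := by
  refine eventuallyUp_of_letterAt_eq_none nofun (N := 1) fun t ht => ?_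
  have h1 : ¬ (t : ℤ) ≤ 0 := by omega
  have h2 : ¬ (t : ℤ) + 1 ≤ 0 := by omega
  simp only [letterAt, h1, h2, if_false, and_self]

theorem eventuallyUp_right_iff {f : ℕ → Letter J} (h : ∀ t : ℕ, C.letterAt (t + 1) = some (f t)) :
    (C.EventuallyUp fun t => t) ↔
      ∃ N, ∀ t ≥ N, (f t).isInv = true ∧ (f t).path.length = 1 := by
  refine exists_congr fun N => ⟨fun H t ht => ?_, fun H => Or.inr fun t ht => ?_⟩
  -- The word has a letter at every position on this side, so the alternative that it stops cannot
  -- occur.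
  · rcases H with H | H
    · have h1 := H (t + 1) (by omega)
      have h2 := vertexAt_of_letterAt (h t)
      push_cast at h1
      simp [h2] at h1
    · obtain ⟨l, ⟨-, hl, hl'⟩ | ⟨hl, -⟩, hl''⟩ := H t ht
      · push_cast at hl
        obtain rfl : f t = l := Option.some_injective _ ((h t).symm.trans hl)
        exact ⟨hl', hl''⟩
      · push_cast at hl
        omega
  · exact ⟨f t, Or.inl ⟨rfl, by push_cast; exact h t, (H t ht).1⟩, (H t ht).2⟩

theorem eventuallyUp_left_iff {f : ℕ → Letter J} (h : ∀ t : ℕ, C.letterAt (-t) = some (f t)) :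
    (C.EventuallyUp fun t => -t) ↔
      ∃ N, ∀ t ≥ N, (f t).isInv = false ∧ (f t).path.length = 1 := by
  refine exists_congr fun N => ⟨fun H t ht => ?_, fun H => Or.inr fun t ht => ?_⟩
  · rcases H with H | H
    · have h1 := H t ht
      have h2 := vertexAt_of_letterAt (h t)
      simp [h2] at h1
    · obtain ⟨l, ⟨hl, -⟩ | ⟨-, hl, hl'⟩, hl''⟩ := H t ht
      · push_cast at hl
        omega
      · obtain rfl : f t = l := Option.some_injective _ ((h t).symm.trans hl)
        exact ⟨hl', hl''⟩
  · exact ⟨f t, Or.inr ⟨by push_cast; ring, h t, (H t ht).1⟩, (H t ht).2⟩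

theorem hasResolvingEnds_nat {f : ℕ → Letter J} : (nat f).HasResolvingEnds ↔
    ∃ N, ∀ t ≥ N, (f t).isInv = true ∧ (f t).path.length = 1 := by
  rw [← eventuallyUp_right_iff (C := nat f) fun t => by
    rw [letterAt, if_pos (by omega), add_sub_cancel_right, Int.toNat_natCast]]
  exact ⟨fun h => h.right, fun h => ⟨h, eventuallyUp_nat_left f⟩⟩

theorem hasResolvingEnds_neg {f : ℕ → Letter J} : (neg f).HasResolvingEnds ↔
    ∃ N, ∀ t ≥ N, (f t).isInv = false ∧ (f t).path.length = 1 := by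
  rw [← eventuallyUp_left_iff (C := neg f) fun t => by
    rw [letterAt, if_pos (by omega), neg_neg, Int.toNat_natCast]]
  exact ⟨fun h => h.left, fun h => ⟨eventuallyUp_neg_right f, h⟩⟩

theorem hasResolvingEnds_int {f : ℤ → Letter J} : (int f).HasResolvingEnds ↔
    (∃ N, ∀ i ≥ N, (f i).isInv = true ∧ (f i).path.length = 1) ∧
    ∃ N, ∀ i ≤ N, (f i).isInv = false ∧ (f i).path.length = 1 := by
  have h1 := eventuallyUp_right_iff (C := int f) (f := fun t => f (t + 1)) fun t => rfl
  have h2 := eventuallyUp_left_iff (C := int f) (f := fun t => f (-t)) fun t => rfl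
  constructor
  · intro h
    obtain ⟨N, hN⟩ := h1.1 h.right
    obtain ⟨M, hM⟩ := h2.1 h.left
    refine ⟨⟨N + 1, fun i hi => ?_⟩, ⟨-M, fun i hi => ?_⟩⟩
    · have h3 := hN (i - 1).toNat (by omega)
      have h4 : ((i - 1).toNat : ℤ) + 1 = i := by omega
      rwa [h4] at h3
    · have h3 := hM (-i).toNat (by omega)
      have h4 : -((-i).toNat : ℤ) = i := by omega
      rwa [h4] at h3
  · rintro ⟨⟨N, hN⟩, M, hM⟩
    exact ⟨h1.2 ⟨N.toNat, fun t ht => hN _ (by omega)⟩,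
      h2.2 ⟨(-M).toNat, fun t ht => hM _ (by omega)⟩⟩

theorem HasResolvingEnds.finite_setOf (h : C.HasResolvingEnds) (n : ℤ) :
    {i : ℤ | C.mu i = n ∧ ∃ v, C.vertexAt i = some v}.Finite := by
  have h1 := (h.right.finite_setOf n).image fun t : ℕ => (t : ℤ)
  have h2 := (h.left.finite_setOf n).image fun t : ℕ => -(t : ℤ)
  refine (h1.union h2).subset fun i hi => ?_
  obtain ⟨t, rfl | rfl⟩ := i.eq_nat_or_neg
  · exact Or.inl ⟨t, hi, rfl⟩
  · exact Or.inr ⟨t, hi, rfl⟩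

theorem HasResolvingEnds.exists_le_mu (h : C.HasResolvingEnds) :
    ∃ b, ∀ i v, C.vertexAt i = some v → b ≤ C.mu i := by
  obtain ⟨b, hb⟩ := h.right.exists_le_mu
  obtain ⟨b', hb'⟩ := h.left.exists_le_mu
  refine ⟨min b b', fun i v hv => ?_⟩
  obtain ⟨t, rfl | rfl⟩ := i.eq_nat_or_neg
  · exact (min_le_left _ _).trans (hb t v hv)
  · exact (min_le_right _ _).trans (hb' t v hv)

end PreWord

theorem Letter.cls_eq_of_length {l : Letter J} (h : l.path.length = 1) :
    l.cls = pathClass J (QPath.ofArrow l.path.last) := by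
  rw [cls, NPath.eq_ofArrow h]
  rfl

namespace IsGentle

variable (hJ : IsGentle J) {C : Word J}
include hJ

/-- In the interior of a sequence of arrows which raise the degree, `P(C)` is exact. -/
theorem exists_diff_eq_single {g h i j m n : ℤ} {l₀ l₁ l₂ l₃ : Letter J} (h0 : C.pre.Step g h l₀)
    (h1 : C.pre.Step h i l₁) (hl₁ : l₁.path.length = 1) (h2 : C.pre.Step i j l₂)
    (hl₂ : l₂.path.length = 1) (h3 : C.pre.Step j m l₃) {f : ℤ →₀ Lam J} (hf : f ∈ C.pre.comp n)
    (hdf : C.pre.diff f = 0) : ∃ x ∈ C.pre.comp (n - 1), C.pre.diff x = Finsupp.single i (f i) := by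
  rcases PreWord.eq_zero_or_of_mem_stalk (hf i) with h4 | ⟨hn, v, hv, hfv⟩
  · exact ⟨0, zero_mem _, by rw [h4, map_zero, Finsupp.single_zero]⟩
  obtain rfl : v = l₂.path.head :=
    Option.some_injective _ (hv.symm.trans (h2.vertexAt_left C.isWord))
  -- As `j` has an outgoing step, `i` is the only source of steps into it, so the `j`-th coefficient
  -- of the zero element `d f` involves `f i` alone.
  have h5 : f i * l₂.cls = 0 := by
    rw [← h2.diff_apply (fun _ _ => h2.unique_in h3), hdf]
    rfl
  have h6 := h1.mul_mem C.isWord h2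
  rw [Letter.cls_eq_of_length hl₂] at h5
  have h7 : l₁.path.first.tail = l₂.path.last.head := l₁.path.tail_first.trans h6.1
  obtain ⟨z, hz⟩ := hJ.exists_eq_mul_of_mul_eq_zero h7 h6.2 hfv h5
  rw [NPath.first_eq_last hl₁, ← Letter.cls_eq_of_length hl₁] at hz
  -- The factor `z` need not lie in the summand at `h`. The idempotent puts it there without
  -- changing its product with the arrow.
  refine ⟨Finsupp.single h (z * idem J l₁.path.head), PreWord.single_mem_comp
    (PreWord.mem_stalk ?_ (h1.vertexAt_left C.isWord) ?_), ?_⟩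
  · have := h1.mu_eq
    omega
  · rw [mul_assoc, idem_mul_idem]
  · have h8 : idem J l₁.path.head * l₁.cls = l₁.cls := idem_mul_pathClass l₁.path.toQPath
    -- The step into `h` guarantees that the differential at `h` has no second term.
    rw [h1.diff_single fun _ _ => h0.unique_out h1, mul_assoc, h8, ← hz]

/-- In high degrees each single component of a cycle is already a boundary, because it sits in the
interior of a ray. The finitely many primitives are then added up. -/
theorem exists_forall_exactIn (hC : C.pre.HasResolvingEnds) :
    ∃ b, ∀ n, b < n → C.ExactIn n := by
  obtain ⟨b, hb⟩ := hC.right.exists_steps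
  obtain ⟨b', hb'⟩ := hC.left.exists_steps
  refine ⟨max b b', fun n hn f hf hdf => ?_⟩
  have key : ∀ i, ∃ x ∈ C.pre.comp (n - 1), C.pre.diff x = Finsupp.single i (f i) := by
    intro i
    rcases PreWord.eq_zero_or_of_mem_stalk (hf i) with h4 | ⟨hn', v, hv, -⟩
    · exact ⟨0, zero_mem _, by rw [h4, map_zero, Finsupp.single_zero]⟩
    have main : ∀ (g : ℕ → ℤ) (t : ℕ), i = g t → (∃ s, t = s + 2 ∧
        ∀ r ≥ s, ∃ l, C.pre.Step (g r) (g (r + 1)) l ∧ l.path.length = 1) →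
        ∃ x ∈ C.pre.comp (n - 1), C.pre.diff x = Finsupp.single i (f i) := by
      rintro g t hi ⟨s, rfl, H⟩
      obtain ⟨l₀, h0, -⟩ := H s le_rfl
      obtain ⟨l₁, h1, hl₁⟩ := H (s + 1) (by omega)
      obtain ⟨l₂, h2, hl₂⟩ := H (s + 2) (by omega)
      obtain ⟨l₃, h3, -⟩ := H (s + 3) (by omega)
      rw [hi]
      exact hJ.exists_diff_eq_single h0 h1 hl₁ h2 hl₂ h3 hf hdf
    obtain ⟨t, hi | hi⟩ := i.eq_nat_or_neg
    · exact main (fun t => t) t hi (hb t v (hi ▸ hv) (by rw [← hi]; omega))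
    · exact main (fun t => -t) t hi (hb' t v (hi ▸ hv) (by rw [← hi]; omega))
  choose x hx hx' using key
  refine ⟨∑ i ∈ f.support, x i, sum_mem fun i _ => hx i, ?_⟩
  rw [map_sum, Finset.sum_congr rfl fun i _ => hx' i]
  exact Finsupp.sum_single f

theorem isPlusB_stringComplex (hC : C.pre.HasResolvingEnds) : IsPlusB C.stringComplex where
  projective n := inferInstanceAs (Module.Projective (Lam J) (C.pre.comp n))
  finite n := PreWord.finite_comp (hC.finite_setOf n)
  leftBounded := by
    obtain ⟨b, hb⟩ := hC.exists_le_mu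
    exact ⟨b, fun n hn => PreWord.subsingleton_comp fun i v hv => (hn.trans_le (hb i v hv)).ne'⟩
  boundedCohomology := by
    obtain ⟨b, hb⟩ := hC.exists_le_mu
    obtain ⟨b', hb'⟩ := hJ.exists_forall_exactIn hC
    -- Outside this interval `n + 1` is either below every degree that occurs, where the component
    -- is zero, or in the range of exactness. The extra `1` accounts for exactness being stated at
    -- the target `n + 1`.
    refine ⟨max |b| |b'| + 1, fun n hn => ?_⟩
    have hd : ∀ (n : ℤ) (x : C.pre.comp n),
        (C.stringComplex.d n (n + 1)).hom x = C.dHom rfl x :=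
      fun n x => C.stringComplex_d_apply rfl x
    have hn' : n + 1 < b ∨ b' < n + 1 := by
      rw [Set.mem_Icc] at hn
      have h1 := neg_abs_le b
      have h2 := le_abs_self b'
      have h3 := le_max_left |b| |b'|
      have h4 := le_max_right |b| |b'|
      omega
    refine le_antisymm ?_ ?_
    · rintro _ ⟨x, rfl⟩
      exact (congrArg _ (hd n x)).trans ((hd (n + 1) _).trans
        (LinearMap.congr_fun (C.dHom_dHom rfl rfl) x))
    · intro f hf
      have hf' : C.pre.diff (f : C.pre.comp (n + 1)).1 = 0 :=
        congrArg Subtype.val ((hd (n + 1) f).symm.trans hf)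
      rcases hn' with hn' | hn'
      · have : Subsingleton (C.pre.comp (n + 1)) :=
          PreWord.subsingleton_comp fun i v hv => (hn'.trans_le (hb i v hv)).ne'
        exact ⟨0, Subsingleton.elim (α := C.pre.comp (n + 1)) _ _⟩
      · obtain ⟨x, hx, hdx⟩ := hb' _ hn' _ (f : C.pre.comp (n + 1)).2 hf'
        rw [add_sub_cancel_right] at hx
        exact ⟨(⟨x, hx⟩ : C.pre.comp n), (hd n _).trans (Subtype.ext hdx)⟩

/-- Each infinite end is an injective sequence of indices joined by steps in one direction or the
other, to which `exists_forall_step` applies. Finite ends satisfy the condition by stopping. -/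
theorem hasResolvingEnds_of_homotopyEquiv {Y : CochainComplex (ModuleCat.{u} (Lam J)) ℤ}
    (e : HomotopyEquiv C.stringComplex Y) (hY : IsPlusB Y) : C.pre.HasResolvingEnds := by
  have key : ∀ g : ℕ → ℤ, g.Injective →
      (∀ t, ∃ l, C.pre.Step (g t) (g (t + 1)) l ∨ C.pre.Step (g (t + 1)) (g t) l) →
      C.pre.EventuallyUp g := fun g hg hstep => by
    obtain ⟨N, hN⟩ := hJ.exists_forall_step (hJ.finite_setOf_mu_le e hY)
      (GentleAlgebra.exists_forall_exactIn e hY) g hg hstep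
    exact ⟨N, Or.inr hN⟩
  have hright : (∀ t : ℕ, ∃ l, C.pre.letterAt (t + 1) = some l) →
      C.pre.EventuallyUp fun t => t := fun h => key _ Nat.cast_injective fun t => by
    obtain ⟨l, hl⟩ := h t
    exact ⟨l, by push_cast; exact PreWord.step_or_step hl⟩
  have hleft : (∀ t : ℕ, ∃ l, C.pre.letterAt (-t) = some l) →
      C.pre.EventuallyUp fun t => -t := fun h => key _
        (neg_injective.comp Nat.cast_injective) fun t => by
    obtain ⟨l, hl⟩ := h t
    have h1 : -(t : ℤ) = -((t + 1 : ℕ) : ℤ) + 1 := by push_cast; ring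
    rw [h1] at hl
    rw [h1]
    exact ⟨l, (PreWord.step_or_step hl).symm⟩
  clear key
  rcases hC : C.pre with ⟨v, δ⟩ | L | f | f | f <;> rw [hC] at hright hleft
  · exact PreWord.hasResolvingEnds_triv v δ
  · exact PreWord.hasResolvingEnds_fin L
  · exact ⟨hright fun t => ⟨_, if_pos (by omega)⟩, PreWord.eventuallyUp_nat_left f⟩
  · exact ⟨PreWord.eventuallyUp_neg_right f, hleft fun t => ⟨_, if_pos (by omega)⟩⟩
  · exact ⟨hright fun t => ⟨_, rfl⟩, hleft fun t => ⟨_, rfl⟩⟩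

end IsGentle

end Ends

/-! ### Words with resolving ends are finite words extended by arrow rays -/

section Words

variable {k : Type u} [Field k] {Q : Type u} [Quiver.{u} Q] [Fintype Q]
  {J : TwoSidedIdeal (PathAlgebra k Q)}

namespace PreWord

variable {B C : PreWord J}

/-- No composability is needed: the condition only concerns letters far from the junction, and where
`concat` is not meaningful its default value is the factor `B`. -/
theorem HasResolvingEnds.concat (hB : B.HasResolvingEnds) (hC : C.HasResolvingEnds) :
    (B.concat C).HasResolvingEnds := by
  cases B with
  | triv v δ => exact hC
  | nat f => cases C <;> exact hB
  | int f => cases C <;> exact hB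
  | fin L =>
    cases C with
    | nat f =>
      obtain ⟨N, hN⟩ := hasResolvingEnds_nat.1 hC
      refine hasResolvingEnds_nat.2 ⟨N + L.length, fun t ht => ?_⟩
      rw [dif_neg (by omega)]
      exact hN _ (by omega)
    | fin M => exact hasResolvingEnds_fin _
    | _ => exact hB
  | neg f =>
    cases C with
    | fin L =>
      obtain ⟨N, hN⟩ := hasResolvingEnds_neg.1 hB
      refine hasResolvingEnds_neg.2 ⟨N + L.length, fun t ht => ?_⟩
      rw [dif_neg (by omega)]
      exact hN _ (by omega)
    | nat g =>
      obtain ⟨N, hN⟩ := hasResolvingEnds_neg.1 hB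
      obtain ⟨M, hM⟩ := hasResolvingEnds_nat.1 hC
      refine hasResolvingEnds_int.2 ⟨⟨M + 1, fun i hi => ?_⟩, ⟨-N, fun i hi => ?_⟩⟩
      · rw [if_neg (by omega)]
        exact hM _ (by omega)
      · rw [if_pos (by omega)]
        exact hN _ (by omega)
    | _ => exact hB

theorem HasResolvingEnds.shift (hC : C.HasResolvingEnds) (t : ℤ) :
    (C.shift t).HasResolvingEnds := by
  cases C with
  | int f =>
    obtain ⟨⟨N, hN⟩, M, hM⟩ := hasResolvingEnds_int.1 hC
    exact hasResolvingEnds_int.2 ⟨⟨N - t, fun i hi => hN _ (by omega)⟩,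
      ⟨M - t, fun i hi => hM _ (by omega)⟩⟩
  | _ => exact hC

end PreWord

namespace Word

variable {C : Word J} {s : SignChoice J}

theorem ext_pre {A B : Word J} (h : A.pre = B.pre) : A = B := by
  cases A
  cases B
  cases h
  rfl

/-- All multiples of a period have the same degree, whereas resolving ends allow only finitely many
indices in each degree. -/
theorem IsPeriodic.not_hasResolvingEnds (hC : C.IsPeriodic) : ¬ C.pre.HasResolvingEnds := by
  intro h
  obtain ⟨p, hp, hC⟩ := hC
  refine Set.infinite_of_injective_forall_mem (f := fun n : ℤ => n * p) ?_ ?_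
    (h.finite_setOf (C.pre.mu 0))
  · exact mul_left_injective₀ (by exact_mod_cast hp.ne')
  · intro n
    have h1 := (hC.isSymm n).mu 0
    rw [zero_add] at h1
    obtain ⟨f, hf⟩ := hC.1
    exact ⟨h1, _, PreWord.vertexAt_of_letterAt (l := f (n * p)) (by rw [hf]; rfl)⟩

theorem hasResolvingEnds_of_mem_swSet {B : PreWord J} (hB : B ∈ C.swSet s) :
    B.HasResolvingEnds := by
  obtain ⟨⟨L, -, rfl⟩ | ⟨f, rfl⟩, hB, -⟩ := hB
  · exact PreWord.hasResolvingEnds_fin L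
  · refine PreWord.hasResolvingEnds_neg.2 ⟨0, fun t _ => hB (-t) (f t) ?_⟩
    rw [PreWord.letterAt, if_pos (by omega), neg_neg, Int.toNat_natCast]

theorem hasResolvingEnds_of_mem_seSet {D : PreWord J} (hD : D ∈ C.seSet s) :
    D.HasResolvingEnds := by
  obtain ⟨⟨L, -, rfl⟩ | ⟨f, rfl⟩, hD, -⟩ := hD
  · exact PreWord.hasResolvingEnds_fin L
  · refine PreWord.hasResolvingEnds_nat.2 ⟨0, fun t _ => hD (t + 1) (f t) ?_⟩
    rw [PreWord.letterAt, if_pos (by omega), add_sub_cancel_right, Int.toNat_natCast]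

theorem IsFinite.hasResolvingEnds (hC : C.IsFinite) : C.pre.HasResolvingEnds := by
  rcases hC with ⟨v, δ, h⟩ | ⟨L, h⟩ <;> rw [h]
  · exact PreWord.hasResolvingEnds_triv v δ
  · exact PreWord.hasResolvingEnds_fin L

/-- It does not matter which longest sequence is chosen: every admissible one consists of arrows of
the right orientation, and if there is none the word is unchanged. -/
theorem hasResolvingEnds_sw (hC : C.pre.HasResolvingEnds) (s : SignChoice J) :
    (C.sw s).pre.HasResolvingEnds := by
  unfold sw
  split_ifs with h
  · exact (hasResolvingEnds_of_mem_swSet h.choose_spec.1).concat hC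
  · exact hC

theorem hasResolvingEnds_se (hC : C.pre.HasResolvingEnds) (s : SignChoice J) :
    (C.se s).pre.HasResolvingEnds := by
  unfold se
  split_ifs with h
  · exact hC.concat (hasResolvingEnds_of_mem_seSet h.choose_spec.1)
  · exact hC

theorem hasResolvingEnds_swse (hC : C.pre.HasResolvingEnds) (s : SignChoice J) :
    (C.swse s).pre.HasResolvingEnds := by
  unfold swse
  split_ifs with h
  · exact (hasResolvingEnds_of_mem_swSet h.choose_spec.1).concat (hasResolvingEnds_se hC s)
  · exact hasResolvingEnds_se hC s

end Word

theorem eq_of_encard_le_two {α : Type*} {S : Set α} (hS : S.encard ≤ 2) {x a b : α}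
    (hx : x ∈ S) (ha : a ∈ S) (hb : b ∈ S) (hxa : x ≠ a) (hxb : x ≠ b) : a = b := by
  by_contra hab
  have h1 : ({x, a, b} : Set α) ⊆ S := by
    rintro y (rfl | rfl | rfl) <;> assumption
  have h2 := (Set.encard_le_encard h1).trans hS
  rw [Set.encard_insert_of_notMem (by simp [hxa, hxb]), Set.encard_pair hab] at h2
  exact absurd h2 (by decide)

theorem Letter.ext_of_last {a b : Letter J} (h : a.isInv = b.isInv) (ha : a.path.length = 1)
    (hb : b.path.length = 1) (hl : a.path.last = b.path.last) : a = b := by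
  have h1 := NPath.ext_of_length ha hb hl
  cases a
  cases b
  cases h
  cases h1
  rfl

namespace IsGentle

variable (hJ : IsGentle J)
include hJ

/-- If `l` is direct, the new arrow ends where the path of `l` ends and differs from its last arrow,
and at most two arrows end there. If `l` is inverse, the new arrow is the unique one forming a
relation with the first arrow of `l`. -/
theorem eq_of_adj_right {l a b : Letter J} (ha : l.Adj a) (hb : l.Adj b)
    (ha' : a.isInv = true ∧ a.path.length = 1) (hb' : b.isInv = true ∧ b.path.length = 1) :
    a = b := by
  refine Letter.ext_of_last (ha'.1.trans hb'.1.symm) ha'.2 hb'.2 ?_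
  cases hl : l.isInv <;> simp only [Letter.Adj, hl, ha'.1, hb'.1] at ha hb
  · exact eq_of_encard_le_two (hJ.card_in_le l.path.head) rfl ha.1.symm hb.1.symm ha.2 hb.2
  · refine Set.encard_le_one_iff.1 (hJ.card_right_mem_le l.path.first) _ _ ⟨?_, ha.2⟩ ⟨?_, hb.2⟩
    · exact ha.1.symm.trans l.path.tail_first.symm
    · exact hb.1.symm.trans l.path.tail_first.symm

theorem eq_of_adj_left {l a b : Letter J} (ha : a.Adj l) (hb : b.Adj l)
    (ha' : a.isInv = false ∧ a.path.length = 1) (hb' : b.isInv = false ∧ b.path.length = 1) :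
    a = b := by
  refine Letter.ext_of_last (ha'.1.trans hb'.1.symm) ha'.2 hb'.2 ?_
  cases hl : l.isInv <;> simp only [Letter.Adj, hl, ha'.1, hb'.1] at ha hb
  · refine Set.encard_le_one_iff.1 (hJ.card_right_mem_le l.path.first) _ _ ⟨?_, ha.2⟩ ⟨?_, hb.2⟩
    · exact ha.1.trans l.path.tail_first.symm
    · exact hb.1.trans l.path.tail_first.symm
  · exact eq_of_encard_le_two (hJ.card_in_le l.path.head) rfl ha.1 hb.1 ha.2.symm hb.2.symm

end IsGentle

theorem PreWord.adj_of_isWord_fin_concat_nat {L : List (Letter J)} (hL : L ≠ []) {g : ℕ → Letter J}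
    (h : ((fin L).concat (nat g)).IsWord) :
    (L.getLast hL).Adj (g 0) ∧ ∀ j, (g j).Adj (g (j + 1)) := by
  have hL' := List.length_pos_iff.2 hL
  constructor
  · have h1 := h (L.length - 1)
    have h3 : ¬ L.length - 1 + 1 < L.length := by omega
    have h4 : L.length - 1 + 1 - L.length = 0 := by omega
    simp only [Nat.sub_one_lt_of_lt hL', h3, dite_true, dite_false, h4] at h1
    rwa [List.getLast_eq_getElem]
  · intro j
    have h1 := h (L.length + j)
    have h2 : ¬ L.length + j < L.length := by omega
    have h3 : ¬ L.length + j + 1 < L.length := by omega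
    have h4 : L.length + j - L.length = j := by omega
    have h5 : L.length + j + 1 - L.length = j + 1 := by omega
    simpa only [h2, h3, dite_false, h4, h5] using h1

namespace Word

variable {C : Word J} {s : SignChoice J} {L : List (Letter J)}

theorem eq_of_mem_seSet (hJ : IsGentle J) (hC : C.pre = .fin L) {g g' : ℕ → Letter J}
    (hg : .nat g ∈ C.seSet s) (hg' : .nat g' ∈ C.seSet s) : g = g' := by
  have hL : L ≠ [] := by
    have := C.isWord
    rw [hC] at this
    exact this.1
  have key : ∀ g : ℕ → Letter J, .nat g ∈ C.seSet s → ((L.getLast hL).Adj (g 0) ∧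
      ∀ j, (g j).Adj (g (j + 1))) ∧ ∀ j, (g j).isInv = true ∧ (g j).path.length = 1 := by
    rintro g ⟨-, h1, h2⟩
    refine ⟨PreWord.adj_of_isWord_fin_concat_nat hL (hC ▸ h2.isWord), fun j => h1 (j + 1) _ ?_⟩
    rw [PreWord.letterAt, if_pos (by omega), add_sub_cancel_right, Int.toNat_natCast]
  obtain ⟨⟨h1, h2⟩, h3⟩ := key g hg
  obtain ⟨⟨h1', h2'⟩, h3'⟩ := key g' hg'
  funext j
  induction j with
  | zero => exact hJ.eq_of_adj_right h1 h1' (h3 0) (h3' 0)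
  | succ j ih => exact hJ.eq_of_adj_right (h2 j) (ih ▸ h2' j) (h3 _) (h3' _)

theorem eq_of_mem_swSet (hJ : IsGentle J) (hC : C.pre = .fin L) {g g' : ℕ → Letter J}
    (hg : .neg g ∈ C.swSet s) (hg' : .neg g' ∈ C.swSet s) : g = g' := by
  have hL : L ≠ [] := by
    have := C.isWord
    rw [hC] at this
    exact this.1
  have key : ∀ g : ℕ → Letter J, .neg g ∈ C.swSet s → ((g 0).Adj (L.head hL) ∧
      ∀ j, (g (j + 1)).Adj (g j)) ∧ ∀ j, (g j).isInv = false ∧ (g j).path.length = 1 := by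
    rintro g ⟨-, h1, h2⟩
    obtain ⟨h3, h4⟩ := PreWord.isWord_of_concat_fin hL (Or.inr ⟨g, rfl⟩) (hC ▸ h2.isWord)
    refine ⟨⟨h4 _ rfl _ (List.head_mem_head? hL), h3⟩, fun j => h1 (-j) _ ?_⟩
    rw [PreWord.letterAt, if_pos (by omega), neg_neg, Int.toNat_natCast]
  obtain ⟨⟨h1, h2⟩, h3⟩ := key g hg
  obtain ⟨⟨h1', h2'⟩, h3'⟩ := key g' hg'
  funext j
  induction j with
  | zero => exact hJ.eq_of_adj_left h1 h1' (h3 0) (h3' 0)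
  | succ j ih => exact hJ.eq_of_adj_left (h2 j) (ih ▸ h2' j) (h3 _) (h3' _)

/-- Infinite length beats every finite sequence, and the letters of an infinite sequence are forced
one after the other. This pins down the arbitrary choice in the definition of `se`. -/
theorem isLongest_seSet (hJ : IsGentle J) (hC : C.pre = .fin L) {g : ℕ → Letter J}
    (hg : .nat g ∈ C.seSet s) {D : PreWord J} : IsLongest (C.seSet s) D ↔ D = .nat g := by
  constructor
  · rintro ⟨h1, h2⟩
    obtain ⟨M, -, rfl⟩ | ⟨f, rfl⟩ := h1.1
    · exact absurd (h2 _ hg) (by simp [PreWord.length])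
    · rw [eq_of_mem_seSet hJ hC h1 hg]
  · rintro rfl
    exact ⟨hg, fun _ _ => le_top⟩

theorem isLongest_swSet (hJ : IsGentle J) (hC : C.pre = .fin L) {g : ℕ → Letter J}
    (hg : .neg g ∈ C.swSet s) {B : PreWord J} : IsLongest (C.swSet s) B ↔ B = .neg g := by
  constructor
  · rintro ⟨h1, h2⟩
    obtain ⟨M, -, rfl⟩ | ⟨f, rfl⟩ := h1.1
    · exact absurd (h2 _ hg) (by simp [PreWord.length])
    · rw [eq_of_mem_swSet hJ hC h1 hg]
  · rintro rfl
    exact ⟨hg, fun _ _ => le_top⟩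

theorem pre_se (hJ : IsGentle J) (hC : C.pre = .fin L) {g : ℕ → Letter J}
    (hg : .nat g ∈ C.seSet s) : (C.se s).pre = (PreWord.fin L).concat (.nat g) := by
  have h : ∃ D, IsLongest (C.seSet s) D := ⟨_, (isLongest_seSet hJ hC hg).2 rfl⟩
  rw [se, dif_pos h]
  change C.pre.concat h.choose = _
  rw [(isLongest_seSet hJ hC hg).1 h.choose_spec, hC]

theorem pre_sw (hJ : IsGentle J) (hC : C.pre = .fin L) {g : ℕ → Letter J}
    (hg : .neg g ∈ C.swSet s) : (C.sw s).pre = (PreWord.neg g).concat (.fin L) := by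
  have h : ∃ D, IsLongest (C.swSet s) D := ⟨_, (isLongest_swSet hJ hC hg).2 rfl⟩
  rw [sw, dif_pos h]
  change h.choose.concat C.pre = _
  rw [(isLongest_swSet hJ hC hg).1 h.choose_spec, hC]

theorem pre_swse (hJ : IsGentle J) (hC : C.pre = .fin L) {g g' : ℕ → Letter J}
    (hg : .neg g ∈ C.swSet s) (hg' : .nat g' ∈ C.seSet s) :
    (C.swse s).pre = (PreWord.neg g).concat ((PreWord.fin L).concat (.nat g')) := by
  have h : ∃ D, IsLongest (C.swSet s) D := ⟨_, (isLongest_swSet hJ hC hg).2 rfl⟩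
  rw [swse, dif_pos h]
  change h.choose.concat (C.se s).pre = _
  rw [(isLongest_swSet hJ hC hg).1 h.choose_spec, pre_se hJ hC hg']

/-- The sign conditions for composability concern trivial words only, so they are vacuous here. -/
theorem nat_mem_seSet (hC : C.pre = .fin L) {g : ℕ → Letter J}
    (h : ((PreWord.fin L).concat (.nat g)).IsWord)
    (hg : ∀ j, (g j).isInv = true ∧ (g j).path.length = 1) : .nat g ∈ C.seSet s := by
  refine ⟨Or.inr ⟨g, rfl⟩, fun i l hl => ?_, by rwa [hC], nofun, by rw [hC]; exact nofun⟩
  rw [PreWord.letterAt] at hl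
  split_ifs at hl
  exact Option.some_injective _ hl ▸ hg _

theorem neg_mem_swSet (hC : C.pre = .fin L) {g : ℕ → Letter J}
    (h : ((PreWord.neg g).concat (.fin L)).IsWord)
    (hg : ∀ j, (g j).isInv = false ∧ (g j).path.length = 1) : .neg g ∈ C.swSet s := by
  refine ⟨Or.inr ⟨g, rfl⟩, fun i l hl => ?_, by rwa [hC], by rw [hC]; exact nofun, nofun⟩
  rw [PreWord.letterAt] at hl
  split_ifs at hl
  exact Option.some_injective _ hl ▸ hg _

/-- A word with resolving ends arises from a finite word by adding arrows at the ends. -/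
theorem exists_eq_of_hasResolvingEnds (hJ : IsGentle J) (s : SignChoice J) {A : Word J}
    (hA : A.pre.HasResolvingEnds) : ∃ C : Word J, C.IsFinite ∧ ∃ t : ℤ,
      A = C.shift t ∨ A = (C.sw s).shift t ∨ A = (C.se s).shift t ∨ A = (C.swse s).shift t := by
  obtain ⟨A, hw⟩ := A
  have hword : ∀ {N : ℕ} (f : ℕ → Letter J), (∀ j < N, (f j).Adj (f (j + 1))) →
      (PreWord.fin ((List.range (N + 1)).map f)).IsWord := by
    intro N f hf
    refine ⟨by simp, List.isChain_iff_getElem.2 fun i hi => ?_⟩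
    simp only [List.length_map, List.length_range] at hi
    simpa using hf i (by omega)
  cases A with
  | triv v δ => exact ⟨⟨_, hw⟩, Or.inl ⟨v, δ, rfl⟩, 0, Or.inl rfl⟩
  | fin L => exact ⟨⟨_, hw⟩, Or.inr ⟨L, rfl⟩, 0, Or.inl rfl⟩
  | nat f =>
    obtain ⟨N, hN⟩ := PreWord.hasResolvingEnds_nat.1 hA
    -- The finite part has `N + 1` letters rather than `N` because an empty list is not a word.
    let C : Word J := ⟨_, hword (N := N) f fun j _ => hw j⟩
    have h1 : (PreWord.fin ((List.range (N + 1)).map f)).concat (.nat fun j => f (N + 1 + j)) =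
        .nat f := by
      refine congrArg PreWord.nat (funext fun j => ?_)
      simp only [List.length_map, List.length_range, List.getElem_map, List.getElem_range]
      split_ifs with h
      · rfl
      · congr 1
        omega
    have h2 : .nat (fun j => f (N + 1 + j)) ∈ C.seSet s :=
      nat_mem_seSet rfl (by rw [h1]; exact hw) fun j => hN _ (by omega)
    refine ⟨C, Or.inr ⟨_, rfl⟩, 0, Or.inr (Or.inr (Or.inl (ext_pre ?_)))⟩
    change _ = (C.se s).pre.shift 0
    rw [pre_se hJ rfl h2, h1]
    rfl
  | neg f =>
    obtain ⟨N, hN⟩ := PreWord.hasResolvingEnds_neg.1 hA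
    -- A left-infinite word is indexed from its right end, so the finite part lists its letters in
    -- reverse.
    let C : Word J := ⟨_, hword (N := N) (fun j => f (N - j)) fun j hj => by
      have h1 : N - j = N - (j + 1) + 1 := by omega
      rw [h1]
      exact hw _⟩
    have h1 : (PreWord.neg fun j => f (N + 1 + j)).concat
        (.fin ((List.range (N + 1)).map fun j => f (N - j))) = .neg f := by
      refine congrArg PreWord.neg (funext fun j => ?_)
      simp only [List.length_map, List.length_range, List.getElem_map, List.getElem_range]
      split_ifs with h <;> congr 1 <;> omega
    have h2 : .neg (fun j => f (N + 1 + j)) ∈ C.swSet s :=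
      neg_mem_swSet rfl (by rw [h1]; exact hw) fun j => hN _ (by omega)
    refine ⟨C, Or.inr ⟨_, rfl⟩, 0, Or.inr (Or.inl (ext_pre ?_))⟩
    change _ = (C.sw s).pre.shift 0
    rw [pre_sw hJ rfl h2, h1]
    rfl
  | int f =>
    obtain ⟨⟨N, hN⟩, M, hM⟩ := PreWord.hasResolvingEnds_int.1 hA
    have hw' : ∀ {i j : ℤ}, j = i + 1 → (f i).Adj (f j) := fun {i j} h => h ▸ hw i
    -- The finite part occupies the indices from `M + 1` to `M + 1 + m`. It is non-empty even if the
    -- two rays overlap, and everything to the right of it belongs to the right ray.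
    obtain ⟨m, hm⟩ : ∃ m : ℕ, N ≤ M + 1 + m := ⟨(N - M).toNat, by omega⟩
    let C : Word J := ⟨_, hword (N := m) (fun j : ℕ => f (M + 1 + j)) fun j _ =>
      hw' (by push_cast; ring)⟩
    have h1 : (PreWord.fin ((List.range (m + 1)).map fun j : ℕ => f (M + 1 + j))).concat
        (.nat fun j => f (M + 1 + (m + 1) + j)) = .nat fun j => f (M + 1 + j) := by
      refine congrArg PreWord.nat (funext fun j => ?_)
      simp only [List.length_map, List.length_range, List.getElem_map, List.getElem_range]
      split_ifs with h
      · rfl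
      · congr 1
        omega
    have h2 : (PreWord.neg fun j => f (M - j)).concat
        (.fin ((List.range (m + 1)).map fun j : ℕ => f (M + 1 + j))) =
        .neg fun j => f (M + 1 + m - j) := by
      refine congrArg PreWord.neg (funext fun j => ?_)
      simp only [List.length_map, List.length_range, List.getElem_map, List.getElem_range]
      split_ifs with h <;> congr 1 <;> omega
    have h3 : .nat (fun j => f (M + 1 + (m + 1) + j)) ∈ C.seSet s :=
      nat_mem_seSet rfl (by rw [h1]; exact fun j => hw' (by push_cast; ring))
        fun j => hN _ (by omega)
    have h4 : .neg (fun j => f (M - j)) ∈ C.swSet s :=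
      neg_mem_swSet rfl (by rw [h2]; exact fun j => hw' (by push_cast; ring))
        fun j => hM _ (by omega)
    -- Concatenation puts the last letter of the left ray at index `0`, whereas in the given word it
    -- has index `M`.
    refine ⟨C, Or.inr ⟨_, rfl⟩, -M, Or.inr (Or.inr (Or.inr (ext_pre ?_)))⟩
    change _ = (C.swse s).pre.shift (-M)
    rw [pre_swse hJ rfl h4 h3, h1]
    refine congrArg PreWord.int (funext fun i => ?_)
    beta_reduce
    split_ifs with h <;> congr 1 <;> omega

end Word

end Words

/-! ### Stability of `K^{+,b}` under shifts -/

section Shift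

variable {Λ : Type u} [Ring Λ]

/-- Used to discard the sign that shifting a complex puts on its differentials. -/
theorem range_units_smul {A B : ModuleCat.{u} Λ} (r : ℤˣ) (f : A ⟶ B) :
    LinearMap.range (r • f).hom = LinearMap.range f.hom := by
  rcases Int.units_eq_one_or r with rfl | rfl
  · rw [one_smul]
  · rw [Units.neg_smul, one_smul, ModuleCat.hom_neg, LinearMap.range_neg]

theorem ker_units_smul {A B : ModuleCat.{u} Λ} (r : ℤˣ) (f : A ⟶ B) :
    LinearMap.ker (r • f).hom = LinearMap.ker f.hom := by
  rcases Int.units_eq_one_or r with rfl | rfl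
  · rw [one_smul]
  · ext x
    rw [Units.neg_smul, one_smul, ModuleCat.hom_neg, LinearMap.mem_ker, LinearMap.mem_ker,
      LinearMap.neg_apply, neg_eq_zero]

theorem IsPlusB.shift {Y : CochainComplex (ModuleCat.{u} Λ) ℤ} (hY : IsPlusB Y) (n : ℤ) :
    IsPlusB (Y⟦n⟧) where
  projective i := hY.projective (i + n)
  finite i := hY.finite (i + n)
  leftBounded := by
    obtain ⟨m, hm⟩ := hY.leftBounded
    exact ⟨m - n, fun i hi => hm (i + n) (by omega)⟩
  boundedCohomology := by
    obtain ⟨h, hh⟩ := hY.boundedCohomology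
    refine ⟨h + |n|, fun i hi => ?_⟩
    have key : ∀ i j l : ℤ, i + 1 = j → j + 1 = l → i ∉ Set.Icc (-h) h →
        LinearMap.range (Y.d i j).hom = LinearMap.ker (Y.d j l).hom := by
      rintro i _ _ rfl rfl hi
      exact hh i hi
    have h1 := key (i + n) (i + 1 + n) (i + 1 + 1 + n) (by ring) (by ring) (by
      have h2 := neg_abs_le n
      have h3 := le_abs_self n
      rw [Set.mem_Icc] at hi ⊢
      omega)
    change LinearMap.range (n.negOnePow • Y.d (i + n) (i + 1 + n)).hom =
      LinearMap.ker (n.negOnePow • Y.d (i + 1 + n) (i + 1 + 1 + n)).hom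
    rw [range_units_smul, ker_units_smul, h1]

theorem InKPlusB.of_iso {X X' : HomotopyCategory (ModuleCat.{u} Λ) (ComplexShape.up ℤ)}
    (e : X ≅ X') (h : InKPlusB X) : InKPlusB X' := by
  obtain ⟨Y, hY, ⟨f⟩⟩ := h
  exact ⟨Y, hY, ⟨e.symm ≪≫ f⟩⟩

theorem InKPlusB.shift {X : HomotopyCategory (ModuleCat.{u} Λ) (ComplexShape.up ℤ)}
    (h : InKPlusB X) (n : ℤ) : InKPlusB (X⟦n⟧) := by
  obtain ⟨Y, hY, ⟨f⟩⟩ := h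
  exact ⟨Y⟦n⟧, hY.shift n, ⟨(shiftFunctor _ n).mapIso f ≪≫
    (((HomotopyCategory.quotient _ _).commShiftIso n).app Y).symm⟩⟩

theorem inKPlusB_shift_iff {X : HomotopyCategory (ModuleCat.{u} Λ) (ComplexShape.up ℤ)} (n : ℤ) :
    InKPlusB (X⟦n⟧) ↔ InKPlusB X :=
  ⟨fun h => (h.shift (-n)).of_iso (shiftShiftNeg X n), fun h => h.shift n⟩

end Shift

/-! ### Band complexes: the action of `T` and homomorphisms out of `Pⁿ(C) ⊗ V` -/

section Bands

variable {k : Type u} [Field k] {Q : Type u} [Quiver.{u} Q] [Fintype Q]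
  {J : TwoSidedIdeal (PathAlgebra k Q)}

namespace Word

variable {C : Word J} (hC : C.IsPeriodic) {n : ℤ}

theorem IsPeriodic.period_pos (hC : C.IsPeriodic) : 0 < C.period :=
  (Nat.sInf_mem (s := {p : ℕ | 0 < p ∧ C.HasPeriod p}) hC).1

theorem coe_T_smul (t : ℤ) (x : BandComp hC n) :
    ((LaurentPolynomial.T t : k[T;T⁻¹]) • x : C.pre.comp n).1 =
      PreWord.translate (t * C.period) (x : C.pre.comp n).1 := by
  rw [laurent_smul_def, LaurentPolynomial.T, laurentHom]
  have h : (AddMonoidAlgebra.lift k (Module.End (Lam J) (C.pre.comp n)) ℤ (translateHom hC n))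
      (AddMonoidAlgebra.single t 1) = (1 : k) • translateHom hC n (Multiplicative.ofAdd t) :=
    AddMonoidAlgebra.lift_single ..
  erw [h]
  rw [one_smul]
  rfl

theorem C_smul (c : k) (x : BandComp hC n) :
    (LaurentPolynomial.C c : k[T;T⁻¹]) • x = algebraMap k (Lam J) c • x := by
  have h : laurentHom hC n (LaurentPolynomial.C c) = algebraMap k _ c :=
    (laurentHom hC n).commutes c
  rw [laurent_smul_def, h]
  exact (algebraMap_smul (Lam J) c (show C.pre.comp n from x)).symm

/-- The generator `b_i` as an element of `Pⁿ(C)`, and zero if `b_i` is not of degree `n`. -/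
def bandGen (n i : ℤ) : BandComp hC n := C.pre.gen n i

theorem T_smul_bandGen (t i : ℤ) :
    (LaurentPolynomial.T t : k[T;T⁻¹]) • bandGen hC n i = bandGen hC n (i - t * C.period) := by
  unfold bandGen
  have hs := hC.hasPeriod.isSymm t
  have hi : i - t * C.period + t * C.period = i := sub_add_cancel _ _
  have hmu := hs.mu (i - t * C.period)
  have hv := hs.vertexAt (i - t * C.period)
  rw [hi] at hmu hv
  by_cases h : C.pre.mu i = n ∧ ∃ v, C.pre.vertexAt i = some v
  · obtain ⟨h1, v, h2⟩ := h
    rw [PreWord.gen_eq h1 h2, PreWord.gen_eq (hmu.symm.trans h1) (hv.symm.trans h2)]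
    exact Subtype.ext ((coe_T_smul hC t _).trans (PreWord.translate_single _ _ _))
  · rw [PreWord.gen_eq_zero h, PreWord.gen_eq_zero]
    · exact Subtype.ext ((coe_T_smul hC t _).trans (map_zero _))
    · rwa [← hmu, ← hv]

/-- The degree depends only on the index modulo the period. -/
theorem mu_bounded (hC : C.IsPeriodic) : ∃ b, ∀ i, |C.pre.mu i| ≤ b := by
  obtain ⟨b, hb⟩ := ((Set.finite_Ico (0 : ℤ) C.period).image fun i => |C.pre.mu i|).bddAbove
  refine ⟨b, fun i => ?_⟩
  have hp : (0 : ℤ) < C.period := by exact_mod_cast hC.period_pos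
  have h := (hC.hasPeriod.isSymm (i / C.period)).mu (i % C.period)
  rw [Int.emod_add_ediv_mul] at h
  rw [h]
  exact hb ⟨_, ⟨Int.emod_nonneg _ hp.ne', Int.emod_lt_of_pos _ hp⟩, rfl⟩

variable {V : Type u} [AddCommGroup V] [Module k V] [Module k[T;T⁻¹] V]
  [IsScalarTower k k[T;T⁻¹] V]

section Pairing

variable {W : Type*} [AddCommGroup W] [Module (Lam J) W] (r : ℤ) (β : V →+ W)

/-- The value of `bandPairing` at `b_i ⊗ v`. -/
def bandValue (C : Word J) (v : V) (i : ℤ) : W :=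
  if i % C.period = r then
    β ((LaurentPolynomial.T (-(i / C.period)) : k[T;T⁻¹]) • v) else 0

variable (hβ : ∀ (c : k) v, β (c • v) = algebraMap k (Lam J) c • β v)

-- This is the balancing condition for the tensor product. Multiplication by `T ^ t` moves the index
-- `i` to `i - tp`, which keeps the residue and lowers the quotient by `t`; that change is exactly
-- the factor `T ^ t` on `v`. Scalars pass through since they are central in `Λ`.
include hβ in
theorem linearCombination_smul (q : k[T;T⁻¹]) (x : BandComp hC n)
    (v : V) :
    Finsupp.linearCombination (Lam J) (bandValue r β C v) (q • x : C.pre.comp n).1 =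
      Finsupp.linearCombination (Lam J) (bandValue r β C (q • v)) (x : C.pre.comp n).1 := by
  have hp : (C.period : ℤ) ≠ 0 := by exact_mod_cast hC.period_pos.ne'
  have hadd : ∀ v w : V, bandValue r β C (v + w) = bandValue r β C v + bandValue r β C w := by
    intro v w
    ext i
    simp only [bandValue, Pi.add_apply]
    split_ifs
    · rw [smul_add, map_add]
    · rw [add_zero]
  induction q using LaurentPolynomial.induction_on' with
  | add q q' hq hq' =>
    rw [add_smul, add_smul, hadd]
    have h1 : (q • x + q' • x : C.pre.comp n).1 = (q • x : C.pre.comp n).1 +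
      (q' • x : C.pre.comp n).1 := rfl
    have h2 : ∀ (f g : ℤ → W) (y : ℤ →₀ Lam J), Finsupp.linearCombination (Lam J) (f + g) y =
        Finsupp.linearCombination (Lam J) f y + Finsupp.linearCombination (Lam J) g y := by
      intro f g y
      simp [Finsupp.linearCombination_apply, Finsupp.sum_add]
    rw [h2, ← hq, ← hq']
    exact map_add _ _ _
  | C_mul_T t c =>
    rw [mul_smul, mul_smul, C_smul]
    have h1 : (algebraMap k (Lam J) c • (LaurentPolynomial.T t : k[T;T⁻¹]) • x : C.pre.comp n).1 =
        algebraMap k (Lam J) c • PreWord.translate (t * C.period) (x : C.pre.comp n).1 :=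
      congrArg (algebraMap k (Lam J) c • ·) (coe_T_smul hC t x)
    have h2 : ∀ i, bandValue r β C ((LaurentPolynomial.C c : k[T;T⁻¹]) •
        (LaurentPolynomial.T t : k[T;T⁻¹]) • v) i =
        algebraMap k (Lam J) c • bandValue r β C v (i - t * C.period) := by
      intro i
      unfold bandValue
      rw [Int.sub_mul_emod_self_right, Int.sub_mul_ediv_right _ _ hp]
      split_ifs
      · rw [← hβ, ← algebraMap_smul k[T;T⁻¹] c (_ : V), ← mul_smul, ← mul_smul, ← mul_smul]
        congr 2
        have h3 : (algebraMap k k[T;T⁻¹]) c = LaurentPolynomial.C c := rfl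
        rw [h3, neg_sub, sub_eq_add_neg, LaurentPolynomial.T_add]
        ring
      · rw [smul_zero]
    rw [h1]
    generalize (x : C.pre.comp n).1 = y
    induction y using Finsupp.induction_linear with
    | zero => simp
    | add f g hf hg => rw [map_add, smul_add, map_add, hf, hg, map_add]
    | single i a =>
      rw [PreWord.translate_single, Finsupp.smul_single, Finsupp.linearCombination_single,
        Finsupp.linearCombination_single, h2, smul_smul, smul_eq_mul, Algebra.commutes]

/-- The `Λ`-linear map on `Pⁿ(C) ⊗ V` which sends `b_i ⊗ v`, where `i = r + tp`, to
`β (T ^ (-t) v)`, and `b_i ⊗ v` to zero for the other values of `i`. -/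
def bandPairing : BandComp hC n ⊗[k[T;T⁻¹]] V →ₗ[Lam J] W :=
  let F : BandComp hC n ⊗[k[T;T⁻¹]] V →+ W := TensorProduct.liftAddHom
    (AddMonoidHom.mk' (fun x : BandComp hC n => AddMonoidHom.mk' (fun v : V =>
      Finsupp.linearCombination (Lam J) (bandValue r β C v) (x : C.pre.comp n).1) (by
        intro v w
        rw [Finsupp.linearCombination_apply, Finsupp.linearCombination_apply,
          Finsupp.linearCombination_apply, ← Finsupp.sum_add]
        refine Finsupp.sum_congr fun i _ => ?_
        rw [← smul_add]
        congr 1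
        unfold bandValue
        split_ifs
        · rw [smul_add, map_add]
        · rw [add_zero]))
      (fun x y => by ext v; exact map_add (Finsupp.linearCombination _ _) _ _))
    (fun q x v => linearCombination_smul hC r β hβ q x v)
  { F with
    map_smul' a x := by
      change F (a • x) = a • F x
      induction x using TensorProduct.induction_on with
      | zero => simp
      | tmul x v =>
        exact map_smul (Finsupp.linearCombination (Lam J) (bandValue r β C v)) a
          (x : C.pre.comp n).1
      | add x y hx hy => rw [smul_add, map_add, map_add, smul_add, hx, hy] }

theorem bandPairing_bandGen_tmul {i : ℤ} {w : Q} (hn : C.pre.mu i = n)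
    (hw : C.pre.vertexAt i = some w) (v : V) :
    bandPairing hC r β hβ (bandGen hC n i ⊗ₜ v) =
      idem J w • bandValue r β C v i := by
  have h : bandPairing hC r β hβ (bandGen hC n i ⊗ₜ v) =
    Finsupp.linearCombination (Lam J) (bandValue r β C v) (C.pre.gen n i).1 := rfl
  rw [h, PreWord.gen_eq hn hw, Finsupp.linearCombination_single]

end Pairing

end Word

end Bands

/-! ### Band complexes and finite-dimensionality of `V` -/

section Bands

variable {k : Type u} [Field k] {Q : Type u} [Quiver.{u} Q] [Fintype Q]
  {J : TwoSidedIdeal (PathAlgebra k Q)}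

namespace Word

variable {C : Word J} (hC : C.IsPeriodic) {n m : ℤ}
  {V : Type u} [AddCommGroup V] [Module k[T;T⁻¹] V]

/-- The homomorphism `x ↦ x ⊗ v`. -/
def tmulHom (n : ℤ) (v : V) : C.pre.comp n →ₗ[Lam J] BandComp hC n ⊗[k[T;T⁻¹]] V where
  toFun x := (show BandComp hC n from x) ⊗ₜ v
  map_add' x y := TensorProduct.add_tmul (show BandComp hC n from x) (show BandComp hC n from y) v
  map_smul' _ _ := rfl

theorem bandComplex_d_apply (h : n + 1 = m) (x : BandComp hC n ⊗[k[T;T⁻¹]] V) :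
    (bandComplex hC V).d n m x = bandDiff hC V h x := by
  have h1 : (bandComplex hC V).d n m = ModuleCat.ofHom (bandDiff hC V h) := dif_pos h
  rw [h1]
  rfl

theorem map_bandDiff_eq_zero {M : Type*} [AddCommGroup M] [Module (Lam J) M]
    (hM : ∀ (l : Letter J) (y : M), l.cls • y = 0) (h : n + 1 = m)
    (φ : BandComp hC m ⊗[k[T;T⁻¹]] V →ₗ[Lam J] M) (x : BandComp hC n ⊗[k[T;T⁻¹]] V) :
    φ (bandDiff hC V h x) = 0 := by
  induction x using TensorProduct.induction_on with
  | zero => rw [map_zero, map_zero]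
  | tmul x v => exact C.map_dHom_eq_zero hM h (φ ∘ₗ tmulHom hC m v) x
  | add x y hx hy => rw [map_add, map_add, hx, hy, add_zero]

/-- The elements `b_i ⊗ v` generate the tensor product over `Λ`, so additive and `Λ`-linear claims
need only be tested on them. -/
theorem bandTensor_induction {P : BandComp hC n ⊗[k[T;T⁻¹]] V → Prop}
    (x : BandComp hC n ⊗[k[T;T⁻¹]] V) (h0 : P 0) (hadd : ∀ x y, P x → P y → P (x + y))
    (hsmul : ∀ (a : Lam J) x, P x → P (a • x))
    (hgen : ∀ i w v, C.pre.mu i = n → C.pre.vertexAt i = some w → P (bandGen hC n i ⊗ₜ v)) :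
    P x := by
  induction x using TensorProduct.induction_on with
  | zero => exact h0
  | add x y hx hy => exact hadd x y hx hy
  | tmul x v =>
    have h1 : tmulHom hC n v (∑ i ∈ (x : C.pre.comp n).1.support,
        (x : C.pre.comp n).1 i • C.pre.gen n i) = x ⊗ₜ v :=
      congrArg (tmulHom hC n v) (PreWord.sum_smul_gen x)
    rw [← h1, map_sum]
    refine Finset.sum_induction _ P hadd h0 fun i _ => ?_
    rw [map_smul]
    refine hsmul _ _ ?_
    by_cases h : C.pre.mu i = n ∧ ∃ v, C.pre.vertexAt i = some v
    · obtain ⟨h1, w, h2⟩ := h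
      exact hgen i w v h1 h2
    · rw [PreWord.gen_eq_zero h, map_zero]
      exact h0

variable [Module k V] [IsScalarTower k k[T;T⁻¹] V]

theorem algebraMap_smul_tmul (c : k) (x : BandComp hC n) (v : V) :
    algebraMap k (Lam J) c • (x ⊗ₜ[k[T;T⁻¹]] v) = x ⊗ₜ[k[T;T⁻¹]] (c • v) := by
  have h : c • v = (LaurentPolynomial.C c : k[T;T⁻¹]) • v := (algebraMap_smul k[T;T⁻¹] c v).symm
  rw [TensorProduct.smul_tmul', ← C_smul, h, TensorProduct.smul_tmul]

variable [FiniteDimensional k V]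

/-- The homomorphism from a free module onto `Pⁿ(C) ⊗ V`. -/
def bandCover (n : ℤ) (V : Type u) [AddCommGroup V] [Module k[T;T⁻¹] V] [Module k V]
    [FiniteDimensional k V] :
    (Fin C.period × Fin (Module.finrank k V) → Lam J) →ₗ[Lam J] BandComp hC n ⊗[k[T;T⁻¹]] V :=
  Fintype.linearCombination (Lam J) fun j => bandGen hC n j.1 ⊗ₜ Module.finBasis k V j.2

variable (J) in
/-- A coordinate of the elements of `V`, as an element of `Λ`. -/
def basisCoord (V : Type*) [AddCommGroup V] [Module k V] [FiniteDimensional k V]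
    (b : Fin (Module.finrank k V)) : V →+ Lam J :=
  (algebraMap k (Lam J) : k →+ Lam J).comp ((Module.finBasis k V).coord b : V →+ k)

theorem basisCoord_smul {V : Type*} [AddCommGroup V] [Module k V] [FiniteDimensional k V]
    (b : Fin (Module.finrank k V)) (c : k) (v : V) :
    basisCoord J V b (c • v) = algebraMap k (Lam J) c • basisCoord J V b v := by
  change algebraMap k (Lam J) ((Module.finBasis k V).coord b (c • v)) =
    algebraMap k (Lam J) c • algebraMap k (Lam J) ((Module.finBasis k V).coord b v)
  rw [map_smul, smul_eq_mul, map_mul, smul_eq_mul]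

/-- The section of `bandCover`. -/
def bandSection (n : ℤ) (V : Type u) [AddCommGroup V] [Module k[T;T⁻¹] V] [Module k V]
    [IsScalarTower k k[T;T⁻¹] V] [FiniteDimensional k V] :
    BandComp hC n ⊗[k[T;T⁻¹]] V →ₗ[Lam J] (Fin C.period × Fin (Module.finrank k V) → Lam J) :=
  LinearMap.pi fun j => bandPairing hC (j.1 : ℤ) (basisCoord J V j.2) (basisCoord_smul j.2)

/-- Writing `i = r + tp` with `0 ≤ r < p` gives `b_i ⊗ v = b_r ⊗ T ^ (-t) v`, and the section
records the coordinates of `T ^ (-t) v` in the block of `r`. Residues whose degree is not `n`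
contribute zero, as `bandGen` vanishes there. -/
theorem bandCover_bandSection (x : BandComp hC n ⊗[k[T;T⁻¹]] V) :
    bandCover hC n V (bandSection hC n V x) = x := by
  induction x using bandTensor_induction hC with
  | h0 => rw [map_zero, map_zero]
  | hadd x y hx hy => rw [map_add, map_add, hx, hy]
  | hsmul a x hx => rw [map_smul, map_smul, hx]
  | hgen i w v hn hw =>
    have hp : (0 : ℤ) < C.period := by exact_mod_cast hC.period_pos
    have hr := Int.emod_nonneg i hp.ne'
    have hr' := Int.emod_lt_of_pos i hp
    let r : Fin C.period := ⟨(i % C.period).toNat, by omega⟩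
    have hrv : ((r : ℕ) : ℤ) = i % C.period := Int.toNat_of_nonneg hr
    set v' : V := (LaurentPolynomial.T (-(i / C.period)) : k[T;T⁻¹]) • v with hv'
    have h1 : ∀ j, bandSection hC n V (bandGen hC n i ⊗ₜ v) j =
        idem J w • if j.1 = r then algebraMap k (Lam J) ((Module.finBasis k V).coord j.2 v')
          else 0 := by
      intro j
      refine (bandPairing_bandGen_tmul hC _ _ (basisCoord_smul j.2) hn hw v).trans ?_
      have h2 : i % C.period = ((j.1 : ℕ) : ℤ) ↔ j.1 = r := by
        rw [← hrv, Fin.ext_iff, Nat.cast_inj, eq_comm]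
      simp only [bandValue, h2]
      rfl
    have h2 : bandGen hC n i ⊗ₜ[k[T;T⁻¹]] v = bandGen hC n r ⊗ₜ v' := by
      have h3 : bandGen hC n i =
          (LaurentPolynomial.T (-(i / C.period)) : k[T;T⁻¹]) • bandGen hC n r := by
        rw [T_smul_bandGen, hrv]
        congr 1
        have := Int.emod_add_ediv_mul i C.period
        rw [neg_mul]
        omega
      rw [h3, TensorProduct.smul_tmul]
    -- The pairing yields coordinates multiplied by the idempotent at the vertex, which fixes the
    -- generator.
    have h3 : idem J w • bandGen hC n r ⊗ₜ[k[T;T⁻¹]] v' = bandGen hC n r ⊗ₜ v' := by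
      rw [← h2]
      have h4 : idem J w • C.pre.gen n i = C.pre.gen n i := by
        rw [PreWord.gen_eq hn hw]
        refine Subtype.ext ?_
        change idem J w • Finsupp.single i (idem J w) = _
        rw [Finsupp.smul_single, smul_eq_mul, idem_mul_idem]
      exact congrArg (tmulHom hC n v) h4
    rw [bandCover, Fintype.linearCombination_apply, Fintype.sum_prod_type,
      Finset.sum_eq_single r]
    · simp only [h1, if_true, smul_assoc, algebraMap_smul_tmul]
      rw [← Finset.smul_sum, ← TensorProduct.tmul_sum]
      have h5 : ∑ b, (Module.finBasis k V).coord b v' • Module.finBasis k V b = v' :=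
        (Module.finBasis k V).sum_repr v'
      rw [h5, h3, h2]
    · intro j _ hj
      simp [h1, hj]
    · simp

/-- Boundedness of the degrees leaves only finitely many non-zero components, which gives the bounds
on the complex and on its cohomology at once. The split surjection `bandCover` gives projectivity
and finite generation. -/
theorem isPlusB_bandComplex : IsPlusB (bandComplex hC V) := by
  obtain ⟨b, hb⟩ := mu_bounded hC
  have hsub : ∀ n, b < |n| → Subsingleton ((bandComplex hC V).X n) := by
    intro n hn
    refine subsingleton_of_forall_eq (0 : BandComp hC n ⊗[k[T;T⁻¹]] V) fun x => ?_
    change (x : BandComp hC n ⊗[k[T;T⁻¹]] V) = 0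
    refine bandTensor_induction hC (P := fun x => x = 0) x rfl ?_ ?_ ?_
    · rintro _ _ rfl rfl
      rw [add_zero]
    · rintro a _ rfl
      rw [smul_zero]
    · intro i w v hn' _
      exact absurd (hb i) (by rw [hn']; omega)
  refine ⟨fun n => ?_, fun n => ?_, ⟨-b, fun n hn => hsub n ?_⟩, b + 1, fun n hn => ?_⟩
  · exact Module.Projective.of_split (bandSection hC n V) (bandCover hC n V)
      (LinearMap.ext (bandCover_bandSection hC))
  · exact Module.Finite.of_surjective (bandCover hC n V)
      fun x => ⟨_, bandCover_bandSection hC x⟩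
  · have := neg_le_abs n
    omega
  -- Image and kernel are compared inside the component of degree `n + 1`, which is why the bound
  -- chosen is `b + 1`.
  · have : Subsingleton ((bandComplex hC V).X (n + 1)) := hsub _ (by
      rw [Set.mem_Icc] at hn
      have h1 := neg_le_abs (n + 1)
      have h2 := le_abs_self (n + 1)
      omega)
    exact Subsingleton.elim _ _

-- Let `Λ` act on `V` through the simple module at the vertex of `b₀`. The map `b₀ ⊗ v ↦ v` is then
-- unaffected by going to `Y⁰` and back, so it exhibits `V` as a quotient of the finitely generated
-- module `Y⁰`.
omit [FiniteDimensional k V] in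
theorem finiteDimensional_of_homotopyEquiv (hJ : IsGentle J)
    {Y : CochainComplex (ModuleCat.{u} (Lam J)) ℤ} (e : HomotopyEquiv (bandComplex hC V) Y)
    (hY : IsPlusB Y) : FiniteDimensional k V := by
  obtain ⟨f, hf⟩ := hC.hasPeriod.1
  obtain ⟨w, hw⟩ : ∃ w, C.pre.vertexAt 0 = some w :=
    ⟨_, PreWord.vertexAt_of_letterAt (l := f 0) (by rw [hf]; rfl)⟩
  have hmu : C.pre.mu 0 = 0 := by simp [PreWord.mu]
  let _ : Module (Lam J) V := Module.compHom V (hJ.vertexHom w)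
  have hV : ∀ (a : Lam J) (v : V), a • v = hJ.vertexHom w a • v := fun a v => rfl
  let φ : BandComp hC 0 ⊗[k[T;T⁻¹]] V →ₗ[Lam J] V :=
    bandPairing hC 0 (AddMonoidHom.id V) fun c v => by
      rw [hV, hJ.vertexHom_algebraMap]
      rfl
  have hφ : ∀ v, φ (bandGen hC 0 0 ⊗ₜ v) = v := by
    intro v
    rw [bandPairing_bandGen_tmul hC _ _ _ hmu hw, hV, hJ.vertexHom_idem, one_smul, bandValue,
      if_pos (Int.zero_emod _), Int.zero_ediv, neg_zero, LaurentPolynomial.T_zero, one_smul]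
    rfl
  have h1 := map_inv_hom_apply (X := bandComplex hC V) (M := V) (fun n m ψ x h => by
    exact (congrArg ψ (bandComplex_d_apply hC h x)).trans (map_bandDiff_eq_zero hC (fun l y => by
      rw [hV, Letter.cls, hJ.vertexHom_pathClass, zero_smul]) h ψ x)) e (n := 0) φ
  have hfin : Module.Finite (Lam J) V := by
    have := hY.finite 0
    refine Module.Finite.of_surjective (φ ∘ₗ (e.inv.f 0).hom) fun v =>
      ⟨e.hom.f 0 (bandGen hC 0 0 ⊗ₜ v : BandComp hC 0 ⊗[k[T;T⁻¹]] V), ?_⟩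
    exact (h1 _).trans (hφ v)
  -- Since `Λ` acts on `V` through a surjection onto `k`, finite generation over `Λ` is finite
  -- generation over `k`.
  have : RingHomSurjective (hJ.vertexHom w) :=
    ⟨fun c => ⟨algebraMap k (Lam J) c, hJ.vertexHom_algebraMap w c⟩⟩
  exact Module.Finite.of_surjective
    ({ toFun := id, map_add' := fun _ _ => rfl, map_smul' := fun a v => hV a v } :
      V →ₛₗ[hJ.vertexHom w] V) Function.surjective_id

end Word

end Bands

end GentleAlgebra

end

/-- Let `kQ / J` be a gentle algebra, with a choice of signs `s`. A string complex `P(A)` lies in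
`K^{+,b}(Λ-proj)` if and only if, up to a shift of the indexing of `A`, it is `P(C)`, `P(C(↙))`,
`P(C(↘))` or `P(C(↙↘))` for some finite generalised word `C`. A shift of a band complex `P(D,V)` lies
in `K^{+,b}(Λ-proj)` if and only if `V` is finite-dimensional over `k`. -/
theorem proposition3 {k : Type u} [Field k] {Q : Type u} [Quiver.{u} Q] [Fintype Q]
    (J : TwoSidedIdeal (PathAlgebra k Q)) (hJ : IsGentle J) (s : SignChoice J) :
    (∀ A : Word J,
      (A.IsAperiodic ∧ InKPlusB ((HomotopyCategory.quotient _ _).obj A.stringComplex)) ↔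
        ∃ C : Word J, C.IsFinite ∧ ∃ t : ℤ,
          A = C.shift t ∨ A = (C.sw s).shift t ∨ A = (C.se s).shift t ∨
            A = (C.swse s).shift t) ∧
    (∀ (D : Word J) (hD : D.IsPeriodic) (V : Type u) [AddCommGroup V] [Module k V]
      [Module k[T;T⁻¹] V] [IsScalarTower k k[T;T⁻¹] V],
      Indecomposable (ModuleCat.of k[T;T⁻¹] V) → ∀ n : ℤ,
        (InKPlusB (((HomotopyCategory.quotient _ _).obj (Word.bandComplex hD V))⟦n⟧) ↔
          FiniteDimensional k V)) := by
  -- Membership in `K^{+,b}` becomes a condition on the word alone, and what remains of (i) is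
  -- combinatorial.
  have key : ∀ A : Word J,
      InKPlusB ((HomotopyCategory.quotient _ _).obj A.stringComplex) ↔ A.pre.HasResolvingEnds := by
    refine fun A => ⟨?_, fun h => ⟨_, hJ.isPlusB_stringComplex h, ⟨Iso.refl _⟩⟩⟩
    rintro ⟨Y, hY, ⟨e⟩⟩
    exact hJ.hasResolvingEnds_of_homotopyEquiv (HomotopyCategory.homotopyEquivOfIso e) hY
  refine ⟨fun A => ⟨?_, ?_⟩, fun D hD V _ _ _ _ _ n => ?_⟩
  · rintro ⟨-, h⟩
    exact Word.exists_eq_of_hasResolvingEnds hJ s ((key A).1 h)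
  · rintro ⟨C, hC, t, h⟩
    have hA : A.pre.HasResolvingEnds := by
      have h0 := hC.hasResolvingEnds
      rcases h with rfl | rfl | rfl | rfl
      · exact h0.shift t
      · exact (Word.hasResolvingEnds_sw h0 s).shift t
      · exact (Word.hasResolvingEnds_se h0 s).shift t
      · exact (Word.hasResolvingEnds_swse h0 s).shift t
    -- Aperiodicity comes from the same condition: a periodic word returns to one degree infinitely
    -- often.
    exact ⟨fun h => h.not_hasResolvingEnds hA, (key A).2 hA⟩
  · rw [inKPlusB_shift_iff]
    constructor
    · rintro ⟨Y, hY, ⟨e⟩⟩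
      exact Word.finiteDimensional_of_homotopyEquiv hD hJ
        (HomotopyCategory.homotopyEquivOfIso e) hY
    · intro _
      exact ⟨_, Word.isPlusB_bandComplex hD, ⟨Iso.refl _⟩⟩
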